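/- Call a polynomial $p\in\mathbb{Z}[z]$ odd if $p(z)$ is odd for every $z\in\mathbb{Z}$, and non-odd otherwise. For $p(z)=a_dz^d+\dots+a_0$ of degree $d$ let $\|p\|=d+\sum_{i=0}^d|a_i|$. For a positive integer $n$ let $[n]=\{1,\dots,n\}$, and for a $2$-coloring $\phi$ of $[n]$ let $S_p(n,\phi)$ be the number of ordered triples $(x,y,z)\in[n]^3$ with $x+y=p(z)$ and $\phi(x)=\phi(y)=\phi(z)$. **Theorem 1.3.** Let $p\in\mathbb{Z}[z]$ be a non-odd polynomial of degree $d\ge 2$ with positive leading coefficient. There are a function $\varepsilon:\mathbb{N}\to\mathbb{R}$ with $\varepsilon(n)\to 0$ as $n\to\infty$, constants $c,C,C'>0$ and an integer $n_0$, all depending only on $d$ and $\|p\|$, such that the following hold. 1. For all $n\ge n_0$ and every $2$-coloring $\phi$ of $[n]$, $S_p(n,\phi)\ge n^{2/d^2-\varepsilon(n)}$. 2. More precisely, for all $n\ge n_0$ and every $2$-coloring $\phi$ of $[n]$, $$S_p(n,\phi)\ \ge\ c\,\frac{n^{2/d^2}}{\log_2 n}\quad\text{if } d\ge 3,\qquad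 S_p(n,\phi)\ \ge\ n^{\frac{2}{d^2}-\frac{C}{\log_2\log_2 n}}\quad\text{if } d=2.$$ 3. The exponent $2/d^2$ is tight: for every $n\ge 1$ there is a $2$-coloring $\phi$ of $[n]$ with $S_p(n,\phi)\le C'\,n^{2/d^2}$. -/

import Mathlib

open Filter Topology Polynomial

/-- A polynomial with integer coefficients is odd if all its values at integers are odd. -/
def IsOddPoly (p : ℤ[X]) : Prop := ∀ z : ℤ, Odd (p.eval z)

/-- The norm `‖p‖ = d + ∑_{i=0}^d |a_i|` of `p = a_d z^d + ⋯ + a_0`, where `d` is the degree. -/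
def polyNorm (p : ℤ[X]) : ℕ :=
  p.natDegree + ∑ i ∈ Finset.range (p.natDegree + 1), (p.coeff i).natAbs

/-- The non-odd integer polynomials of degree `d` with positive leading coefficient and norm `K`. -/
def nonOddPolys (d K : ℕ) : Set ℤ[X] :=
  {p | p.natDegree = d ∧ 0 < p.leadingCoeff ∧ ¬ IsOddPoly p ∧ polyNorm p = K}

/-- The monochromatic solutions `(x, y, z) ∈ {1, …, n}³` of `x + y = p(z)` for the 2-coloring `φ`
(only the values of `φ` on `{1, …, n}` matter). The triples are ordered: `(x, y, z)` and
`(y, x, z)` with `x ≠ y` are two different solutions. -/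
noncomputable def monoSolutions (p : ℤ[X]) (n : ℕ) (φ : ℕ → Bool) : Finset (ℕ × ℕ × ℕ) :=
  (Finset.Icc 1 n ×ˢ Finset.Icc 1 n ×ˢ Finset.Icc 1 n).filter fun t =>
    (t.1 : ℤ) + (t.2.1 : ℤ) = p.eval (t.2.2 : ℤ) ∧ φ t.1 = φ t.2.1 ∧ φ t.2.1 = φ t.2.2

/-!
Let `P` be the polynomial, of degree `d`. Join two integers by an edge with label `w` if their sum
is `P w`. An edge is bad if its ends have the color of its label, so that bad edges are
monochromatic solutions. It suffices to find `c * M ^ 2` bad edges if `n` is about `M ^ (d ^ 2)`;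
this bound is free of the logarithmic losses that the theorem permits.

*Moves.* Let the labels `r`, `b` have the colors `R`, `!R`. If `x` has the color `R`, then, without
bad edges, `P r - x` has the color `!R`, and `P b - (P r - x)` has the color `R` again. So
translation by `P b - P r` preserves the color `R` up to bad edges (`bad_of_move`).

*One direction only.* Suppose that there are both upward and downward moves near a label `v`. They
are combined with moves that use the labels `v, …, v + d`. Since every multiple of the constant
`d`-th difference `g` of `P` is an integer combination of `P v, …, P (v + d)` with coefficients
`O(v)`, all small translations by multiples of `g` are compositions of `O(v)` moves
(`exists_moves`). So a long progression of difference `g` centered at half an even value of `P` is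
almost monochromatic (`exists_majority`), and the edges of a label of its color, which reflect the
progression to itself, are mostly bad (`card_le_of_reflect`). Even values are available since `P` is
not odd. Hence, if the labels have `o(v ^ (d - 1))` bad edges each, the moves of the order of `v` all
go in the same direction (`Growth.two_sided`).

*Degree at least three.* Assume that there are fewer than `c * M ^ 2` bad edges. Since
`2 ≤ d - 1`, the last result applies to all labels above about `M`. If the color is constant
between `M` and `O(M ^ d)`, then all edges of `x` and `w` of the order of `M` are bad. Otherwise it
switches at some `z` and is constant on both sides of `z`. Then moves that use one label above and
one label below `z` lead from `P w - x`, where `x` and `w` are below `z`, down to a number below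
`z`, and there is a bad edge on the way. That the target is reached is ensured by
`O(log z)` gadgets whose two states differ by finite differences of `P` of order at least two, with
steps the powers of two (`Growth.exists_gadgets`). Few of them share a label, so that the chains for
all `x`, `w` give `c * z ^ 2` different bad edges (`card_chains_le`, `Growth.one_sided`).

*Degree two.* The number of bad edges is small for most labels only. Outside of a small set of
labels the same dichotomy holds (`Growth.not_rises`), and in the second case an identity of the form
`(2 * j - 1) ^ 2 + (4 * h) ^ 2 = (2 * j + 1) ^ 2` provides three labels on the two sides of `z` with
`P w₀ + P w₁ - P w₂` of the order of `z`. The chains of three edges along them replace the long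
chains (`Growth.sq_le_card_of_separated`).

*The upper bound.* Let `N` be the largest `m ≤ n` with `P m ≤ 2 * n`, about `n ^ (1 / d)`. The
numbers `m` with `m > N` or `P m ≤ 2 * N` get one color, and the others get the other color. Then
all solutions with a label `z` such that `P z > 2 * N` are excluded, and only
`O(n ^ (1 / d ^ 2))` labels are left (`exists_card_le_rpow`).
-/

open scoped fwdDiff

/-! ### Finite differences of polynomials -/

/-- Mean value theorem for iterated forward differences of a polynomial. -/
theorem exists_fwdDiff_eq (k : ℕ) : ∀ (q : ℝ[X]) (x : ℝ) {h : ℝ}, 0 < h →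
    ∃ ξ ∈ Set.Icc x (x + k * h),
      (Δ_[h] ^[k] fun t => q.eval t) x = h ^ k * (derivative^[k] q).eval ξ := by
  induction k with
  | zero => intro q x h hh; exact ⟨x, by simp, by simp⟩
  | succ k ih =>
    intro q x h hh
    have hcomp : ∀ (k : ℕ) (q : ℝ[X]),
        derivative^[k] (q.comp (X + C h)) = (derivative^[k] q).comp (X + C h) := by
      intro k
      induction k with
      | zero => intro q; simp
      | succ k ih' => intro q; rw [Function.iterate_succ_apply, Function.iterate_succ_apply,
          derivative_comp, ← ih']; simp
    -- the first difference of `q` is a polynomial, to which the induction hypothesis applies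
    have hΔ : (Δ_[h] fun t => q.eval t) = fun t => (q.comp (X + C h) - q).eval t := by
      ext t; simp [fwdDiff]
    rw [Function.iterate_succ_apply, hΔ]
    obtain ⟨ξ, hξ, he⟩ := ih (q.comp (X + C h) - q) x hh
    obtain ⟨c, hc, hs⟩ := exists_deriv_eq_slope (fun t => (derivative^[k] q).eval t)
      (show ξ < ξ + h by linarith) (Polynomial.continuous _).continuousOn
      (Polynomial.differentiable _).differentiableOn
    refine ⟨c, ⟨by linarith [hc.1, hξ.1], by push_cast; linarith [hc.2, hξ.2]⟩, ?_⟩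
    rw [he, iterate_derivative_sub, hcomp, Function.iterate_succ_apply']
    rw [Polynomial.deriv] at hs
    rw [hs, add_sub_cancel_left]
    simp only [eval_sub, eval_comp, eval_add, eval_X, eval_C]
    field_simp
    ring

/-- Quantitative growth of an integer-valued function which behaves like a polynomial of degree `d`
with positive leading coefficient: for `x ≥ z₀` its iterated forward differences of order `k ≤ d`
and step `h` are, up to constants, `h ^ k * x ^ (d - k)`; its `d`-th difference is the constant `g`;
and, of two consecutive values, one is even, which is what a non-odd polynomial provides. The
factor `2` in the lower bound keeps all constants integral. -/
structure Growth (P : ℤ → ℤ) (d : ℕ) (C g z₀ : ℤ) : Prop where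
  one_le_C : 1 ≤ C
  one_le_z₀ : 1 ≤ z₀
  fd : ∀ k ≤ d, ∀ h : ℤ, 1 ≤ h → ∀ x : ℤ, z₀ ≤ x →
    h ^ k * x ^ (d - k) ≤ 2 * (Δ_[h] ^[k] P) x ∧
      (Δ_[h] ^[k] P) x ≤ C * (h ^ k * (x + k * h) ^ (d - k))
  top : ∀ x, (Δ_[1] ^[d] P) x = g
  even : ∀ x, Even (P x) ∨ Even (P (x + 1))

/-- Far out, the derivatives of a polynomial with leading coefficient at least `1` are of the order
of the corresponding powers. -/
theorem eventually_derivative_bounds (q : ℝ[X]) {d : ℕ} (hd : q.natDegree = d)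
    (hq : 1 ≤ q.leadingCoeff) {k : ℕ} (hk : k ≤ d) :
    ∃ C : ℝ, ∀ᶠ x : ℝ in atTop, x ^ (d - k) ≤ 2 * (derivative^[k] q).eval x ∧
      (derivative^[k] q).eval x ≤ C * x ^ (d - k) := by
  set r := derivative^[k] q with hr
  have hcoef : r.coeff (d - k) = (d.descFactorial k : ℝ) * q.leadingCoeff := by
    rw [hr, coeff_iterate_derivative, Nat.sub_add_cancel hk, nsmul_eq_mul, leadingCoeff, hd]
  have h1 : (1 : ℝ) ≤ d.descFactorial k := by
    exact_mod_cast Nat.succ_le_of_lt (Nat.descFactorial_pos.2 hk)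
  have hpos : 1 ≤ r.coeff (d - k) := by rw [hcoef]; nlinarith
  have hdeg : r.natDegree = d - k := by
    apply le_antisymm
    · rw [← hd]; exact natDegree_iterate_derivative q k
    · exact le_natDegree_of_ne_zero (by linarith)
  have hlead : r.leadingCoeff = r.coeff (d - k) := by rw [leadingCoeff, hdeg]
  have hequiv := r.isEquivalent_atTop_lead
  rw [hdeg, hlead] at hequiv
  have ho := hequiv.isLittleO.def (show (0 : ℝ) < 1 / 2 by norm_num)
  refine ⟨2 * r.coeff (d - k), ?_⟩
  filter_upwards [ho, eventually_ge_atTop 1] with x hx hx1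
  have hxp : (0 : ℝ) < x ^ (d - k) := by positivity
  simp only [Pi.sub_apply, Real.norm_eq_abs] at hx
  rw [abs_of_pos (a := r.coeff (d - k) * x ^ (d - k)) (by positivity)] at hx
  have := abs_le.1 hx
  constructor <;> nlinarith

theorem cast_fwdDiff_iter (p : ℤ[X]) (k : ℕ) (h x : ℤ) :
    (((Δ_[h] ^[k] fun t : ℤ => p.eval t) x : ℤ) : ℝ) =
      (Δ_[(h : ℝ)] ^[k] fun t => (p.map (Int.castRingHom ℝ)).eval t) (x : ℝ) := by
  rw [fwdDiff_iter_eq_sum_shift, fwdDiff_iter_eq_sum_shift]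
  push_cast
  refine Finset.sum_congr rfl fun i _ => ?_
  have : ((x : ℝ) + i • (h : ℝ)) = ((x + i • h : ℤ) : ℝ) := by push_cast; simp
  rw [this, Polynomial.eval_intCast_map]
  simp

theorem exists_growth (p : ℤ[X]) {d : ℕ} (hd : p.natDegree = d) (hlead : 0 < p.leadingCoeff)
    (hodd : ¬ IsOddPoly p) : ∃ C g z₀, Growth (fun x => p.eval x) d C g z₀ := by
  set q : ℝ[X] := p.map (Int.castRingHom ℝ) with hq
  have hinj : Function.Injective (Int.castRingHom ℝ) := Int.cast_injective
  have hqd : q.natDegree = d := by rw [hq, natDegree_map_eq_of_injective hinj, hd]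
  have hql : 1 ≤ q.leadingCoeff := by
    rw [hq, leadingCoeff_map_of_injective hinj]
    have : (1 : ℤ) ≤ p.leadingCoeff := hlead
    simpa using (Int.cast_le (R := ℝ)).2 this
  have hb : ∀ k : ℕ, ∃ C : ℝ, k ≤ d → ∀ᶠ x : ℝ in atTop,
      x ^ (d - k) ≤ 2 * (derivative^[k] q).eval x ∧
      (derivative^[k] q).eval x ≤ C * x ^ (d - k) := by
    intro k
    by_cases hk : k ≤ d
    · obtain ⟨C, hC⟩ := eventually_derivative_bounds q hqd hql hk
      exact ⟨C, fun _ => hC⟩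
    · exact ⟨0, fun h => absurd h hk⟩
  choose C hC using hb
  have hall : ∀ᶠ x : ℝ in atTop, ∀ k ∈ Finset.range (d + 1),
      x ^ (d - k) ≤ 2 * (derivative^[k] q).eval x ∧
      (derivative^[k] q).eval x ≤ C k * x ^ (d - k) :=
    (Finset.eventually_all _).2 fun k hk => hC k (by simpa [Nat.lt_succ_iff] using hk)
  obtain ⟨x₀, hx₀⟩ := eventually_atTop.1 hall
  obtain ⟨C', hC'⟩ : ∃ C', ∀ k ∈ Finset.range (d + 1), C k ≤ C' := by
    obtain ⟨C', h⟩ := ((Finset.range (d + 1)).image C).exists_le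
    exact ⟨C', fun k hk => h _ (Finset.mem_image_of_mem C hk)⟩
  refine ⟨max 1 ⌈C'⌉, (d.factorial : ℤ) * p.leadingCoeff, max 1 ⌈x₀⌉, le_max_left _ _,
    le_max_left _ _, ?_, ?_, ?_⟩
  · intro k hk h hh x hx
    have hh0 : (0 : ℝ) < h := by exact_mod_cast hh
    obtain ⟨ξ, hξ, he⟩ := exists_fwdDiff_eq k q (x : ℝ) hh0
    have hx1 : (1 : ℝ) ≤ x := by exact_mod_cast (le_max_left _ _).trans hx
    have hxx : x₀ ≤ x := (Int.le_ceil _).trans (by exact_mod_cast (le_max_right _ _).trans hx)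
    have hkm : k ∈ Finset.range (d + 1) := by simpa [Nat.lt_succ_iff] using hk
    obtain ⟨hl, hu⟩ := hx₀ ξ (hxx.trans hξ.1) k hkm
    have hcast := cast_fwdDiff_iter p k h x
    rw [he] at hcast
    have hCC : C k ≤ (max 1 ⌈C'⌉ : ℤ) :=
      (hC' k hkm).trans ((Int.le_ceil _).trans (by exact_mod_cast le_max_right _ _))
    have hξ1 : 1 ≤ ξ := hx1.trans hξ.1
    have hC0 : (0 : ℝ) ≤ (max 1 ⌈C'⌉ : ℤ) := by
      exact_mod_cast le_trans (by norm_num) (le_max_left 1 ⌈C'⌉)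
    constructor
    · have : ((h ^ k * x ^ (d - k) : ℤ) : ℝ) ≤
          ((2 * (Δ_[h] ^[k] fun x => p.eval x) x : ℤ) : ℝ) := by
        rw [Int.cast_mul 2, hcast]
        push_cast
        have h1 : (x : ℝ) ^ (d - k) ≤ ξ ^ (d - k) := by
          apply pow_le_pow_left₀ (by linarith) hξ.1
        have h2 : (0 : ℝ) < (h : ℝ) ^ k := by positivity
        nlinarith
      exact_mod_cast this
    · have : (((Δ_[h] ^[k] fun x => p.eval x) x : ℤ) : ℝ) ≤
          ((max 1 ⌈C'⌉ * (h ^ k * (x + k * h) ^ (d - k)) : ℤ) : ℝ) := by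
        rw [hcast]
        have h1 : ξ ^ (d - k) ≤ ((x : ℝ) + k * h) ^ (d - k) := by
          apply pow_le_pow_left₀ (by linarith) hξ.2
        have h2 : (0 : ℝ) < (h : ℝ) ^ k := by positivity
        have h3 : (0 : ℝ) < ξ ^ (d - k) := by positivity
        calc (h : ℝ) ^ k * (derivative^[k] q).eval ξ
            ≤ (h : ℝ) ^ k * ((max 1 ⌈C'⌉ : ℤ) * ((x : ℝ) + k * h) ^ (d - k)) := by
              gcongr
              calc _ ≤ C k * ξ ^ (d - k) := hu
                _ ≤ (max 1 ⌈C'⌉ : ℤ) * ξ ^ (d - k) := by gcongr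
                _ ≤ _ := by gcongr
          _ = _ := by push_cast; ring
      exact_mod_cast this
  · intro x
    have := congrFun (Polynomial.fwdDiff_iter_degree_eq_factorial p) x
    rw [hd] at this
    simpa [mul_comm] using this
  · intro x
    have hpar : ∀ a b : ℤ, Even (a - b) → Even (p.eval a) → Even (p.eval b) := by
      intro a b hab ha
      have h1 : a - b ∣ p.eval a - p.eval b := sub_dvd_eval_sub a b p
      have h2 : Even (p.eval a - p.eval b) :=
        even_iff_two_dvd.2 ((even_iff_two_dvd.1 hab).trans h1)
      exact (Int.even_sub.1 h2).1 ha
    simp only [IsOddPoly, not_forall, Int.not_odd_iff_even] at hodd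
    obtain ⟨z, hz⟩ := hodd
    rcases Int.even_or_odd (z - x) with h | h
    · exact Or.inl (hpar z x h hz)
    · refine Or.inr (hpar z (x + 1) ?_ hz)
      rw [show z - (x + 1) = (z - x) - 1 by ring]
      exact h.sub_odd odd_one

namespace Growth

variable {P : ℤ → ℤ} {d : ℕ} {C g z₀ : ℤ}

theorem pow_le (G : Growth P d C g z₀) {x : ℤ} (hx : z₀ ≤ x) : x ^ d ≤ 2 * P x := by
  simpa using (G.fd 0 (Nat.zero_le _) 1 le_rfl x hx).1

theorem le_pow (G : Growth P d C g z₀) {x : ℤ} (hx : z₀ ≤ x) : P x ≤ C * x ^ d := by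
  simpa using (G.fd 0 (Nat.zero_le _) 1 le_rfl x hx).2

theorem le_sub (G : Growth P d C g z₀) (hd : 1 ≤ d) {x y : ℤ} (hx : z₀ ≤ x) (hxy : x ≤ y) :
    (y - x) * x ^ (d - 1) ≤ 2 * (P y - P x) := by
  rcases hxy.eq_or_lt with rfl | h
  · simp
  · simpa [fwdDiff] using (G.fd 1 hd (y - x) (by linarith) x hx).1

theorem sub_le (G : Growth P d C g z₀) (hd : 1 ≤ d) {x y : ℤ} (hx : z₀ ≤ x) (hxy : x ≤ y) :
    P y - P x ≤ C * ((y - x) * y ^ (d - 1)) := by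
  rcases hxy.eq_or_lt with rfl | h
  · simp
  · simpa [fwdDiff] using (G.fd 1 hd (y - x) (by linarith) x hx).2

theorem mono (G : Growth P d C g z₀) (hd : 1 ≤ d) {x y : ℤ} (hx : z₀ ≤ x) (hxy : x ≤ y) :
    P x ≤ P y := by
  have h1 := G.le_sub hd hx hxy
  have h2 : 0 ≤ (y - x) * x ^ (d - 1) :=
    mul_nonneg (by linarith) (pow_nonneg (by linarith [G.one_le_z₀]) _)
  linarith

theorem lt (G : Growth P d C g z₀) (hd : 1 ≤ d) {x y : ℤ} (hx : z₀ ≤ x) (hxy : x < y) :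
    P x < P y := by
  have h1 := G.le_sub hd hx hxy.le
  have h2 : 0 < (y - x) * x ^ (d - 1) :=
    mul_pos (by linarith) (pow_pos (by linarith [G.one_le_z₀]) _)
  linarith

theorem one_le_g (G : Growth P d C g z₀) : 1 ≤ g := by
  have := (G.fd d le_rfl 1 le_rfl z₀ le_rfl).1
  rw [G.top] at this
  simp at this
  omega

end Growth

/-! ### Bad edges, and the moves along two edges -/

/-- The pairs `(x, w)` for which `(x, P w - x, w)` is a monochromatic solution in `[1, n]`, for the
coloring `χ`. Such a solution is viewed as a bad edge `{x, P w - x}` with label `w` of the graph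
that joins any two integers of sum `P w`. The edge is recorded together with one of its endpoints,
so that the pairs correspond to ordered solutions. -/
noncomputable def badPairs (P : ℤ → ℤ) (n : ℤ) (χ : ℤ → Bool) : Finset (ℤ × ℤ) :=
  (Finset.Icc 1 n ×ˢ Finset.Icc 1 n).filter fun t =>
    (1 ≤ P t.2 - t.1 ∧ P t.2 - t.1 ≤ n) ∧ χ t.1 = χ t.2 ∧ χ (P t.2 - t.1) = χ t.2

/-- The endpoints of the bad edges with label `w`. -/
noncomputable def badAt (P : ℤ → ℤ) (n : ℤ) (χ : ℤ → Bool) (w : ℤ) : Finset ℤ :=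
  (Finset.Icc 1 n).filter fun x => (x, w) ∈ badPairs P n χ

section
variable {P : ℤ → ℤ} {n : ℤ} {χ : ℤ → Bool}

theorem mem_badPairs {x w : ℤ} : (x, w) ∈ badPairs P n χ ↔
    ((1 ≤ x ∧ x ≤ n) ∧ (1 ≤ w ∧ w ≤ n)) ∧ (1 ≤ P w - x ∧ P w - x ≤ n) ∧
      χ x = χ w ∧ χ (P w - x) = χ w := by
  simp [badPairs]

theorem mem_badAt {x w : ℤ} : x ∈ badAt P n χ w ↔ (x, w) ∈ badPairs P n χ := by
  simp only [badAt, Finset.mem_filter, Finset.mem_Icc, and_iff_right_iff_imp]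
  intro h
  exact (mem_badPairs.1 h).1.1

theorem sum_card_badAt_le {ι : Type*} (s : Finset ι) (f : ι → ℤ) (hf : Set.InjOn f s) :
    ∑ i ∈ s, (badAt P n χ (f i)).card ≤ (badPairs P n χ).card := by
  classical
  rw [← Finset.card_sigma]
  refine Finset.card_le_card_of_injOn (fun t => (t.2, f t.1)) ?_ ?_
  · intro t ht
    have ht := Finset.mem_sigma.1 (Finset.mem_coe.1 ht)
    exact mem_badAt.1 ht.2
  · rintro ⟨i, x⟩ ht ⟨j, y⟩ ht' h
    have ht := Finset.mem_sigma.1 (Finset.mem_coe.1 ht)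
    have ht' := Finset.mem_sigma.1 (Finset.mem_coe.1 ht')
    simp only [Prod.mk.injEq] at h
    obtain rfl := hf ht.1 ht'.1 h.2
    obtain rfl := h.1
    rfl

theorem card_badAt_le (w : ℤ) : (badAt P n χ w).card ≤ (badPairs P n χ).card := by
  simpa using sum_card_badAt_le (P := P) (n := n) (χ := χ) {w} id (by simp)

/-- Along an edge with label `r` and then an edge with label `b` of the other color, a number of
the color of `r` moves to a number of the same color, unless one of the two edges is bad. -/
theorem bad_of_move {R : Bool} {r b y : ℤ} (hr : χ r = R) (hb : χ b = !R)
    (hrn : 1 ≤ r ∧ r ≤ n) (hbn : 1 ≤ b ∧ b ≤ n) (hy : 1 ≤ y ∧ y ≤ n)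
    (hy' : 1 ≤ P r - y ∧ P r - y ≤ n) (hy'' : 1 ≤ y + (P b - P r) ∧ y + (P b - P r) ≤ n)
    (h1 : χ y = R) (h2 : χ (y + (P b - P r)) ≠ R) :
    y ∈ badAt P n χ r ∨ P r - y ∈ badAt P n χ b := by
  by_cases h : χ (P r - y) = R
  · left
    rw [mem_badAt, mem_badPairs]
    exact ⟨⟨hy, hrn⟩, hy', by rw [h1, hr], by rw [h, hr]⟩
  · right
    rw [mem_badAt, mem_badPairs]
    have he : P b - (P r - y) = y + (P b - P r) := by ring
    rw [he]
    exact ⟨⟨hy', hbn⟩, hy'', by rw [hb]; exact Bool.eq_not.2 h, by rw [hb]; exact Bool.eq_not.2 h2⟩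

/-- The move along labels `r`, `b` of different colors changes the color `R` of few elements of
`Y + o`: each exception is an endpoint of a bad edge with label `r` or `b`. -/
theorem card_move_le {R : Bool} {r b : ℤ} (hr : χ r = R) (hb : χ b = !R)
    (hrn : 1 ≤ r ∧ r ≤ n) (hbn : 1 ≤ b ∧ b ≤ n) (Y : Finset ℤ) (o : ℤ)
    (hy : ∀ y ∈ Y, 1 ≤ y + o ∧ y + o ≤ n)
    (hy' : ∀ y ∈ Y, 1 ≤ P r - (y + o) ∧ P r - (y + o) ≤ n)
    (hy'' : ∀ y ∈ Y, 1 ≤ y + (o + (P b - P r)) ∧ y + (o + (P b - P r)) ≤ n) :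
    (Y.filter fun y => χ (y + o) = R ∧ χ (y + (o + (P b - P r))) ≠ R).card ≤
      (badAt P n χ r).card + (badAt P n χ b).card := by
  classical
  have hsub : (Y.filter fun y => χ (y + o) = R ∧ χ (y + (o + (P b - P r))) ≠ R) ⊆
      (badAt P n χ r).image (fun x => x - o) ∪ (badAt P n χ b).image (fun x => P r - x - o) := by
    intro y hyF
    obtain ⟨hyY, h1, h2⟩ := Finset.mem_filter.1 hyF
    have hy3 := hy'' y hyY
    rw [← add_assoc] at h2 hy3
    rw [Finset.mem_union, Finset.mem_image, Finset.mem_image]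
    rcases bad_of_move hr hb hrn hbn (hy y hyY) (hy' y hyY) hy3 h1 h2 with h | h
    · exact Or.inl ⟨_, h, by ring⟩
    · exact Or.inr ⟨_, h, by ring⟩
  calc _ ≤ _ := Finset.card_le_card hsub
    _ ≤ _ := Finset.card_union_le _ _
    _ ≤ _ := add_le_add Finset.card_image_le Finset.card_image_le

/-- Moves `y ↦ y + (P (b i) - P (r i))`, the `i`-th one made `c i` times, preserve the color `R` up
to `E` exceptions for each move. The moves are ordered so that the partial sums stay in
`[-A, A]`: a nonnegative partial sum is followed by a negative move, if one is left. -/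
theorem card_moves_le {ι : Type*} [Fintype ι] {R : Bool} {r b : ι → ℤ}
    (hr : ∀ i, χ (r i) = R) (hb : ∀ i, χ (b i) = !R)
    (hrn : ∀ i, 1 ≤ r i ∧ r i ≤ n) (hbn : ∀ i, 1 ≤ b i ∧ b i ≤ n) {A : ℤ} {E : ℕ}
    (hA : ∀ i, |P (b i) - P (r i)| ≤ A)
    (hE : ∀ i, (badAt P n χ (r i)).card + (badAt P n χ (b i)).card ≤ E) (Y : Finset ℤ)
    (hY : ∀ y ∈ Y, ∀ o, |o| ≤ A → (1 ≤ y + o ∧ y + o ≤ n) ∧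
      ∀ i, 1 ≤ P (r i) - (y + o) ∧ P (r i) - (y + o) ≤ n) :
    ∀ (s : ℕ) (c : ι → ℕ), ∑ i, c i = s → ∀ o : ℤ, |o| ≤ A →
      |o + ∑ i, (c i : ℤ) * (P (b i) - P (r i))| ≤ A →
      (Y.filter fun y => χ (y + o) = R ∧
        χ (y + (o + ∑ i, (c i : ℤ) * (P (b i) - P (r i)))) ≠ R).card ≤ s * E := by
  classical
  intro s
  induction s with
  | zero =>
    intro c hc o ho hN
    have h0 : ∀ i, c i = 0 := by simpa using hc
    simp [h0]
  | succ s ih =>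
    intro c hc o ho hN
    set D : ι → ℤ := fun i => P (b i) - P (r i) with hD
    -- a next move that stays in the window
    have hex : ∃ i, 0 < c i ∧ |o + D i| ≤ A := by
      obtain ⟨j, hj⟩ : ∃ j, 0 < c j := by
        by_contra! h
        have : ∑ i, c i = 0 := Finset.sum_eq_zero fun i _ => by have := h i; omega
        omega
      rw [abs_le] at ho hN
      by_cases ho0 : 0 ≤ o
      · by_cases hneg : ∃ i, 0 < c i ∧ D i ≤ 0
        · obtain ⟨i, hi, hDi⟩ := hneg
          have := abs_le.1 (hA i)
          exact ⟨i, hi, abs_le.2 ⟨by simp only [hD]; linarith, by linarith⟩⟩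
        · -- all remaining moves are upward, so no partial sum exceeds the total
          push Not at hneg
          have h1 : (c j : ℤ) * D j ≤ ∑ i, (c i : ℤ) * D i := by
            refine Finset.single_le_sum (f := fun i => (c i : ℤ) * D i) (fun i _ => ?_)
              (Finset.mem_univ j)
            rcases Nat.eq_zero_or_pos (c i) with h | h
            · simp [h]
            · exact mul_nonneg (by positivity) (hneg i h).le
          have h2 : D j ≤ (c j : ℤ) * D j := by
            have : (1 : ℤ) ≤ c j := by exact_mod_cast hj
            nlinarith [hneg j hj]
          exact ⟨j, hj, abs_le.2 ⟨by linarith [hneg j hj], by linarith⟩⟩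
      · by_cases hpos : ∃ i, 0 < c i ∧ 0 ≤ D i
        · obtain ⟨i, hi, hDi⟩ := hpos
          have := abs_le.1 (hA i)
          exact ⟨i, hi, abs_le.2 ⟨by linarith, by simp only [hD]; linarith⟩⟩
        · -- all remaining moves are downward
          push Not at hpos
          have h1 : ∑ i, (c i : ℤ) * D i ≤ (c j : ℤ) * D j := by
            have := Finset.single_le_sum (f := fun i => -((c i : ℤ) * D i)) (fun i _ => ?_)
              (Finset.mem_univ j)
            · rw [Finset.sum_neg_distrib] at this; linarith
            · rcases Nat.eq_zero_or_pos (c i) with h | h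
              · simp [h]
              · have := hpos i h
                have h' : (0 : ℤ) < c i := by exact_mod_cast h
                show 0 ≤ -((c i : ℤ) * D i)
                nlinarith
          have h2 : (c j : ℤ) * D j ≤ D j := by
            have : (1 : ℤ) ≤ c j := by exact_mod_cast hj
            nlinarith [hpos j hj]
          exact ⟨j, hj, abs_le.2 ⟨by linarith, by linarith [hpos j hj]⟩⟩
    obtain ⟨i, hi, hoi⟩ := hex
    set c' : ι → ℕ := Function.update c i (c i - 1) with hc'
    have hcc : c = c' + Pi.single i 1 := by
      ext j
      by_cases hj : j = i
      · subst hj; simp [hc']; omega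
      · simp [hc', hj]
    have hs' : ∑ j, c' j = s := by
      rw [hcc] at hc
      simp only [Pi.add_apply, Finset.sum_add_distrib, Finset.sum_pi_single', Finset.mem_univ,
        if_true] at hc
      omega
    have hsum : ∑ j, (c j : ℤ) * D j = D i + ∑ j, (c' j : ℤ) * D j := by
      rw [hcc]
      simp only [Pi.add_apply, Nat.cast_add, add_mul, Finset.sum_add_distrib]
      rw [add_comm]
      congr 1
      rw [Finset.sum_eq_single i]
      · simp
      · intro j _ hj; simp [hj]
      · simp
    rw [hsum, ← add_assoc] at hN
    have h1 := ih c' hs' (o + D i) hoi hN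
    have h2 := card_move_le (hr i) (hb i) (hrn i) (hbn i) Y o (fun y hy => (hY y hy o ho).1)
      (fun y hy => (hY y hy o ho).2 i) (fun y hy => (hY y hy _ hoi).1)
    have hsub : (Y.filter fun y => χ (y + o) = R ∧ χ (y + (o + ∑ j, (c j : ℤ) * D j)) ≠ R) ⊆
        (Y.filter fun y => χ (y + o) = R ∧ χ (y + (o + (P (b i) - P (r i)))) ≠ R) ∪
        (Y.filter fun y => χ (y + (o + D i)) = R ∧
          χ (y + (o + D i + ∑ j, (c' j : ℤ) * D j)) ≠ R) := by
      intro y hy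
      rw [hsum, ← add_assoc o] at hy
      simp only [Finset.mem_union, Finset.mem_filter] at hy ⊢
      obtain ⟨hyY, ha, hb'⟩ := hy
      by_cases hm : χ (y + (o + D i)) = R
      · exact Or.inr ⟨hyY, hm, hb'⟩
      · exact Or.inl ⟨hyY, ha, hm⟩
    calc _ ≤ _ := Finset.card_le_card hsub
      _ ≤ _ := Finset.card_union_le _ _
      _ ≤ E + s * E := add_le_add (h2.trans (hE i)) h1
      _ = (s + 1) * E := by ring

end

/-! ### Small translations as combinations of moves -/

/-- Every multiple `X` of the last term `g` of a slowly decreasing sequence `e 0, …, e m` is a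
combination of its terms, with coefficients bounded by `g * Q`. All remainders of the division
algorithm are kept divisible by `g`. -/
theorem exists_digits {g Q : ℤ} (hg : 1 ≤ g) : ∀ (m : ℕ) (e : ℕ → ℤ),
    (∀ k ≤ m, 1 ≤ e k) → e m = g → (∀ k < m, e k ≤ Q * e (k + 1)) →
    ∀ X, g ∣ X → |X| ≤ g * Q * e 0 →
      ∃ j : ℕ → ℤ, ∑ k ∈ Finset.range (m + 1), j k * e k = X ∧ ∀ k ≤ m, |j k| ≤ g * Q := by
  intro m
  induction m with
  | zero =>
    intro e he heg _ X hX hXb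
    obtain ⟨y, rfl⟩ := hX
    refine ⟨fun _ => y, by simp [heg, mul_comm], fun k _ => ?_⟩
    rw [heg, abs_mul, abs_of_pos (by linarith : (0 : ℤ) < g)] at hXb
    have : g * |y| ≤ g * (g * Q) := by linarith [mul_comm (g * Q) g]
    exact le_of_mul_le_mul_left this (by linarith)
  | succ m ih =>
    intro e he heg hQ X hX hXb
    have he0 := he 0 (Nat.zero_le _)
    set q := X / (g * e 0) with hq
    have hge : 0 < g * e 0 := by positivity
    have hdiv := Int.mul_ediv_add_emod X (g * e 0)
    have hr0 := Int.emod_nonneg X hge.ne'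
    have hr1 := Int.emod_lt_of_pos X hge
    rw [← hq] at hdiv
    have hgr : g ∣ X % (g * e 0) := by
      rw [Int.emod_def]
      exact dvd_sub hX (by rw [mul_assoc]; exact dvd_mul_right _ _)
    have hbound : |X % (g * e 0)| ≤ g * Q * e 1 := by
      rw [abs_of_nonneg hr0]
      have := hQ 0 (Nat.succ_pos _)
      nlinarith
    obtain ⟨j, hj, hjb⟩ := ih (fun k => e (k + 1)) (fun k hk => he (k + 1) (by omega)) heg
      (fun k hk => hQ (k + 1) (by omega)) _ hgr hbound
    refine ⟨fun k => if k = 0 then g * q else j (k - 1), ?_, ?_⟩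
    · rw [Finset.sum_range_succ']
      simp only [Nat.add_eq_zero_iff, one_ne_zero, and_false, if_false, Nat.add_sub_cancel,
        if_true, hj]
      linarith [hdiv, mul_right_comm g q (e 0)]
    · intro k hk
      rcases Nat.eq_zero_or_pos k with rfl | hk0
      · simp only [if_true]
        rw [abs_mul, abs_of_pos (by linarith : (0 : ℤ) < g)]
        refine mul_le_mul_of_nonneg_left ?_ (by linarith)
        have := abs_le.1 hXb
        rw [abs_le]
        constructor
        · rw [hq, Int.le_ediv_iff_mul_le hge]; linarith [mul_right_comm g Q (e 0)]
        · rw [hq]; exact (Int.ediv_le_iff_le_mul hge).2 (by nlinarith)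
      · simp only [hk0.ne', if_false]
        exact hjb _ (by omega)

theorem fwdDiff_iter_succ_const (k : ℕ) (h x c : ℤ) : (Δ_[h] ^[k + 1] fun _ : ℤ => c) x = 0 := by
  rw [Function.iterate_succ_apply, fwdDiff_const]
  have : ∀ k : ℕ, (Δ_[h] ^[k] fun _ : ℤ => (0 : ℤ)) = fun _ => 0 := by
    intro k
    induction k with
    | zero => rfl
    | succ k ih => rw [Function.iterate_succ_apply, fwdDiff_const, ih]
  rw [this]

/-- A multiple of the constant `d`-th difference of `P` is an integer combination of
`P v, …, P (v + d)`, with coefficients of sum `0` and of size about that of `v`. -/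
theorem exists_coeffs {P : ℤ → ℤ} {d : ℕ} (hd : 1 ≤ d) {g Q v : ℤ} (hg : 1 ≤ g)
    (hpos : ∀ k < d, 1 ≤ (Δ_[1] ^[k + 1] P) v) (htop : (Δ_[1] ^[d] P) v = g)
    (hQ : ∀ k, k + 1 < d → (Δ_[1] ^[k + 1] P) v ≤ Q * (Δ_[1] ^[k + 2] P) v) {X : ℤ} (hX : g ∣ X)
    (hXb : |X| ≤ g * Q * (Δ_[1] ^[1] P) v) :
    ∃ c : ℕ → ℤ, ∑ i ∈ Finset.range (d + 1), c i = 0 ∧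
      ∑ i ∈ Finset.range (d + 1), c i * P (v + i) = X ∧
      ∀ i, |c i| ≤ g * (d * Q * 2 ^ d) := by
  obtain ⟨m, rfl⟩ : ∃ m, d = m + 1 := ⟨d - 1, by omega⟩
  obtain ⟨j, hj, hjb⟩ := exists_digits (Q := Q) hg m (fun k => (Δ_[1] ^[k + 1] P) v)
    (fun k hk => hpos k (by omega)) htop (fun k hk => hQ k (by omega)) X hX hXb
  set c : ℕ → ℤ := fun i => ∑ k ∈ Finset.range (m + 1),
    j k * ((-1) ^ (k + 1 - i) * ((k + 1).choose i : ℤ)) with hc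
  have key : ∀ f : ℤ → ℤ, ∑ i ∈ Finset.range (m + 1 + 1), c i * f (v + i) =
      ∑ k ∈ Finset.range (m + 1), j k * (Δ_[1] ^[k + 1] f) v := by
    intro f
    simp only [hc, Finset.sum_mul]
    rw [Finset.sum_comm]
    refine Finset.sum_congr rfl fun k hk => ?_
    rw [fwdDiff_iter_eq_sum_shift, Finset.mul_sum]
    have hsub : Finset.range (k + 1 + 1) ⊆ Finset.range (m + 1 + 1) :=
      Finset.range_subset_range.2 (by have := Finset.mem_range.1 hk; omega)
    rw [← Finset.sum_subset hsub]
    · refine Finset.sum_congr rfl fun i _ => ?_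
      simp only [smul_eq_mul, nsmul_eq_mul, mul_one]
      ring
    · intro i _ hi
      have : k + 1 < i := by simpa using hi
      simp [Nat.choose_eq_zero_of_lt this]
  refine ⟨c, ?_, (key P).trans hj, ?_⟩
  · have := key fun _ => 1
    simp only [mul_one, fwdDiff_iter_succ_const, mul_zero, Finset.sum_const_zero] at this
    exact this
  · intro i
    have hgQ : 0 ≤ g * Q := (abs_nonneg _).trans (hjb 0 (Nat.zero_le _))
    calc |c i| ≤ ∑ k ∈ Finset.range (m + 1), |j k * ((-1) ^ (k + 1 - i) *
          ((k + 1).choose i : ℤ))| := Finset.abs_sum_le_sum_abs _ _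
      _ ≤ ∑ k ∈ Finset.range (m + 1), g * Q * 2 ^ (m + 1) := by
        refine Finset.sum_le_sum fun k hk => ?_
        have hk' := Finset.mem_range.1 hk
        rw [abs_mul, abs_mul, abs_pow, abs_neg, abs_one, one_pow, one_mul]
        refine mul_le_mul (hjb k (by omega)) ?_ (abs_nonneg _) hgQ
        rw [abs_of_nonneg (by positivity)]
        have h1 : (k + 1).choose i ≤ 2 ^ (k + 1) := Nat.choose_le_two_pow _ _
        have h2 : 2 ^ (k + 1) ≤ 2 ^ (m + 1) := Nat.pow_le_pow_right (by norm_num) (by omega)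
        exact_mod_cast h1.trans h2
      _ = g * (((m + 1 : ℕ) : ℤ) * Q * 2 ^ (m + 1)) := by
        rw [Finset.sum_const, Finset.card_range, nsmul_eq_mul]; push_cast; ring

/-- The pairs of labels of the moves available near `v`. Here `r₀`, `r₁` have the color `R`, `b₀`,
`b₁` have the other color, and `red i` says whether `v + i` has the color `R`. Each of
`v, …, v + d` is paired with the one of `r₀`, `b₀` that has the other color; then there are the
pairs `r₀`, `b₀` and `r₁`, `b₁`. The first component is always the label with color `R`. -/
def movePairs {d : ℕ} (red : ℕ → Bool) (v r₀ b₀ r₁ b₁ : ℤ) : Fin (d + 1) ⊕ Bool → ℤ × ℤ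
  | .inl i => if red i then (v + i, b₀) else (r₀, v + i)
  | .inr true => (r₀, b₀)
  | .inr false => (r₁, b₁)

/-- A displacement `z` is nearly cancelled by a bounded number `U` of upward moves by `D₀` or `W` of
downward moves by `D₁`. -/
theorem exists_compensation {z D₀ D₁ Δ K C₁ : ℤ} (hK : 0 ≤ K) (h0 : 0 < D₀) (h1 : 0 < D₁)
    (hΔ0 : Δ ≤ C₁ * D₀) (hΔ1 : Δ ≤ C₁ * D₁) (h1Δ : D₁ ≤ Δ) (hD₀b : D₀ ≤ 2 * Δ)
    (hzb : |z| ≤ K * Δ) :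
    ∃ U W : ℤ, 0 ≤ U ∧ 0 ≤ W ∧ U ≤ K * C₁ ∧ W ≤ K * C₁ ∧ |z + U * D₀ - W * D₁| ≤ 2 * Δ := by
  have hb := abs_le.1 hzb
  have hC₁ : 0 ≤ C₁ := by
    by_contra h
    push Not at h
    nlinarith
  have hKC : 0 ≤ K * C₁ := mul_nonneg hK hC₁
  have hK0 : K * Δ ≤ K * (C₁ * D₀) := mul_le_mul_of_nonneg_left hΔ0 hK
  have hK1 : K * Δ ≤ K * (C₁ * D₁) := mul_le_mul_of_nonneg_left hΔ1 hK
  rcases le_total 0 z with hz0 | hz0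
  · refine ⟨0, z / D₁, le_rfl, Int.ediv_nonneg hz0 h1.le, hKC, ?_, ?_⟩
    · apply Int.ediv_le_of_le_mul h1
      linarith
    · have e1 := Int.emod_nonneg z h1.ne'
      have e2 := Int.emod_lt_of_pos z h1
      have e3 := Int.emod_add_mul_ediv z D₁
      rw [abs_le]
      constructor <;> linarith
  · refine ⟨(-z) / D₀, 0, Int.ediv_nonneg (by linarith) h0.le, le_rfl, ?_, hKC, ?_⟩
    · apply Int.ediv_le_of_le_mul h0
      linarith
    · have e1 := Int.emod_nonneg (-z) h0.ne'
      have e2 := Int.emod_lt_of_pos (-z) h0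
      have e3 := Int.emod_add_mul_ediv (-z) D₀
      rw [abs_le]
      constructor <;> linarith

/-- With an upward move along `r₀`, `b₀` and a downward one along `r₁`, `b₁`, every small multiple
of `g` is a sum of displacements of `O(v)` moves: each pair containing one of `v, …, v + d` is used
about equally often, the small imbalances realize a prescribed combination of the values of `P`,
and the drift is cancelled by the two extra moves. -/
theorem exists_moves {P : ℤ → ℤ} {d : ℕ} (hd : 1 ≤ d) {g Q v r₀ b₀ r₁ b₁ Δ C₁ : ℤ}
    (red : ℕ → Bool) (hg : 1 ≤ g) (hQ0 : 0 ≤ Q)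
    (hpos : ∀ k < d, 1 ≤ (Δ_[1] ^[k + 1] P) v) (htop : (Δ_[1] ^[d] P) v = g)
    (hQ : ∀ k, k + 1 < d → (Δ_[1] ^[k + 1] P) v ≤ Q * (Δ_[1] ^[k + 2] P) v)
    (h0 : 0 < P b₀ - P r₀) (h1 : 0 < P r₁ - P b₁)
    (hV : ∀ i ≤ d, |P (v + i) - P v| ≤ Δ) (hr₀ : |P r₀ - P v| ≤ Δ) (hb₀ : |P b₀ - P v| ≤ Δ)
    (hΔ0 : Δ ≤ C₁ * (P b₀ - P r₀)) (hΔ1 : Δ ≤ C₁ * (P r₁ - P b₁)) (h1Δ : P r₁ - P b₁ ≤ Δ)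
    {N : ℤ} (hN : g ∣ N) (hNb : |N| + 2 * g * Δ ≤ g * Q * (Δ_[1] ^[1] P) v) :
    ∃ c : Fin (d + 1) ⊕ Bool → ℕ,
      ∑ i, (c i : ℤ) * (P (movePairs red v r₀ b₀ r₁ b₁ i).2 -
        P (movePairs red v r₀ b₀ r₁ b₁ i).1) = N ∧
      ((∑ i, c i : ℕ) : ℤ) ≤ g * (d * Q * 2 ^ d) * ((d + 1) * (4 + 8 * C₁)) := by
  set D₀ := P b₀ - P r₀ with hD₀
  set D₁ := P r₁ - P b₁ with hD₁
  set B := (d : ℤ) * Q * 2 ^ d with hB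
  have hB0 : 0 ≤ B := by positivity
  have hΔpos : 0 < Δ := by linarith
  have hC₁ : 0 ≤ C₁ := by
    by_contra h
    push Not at h
    nlinarith
  -- the displacement of the move that uses `v + i`
  set T : ℕ → ℤ := fun i => if red i then P b₀ - P (v + i) else P (v + i) - P r₀ with hT
  have hTb : ∀ i ≤ d, |T i| ≤ 2 * Δ := by
    intro i hi
    have h1 := abs_le.1 (hV i hi)
    have h2 := abs_le.1 hr₀
    have h3 := abs_le.1 hb₀
    simp only [hT]
    split_ifs <;> rw [abs_le] <;> constructor <;> linarith
  have hD₀b : D₀ ≤ 2 * Δ := by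
    have h2 := abs_le.1 hr₀
    have h3 := abs_le.1 hb₀
    linarith
  -- by default every move with a `v + i` is made `g * B` times, and the one along `r₀`, `b₀` as
  -- often as all of these together; `g * z` is the resulting drift
  set z := B * (∑ i ∈ Finset.range (d + 1), T i + (d + 1) * D₀) with hz
  have hzb : |z| ≤ 4 * (d + 1) * B * Δ := by
    have hs : |∑ i ∈ Finset.range (d + 1), T i| ≤ (d + 1) * (2 * Δ) := by
      calc _ ≤ ∑ i ∈ Finset.range (d + 1), |T i| := Finset.abs_sum_le_sum_abs _ _
        _ ≤ ∑ i ∈ Finset.range (d + 1), 2 * Δ :=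
          Finset.sum_le_sum fun i hi => hTb i (by simpa [Nat.lt_succ_iff] using hi)
        _ = _ := by simp
    rw [hz, abs_mul, abs_of_nonneg hB0]
    have h2 : |∑ i ∈ Finset.range (d + 1), T i + (d + 1) * D₀| ≤ 4 * (d + 1) * Δ := by
      refine (abs_add_le _ _).trans ?_
      rw [abs_of_nonneg (by positivity : (0 : ℤ) ≤ (d + 1) * D₀)]
      have hdD : ((d : ℤ) + 1) * D₀ ≤ (d + 1) * (2 * Δ) :=
        mul_le_mul_of_nonneg_left hD₀b (by positivity)
      linarith
    calc B * |∑ i ∈ Finset.range (d + 1), T i + (d + 1) * D₀| ≤ B * (4 * (d + 1) * Δ) :=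
          mul_le_mul_of_nonneg_left h2 hB0
      _ = _ := by ring
  obtain ⟨U, W, hU0, hW0, hUb, hWb, hZ⟩ := exists_compensation (K := 4 * (d + 1) * B)
    (by positivity) h0 h1 hΔ0 hΔ1 h1Δ hD₀b hzb
  set Z := g * (z + U * D₀ - W * D₁) with hZdef
  have hZb : |Z| ≤ 2 * g * Δ := by
    rw [hZdef, abs_mul, abs_of_pos (by linarith : (0 : ℤ) < g)]
    calc g * |z + U * D₀ - W * D₁| ≤ g * (2 * Δ) := mul_le_mul_of_nonneg_left hZ (by linarith)
      _ = 2 * g * Δ := by ring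
  obtain ⟨c, hc0, hcX, hcb⟩ := exists_coeffs hd hg hpos htop hQ (X := N - Z)
    (dvd_sub hN (dvd_mul_right _ _)) (by
      have := abs_sub N Z
      linarith)
  rw [← hB] at hcb
  -- `P b₀` is used `ρ` times less often than by default in the moves that contain a `v + i`; the
  -- move along `r₀`, `b₀` makes up for it
  set ρ : ℤ := ∑ i ∈ Finset.range (d + 1), if red i then c i else 0 with hρ
  have hρb : |ρ| ≤ (d + 1) * (g * B) := by
    calc |ρ| ≤ ∑ i ∈ Finset.range (d + 1), |if red i then c i else 0| :=
          Finset.abs_sum_le_sum_abs _ _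
      _ ≤ ∑ i ∈ Finset.range (d + 1), g * B := by
          refine Finset.sum_le_sum fun i _ => ?_
          split_ifs
          · exact hcb i
          · rw [abs_zero]; positivity
      _ = _ := by simp
  set σ : ℕ → ℤ := fun i => if red i then g * B - c i else g * B + c i with hσ
  have hσ0 : ∀ i, 0 ≤ σ i := by
    intro i
    have := abs_le.1 (hcb i)
    simp only [hσ]
    split_ifs <;> linarith
  have hσb : ∀ i, σ i ≤ 2 * (g * B) := by
    intro i
    have := abs_le.1 (hcb i)
    simp only [hσ]
    split_ifs <;> linarith
  set nU := g * (U + (d + 1) * B) + ρ with hnU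
  have hnU0 : 0 ≤ nU := by
    have := (abs_le.1 hρb).1
    have h' : 0 ≤ g * U := by positivity
    rw [hnU]
    linarith [mul_add g U ((d + 1) * B)]
  have hnW0 : 0 ≤ g * W := by positivity
  refine ⟨fun i => match i with
    | .inl i => (σ i).toNat
    | .inr true => nU.toNat
    | .inr false => (g * W).toNat, ?_, ?_⟩
  · rw [Fintype.sum_sum_type, Fintype.sum_bool]
    simp only [movePairs, Int.toNat_of_nonneg (hσ0 _), Int.toNat_of_nonneg hnU0,
      Int.toNat_of_nonneg hnW0]
    have hsum : ∑ i : Fin (d + 1), σ i * (P (if red i then (v + (i : ℕ), b₀)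
          else (r₀, v + (i : ℕ))).2 - P (if red i then (v + (i : ℕ), b₀)
          else (r₀, v + (i : ℕ))).1) =
        ∑ i ∈ Finset.range (d + 1), σ i * T i := by
      rw [← Fin.sum_univ_eq_sum_range (fun i => σ i * T i)]
      refine Finset.sum_congr rfl fun i _ => ?_
      simp only [hT]
      split_ifs <;> rfl
    have hsum' : ∑ i ∈ Finset.range (d + 1), σ i * T i =
        g * B * ∑ i ∈ Finset.range (d + 1), T i + (N - Z) - D₀ * ρ := by
      have : ∀ i, σ i * T i = g * B * T i + c i * P (v + i) - P r₀ * c i -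
          D₀ * (if red i then c i else 0) := by
        intro i
        simp only [hσ, hT]
        split_ifs <;> ring
      simp only [this, Finset.sum_sub_distrib, Finset.sum_add_distrib, ← Finset.mul_sum]
      rw [hcX, hc0, hρ]
      ring
    erw [hsum]
    rw [hsum', hZdef, hnU, hz, hD₀, hD₁]
    ring
  · rw [Fintype.sum_sum_type, Fintype.sum_bool]
    push_cast
    rw [Int.toNat_of_nonneg hnU0, Int.toNat_of_nonneg hnW0]
    have hs : ∑ i : Fin (d + 1), (((σ i).toNat : ℕ) : ℤ) ≤ (d + 1) * (2 * (g * B)) := by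
      calc _ ≤ ∑ i : Fin (d + 1), 2 * (g * B) :=
            Finset.sum_le_sum fun i _ => by rw [Int.toNat_of_nonneg (hσ0 _)]; exact hσb _
        _ = _ := by simp
    have h2 := (abs_le.1 hρb).2
    have h3 : g * U ≤ g * (4 * (d + 1) * B * C₁) := mul_le_mul_of_nonneg_left hUb (by linarith)
    have h4 : g * W ≤ g * (4 * (d + 1) * B * C₁) := mul_le_mul_of_nonneg_left hWb (by linarith)
    rw [hnU]
    calc _ ≤ (d + 1) * (2 * (g * B)) + (g * (U + (d + 1) * B) + (d + 1) * (g * B) + g * W) := by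
          linarith
      _ ≤ _ := by linarith

/-! ### Moves in both directions contradict few bad edges -/

/-- If every translation by a difference of two elements of `Y` almost preserves the color `R`
on `Y`, then `Y` is almost monochromatic. -/
theorem exists_majority {χ : ℤ → Bool} {R : Bool} (Y T : Finset ℤ) {m : ℕ}
    (hT : ∀ y ∈ Y, ∀ y' ∈ Y, y' - y ∈ T) (hTY : T.card ≤ 2 * Y.card)
    (h : ∀ N ∈ T, (Y.filter fun y => χ y = R ∧ χ (y + N) ≠ R).card ≤ m) :
    ∃ μ, (Y.filter fun y => χ y ≠ μ).card ≤ 4 * m := by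
  classical
  set a := (Y.filter fun y => χ y = R).card with ha
  set b := (Y.filter fun y => χ y ≠ R).card with hb
  have hab : a + b = Y.card := Finset.card_filter_add_card_filter_not (s := Y) (fun y => χ y = R)
  -- count the pairs of an element of color `R` and one of the other color by their difference
  have hmul : a * b ≤ T.card * m := by
    rw [ha, hb, ← Finset.card_product, ← smul_eq_mul (T.card), ← Finset.sum_const]
    refine le_trans ?_ (Finset.sum_le_sum h)
    rw [← Finset.card_sigma]
    refine Finset.card_le_card_of_injOn (fun t => ⟨t.2 - t.1, t.1⟩) ?_ ?_
    · rintro ⟨y, y'⟩ ht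
      simp only [Finset.coe_product, Set.mem_prod, Finset.mem_coe, Finset.mem_filter] at ht
      simp only [Finset.coe_sigma, Set.mem_sigma_iff, Finset.mem_coe, Finset.mem_filter]
      exact ⟨hT _ ht.1.1 _ ht.2.1, ht.1.1, ht.1.2, by rw [add_sub_cancel]; exact ht.2.2⟩
    · rintro ⟨y, y'⟩ _ ⟨x, x'⟩ _ hxy
      simp only [Sigma.mk.injEq, heq_eq_eq] at hxy
      obtain ⟨h1, rfl⟩ := hxy
      simpa using h1
  have hR : (Y.filter fun y => χ y ≠ !R) = Y.filter fun y => χ y = R := by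
    refine Finset.filter_congr fun y _ => ?_
    cases χ y <;> cases R <;> simp
  have hmul' : a * b ≤ 2 * (a + b) * m := hmul.trans (Nat.mul_le_mul_right _ (by omega))
  rcases le_total a b with hle | hle
  · refine ⟨!R, ?_⟩
    rw [hR, ← ha]
    rcases Nat.eq_zero_or_pos b with h0 | h0
    · omega
    · by_contra! hlt
      nlinarith
  · refine ⟨R, ?_⟩
    rw [← hb]
    rcases Nat.eq_zero_or_pos a with h0 | h0
    · omega
    · by_contra! hlt
      nlinarith

/-- The label `ℓ` and the value `P ℓ` are in range, and at most `E` bad edges have label `ℓ`. -/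
structure Clean (P : ℤ → ℤ) (n : ℤ) (χ : ℤ → Bool) (E : ℕ) (ℓ : ℤ) : Prop where
  one_le : 1 ≤ ℓ
  le : ℓ ≤ n
  apply_le : P ℓ ≤ n
  card_le : (badAt P n χ ℓ).card ≤ E

/-- An almost monochromatic progression `Y` of difference `g`, symmetric about the half `c₀` of the
value at some label `w`, contradicts a small number of bad edges. With `D` the difference of the
values at `q` and `w`, the edges with label `q`, after `g - 1` moves along `q` and `w`, reflect
`y` to `2 * c₀ + g * D - y`. As the shift `g * D` is a multiple of `g`, this is in `Y` again, up to
at most `|D|` exceptions, and the edges in question join numbers of the color of their label. -/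
theorem card_le_of_reflect {P : ℤ → ℤ} {n : ℤ} {χ : ℤ → Bool} {μ : Bool} {Y : Finset ℤ}
    {c₀ g D k₀ q : ℤ} {M m E : ℕ} (hg : 1 ≤ g)
    (hk₀ : 0 ≤ k₀) (hY : Y = (Finset.Icc (-k₀) k₀).image fun k => c₀ + g * k)
    (hD : P q = 2 * c₀ + D) (hq : χ q = μ) (hqE : Clean P n χ E q)
    (hμ : (Y.filter fun y => χ y ≠ μ).card ≤ m)
    (hM : (Y.filter fun y => χ y = μ ∧ χ (y + -(g - 1) * D) ≠ μ).card ≤ M)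
    (hr : ∀ y ∈ Y, (1 ≤ y + -(g - 1) * D ∧ y + -(g - 1) * D ≤ n) ∧
      1 ≤ P q - (y + -(g - 1) * D) ∧ P q - (y + -(g - 1) * D) ≤ n) :
    2 * k₀ + 1 ≤ 2 * m + M + E + |D| := by
  classical
  have hinj : Function.Injective fun k : ℤ => c₀ + g * k := by
    intro k k' h
    have h : c₀ + g * k = c₀ + g * k' := h
    have : g * k = g * k' := by linarith
    exact mul_left_cancel₀ (by linarith : g ≠ 0) this
  have hcard : (Y.card : ℤ) = 2 * k₀ + 1 := by
    rw [hY, Finset.card_image_of_injective _ hinj, Int.card_Icc]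
    rw [Int.toNat_of_nonneg (by linarith)]; ring
  set ρ : ℤ → ℤ := fun y => 2 * c₀ + g * D - y with hρ
  -- the points reflected out of `Y`
  have hout : ((Y.filter fun y => ρ y ∉ Y).card : ℤ) ≤ |D| := by
    have hsub : (Y.filter fun y => ρ y ∉ Y) ⊆
        ((Finset.Ico (-k₀) (-k₀ + D)) ∪ Finset.Ioc (k₀ + D) k₀).image fun k => c₀ + g * k := by
      intro y hy
      obtain ⟨hy1, hy2⟩ := Finset.mem_filter.1 hy
      rw [hY, Finset.mem_image] at hy1
      obtain ⟨k, hk, rfl⟩ := hy1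
      refine Finset.mem_image.2 ⟨k, ?_, rfl⟩
      rw [Finset.mem_Icc] at hk
      have : ¬ (-k₀ ≤ D - k ∧ D - k ≤ k₀) := by
        intro h
        refine hy2 ?_
        rw [hY, Finset.mem_image]
        exact ⟨D - k, Finset.mem_Icc.2 h, by simp only [hρ]; ring⟩
      simp only [Finset.mem_union, Finset.mem_Ico, Finset.mem_Ioc]
      omega
    have h1 := (Finset.card_le_card hsub).trans (Finset.card_image_le.trans
      (Finset.card_union_le _ _))
    rw [Int.card_Ico, Int.card_Ioc] at h1
    rcases abs_cases D with ⟨h, _⟩ | ⟨h, _⟩ <;> rw [h] <;> omega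
  have hin : (Y.filter fun y => ρ y ∈ Y ∧ χ (ρ y) ≠ μ).card ≤ m := by
    refine le_trans (Finset.card_le_card_of_injOn ρ ?_ ?_) hμ
    · intro y hy
      have hy := Finset.mem_filter.1 (Finset.mem_coe.1 hy)
      exact Finset.mem_coe.2 (Finset.mem_filter.2 hy.2)
    · intro y _ y' _ h
      simp only [hρ] at h
      linarith
  have hbad : (Y.filter fun y => χ (y + -(g - 1) * D) = μ ∧ χ (ρ y) = μ).card ≤ E := by
    refine le_trans (Finset.card_le_card_of_injOn (fun y => y + -(g - 1) * D) ?_ ?_) hqE.card_le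
    · intro y hy
      obtain ⟨hyY, h1, h2⟩ := Finset.mem_filter.1 (Finset.mem_coe.1 hy)
      have h3 := hr y hyY
      refine Finset.mem_coe.2 (mem_badAt.2 (mem_badPairs.2 ⟨⟨h3.1, hqE.one_le, hqE.le⟩, h3.2,
        h1.trans hq.symm, ?_⟩))
      rw [hq, ← h2, hD]
      congr 1
      simp only [hρ]; ring
    · intro y _ y' _ h
      simpa using h
  have hcover : Y ⊆ (Y.filter fun y => χ y ≠ μ) ∪
      (Y.filter fun y => χ y = μ ∧ χ (y + -(g - 1) * D) ≠ μ) ∪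
      (Y.filter fun y => ρ y ∉ Y) ∪ (Y.filter fun y => ρ y ∈ Y ∧ χ (ρ y) ≠ μ) ∪
      (Y.filter fun y => χ (y + -(g - 1) * D) = μ ∧ χ (ρ y) = μ) := by
    intro y hy
    simp only [Finset.mem_union, Finset.mem_filter, hy, true_and]
    tauto
  have h1 := Finset.card_le_card hcover
  have h2 : ∀ a b c d e : Finset ℤ, (a ∪ b ∪ c ∪ d ∪ e).card ≤
      a.card + b.card + c.card + d.card + e.card := by
    intro a b c d e
    have h1 := Finset.card_union_le (a ∪ b ∪ c ∪ d) e
    have h2 := Finset.card_union_le (a ∪ b ∪ c) d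
    have h3 := Finset.card_union_le (a ∪ b) c
    have h4 := Finset.card_union_le a b
    omega
  have h3 := h1.trans (h2 _ _ _ _ _)
  zify at h3 hμ hM hin hbad
  linarith

/-- Consecutive forward differences of `P` at `v` decrease by a factor `O(v)` only. -/
theorem Growth.fwdDiff_le_mul {P : ℤ → ℤ} {d : ℕ} {C g z₀ : ℤ} (G : Growth P d C g z₀) {v : ℤ}
    (hv : z₀ ≤ v) (hdv : (d : ℤ) ≤ v) {k : ℕ} (hk : k + 1 < d) :
    (Δ_[1] ^[k + 1] P) v ≤ C * 2 ^ d * v * (Δ_[1] ^[k + 2] P) v := by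
  have hv1 : 1 ≤ v := G.one_le_z₀.trans hv
  have hC := G.one_le_C
  obtain ⟨m, rfl⟩ : ∃ m, d = k + 2 + m := ⟨d - (k + 2), by omega⟩
  have h1 := (G.fd (k + 1) (by omega) 1 le_rfl v hv).2
  have h2 := (G.fd (k + 2) (by omega) 1 le_rfl v hv).1
  rw [show k + 2 + m - (k + 1) = m + 1 by omega] at h1
  rw [show k + 2 + m - (k + 2) = m by omega] at h2
  simp only [one_pow, one_mul, mul_one] at h1 h2
  have hk2 : v + ((k + 1 : ℕ) : ℤ) ≤ 2 * v := by push_cast at hdv ⊢; linarith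
  calc _ ≤ C * (v + ((k + 1 : ℕ) : ℤ)) ^ (m + 1) := h1
    _ ≤ C * (2 * v) ^ (m + 1) := by gcongr
    _ = C * 2 ^ (m + 1) * v * v ^ m := by ring
    _ ≤ C * 2 ^ (m + 1) * v * (2 * (Δ_[1] ^[k + 2] P) v) := by gcongr
    _ = C * 2 ^ (m + 2) * v * (Δ_[1] ^[k + 2] P) v := by ring
    _ ≤ _ := by
      have : (0 : ℤ) ≤ (Δ_[1] ^[k + 2] P) v := by
        have : 0 ≤ v ^ m := by positivity
        linarith
      have h4 : (2 : ℤ) ^ (m + 2) ≤ 2 ^ (k + 2 + m) := pow_le_pow_right₀ (by norm_num) (by omega)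
      gcongr

/-- Few bad edges at the labels near `v` are incompatible with pairs of labels of both kinds: an
upward move along `r₀`, `b₀` and a downward one along `r₁`, `b₁`. Indeed these moves would make the
color near `P v / 2` almost invariant under all small translations by multiples of `g`, hence
almost constant on a long progression of difference `g`, which edges with a label of that color
reflect to itself. Here `Δ` is the size of the displacements; since `O(v)` moves are needed, it
suffices that each label has `O(v ^ (d - 1))` bad edges. The label `r₁` need not be near `v`, but
`P r₁` must not be too small for its edges at numbers near `P v / 2` to stay in `[1, n]`. -/
theorem Growth.two_sided {P : ℤ → ℤ} {d : ℕ} {C g z₀ : ℤ} (G : Growth P d C g z₀) (hd : 1 ≤ d)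
    {C₁ : ℤ} (hC₁ : 1 ≤ C₁) :
    ∃ H z₁ : ℤ, 1 ≤ H ∧ ∀ (n v r₀ b₀ r₁ b₁ Δ : ℤ) (E : ℕ) (χ : ℤ → Bool) (R : Bool), z₁ ≤ v →
      χ r₀ = R → χ b₀ = (!R) → χ r₁ = R → χ b₁ = (!R) → P r₀ < P b₀ → P b₁ < P r₁ →
      (∀ i ≤ d, Clean P n χ E (v + (i : ℕ))) → Clean P n χ E r₀ → Clean P n χ E b₀ →
      Clean P n χ E r₁ → Clean P n χ E b₁ →
      (∀ i ≤ d, |P (v + (i : ℕ)) - P v| ≤ Δ) → |P r₀ - P v| ≤ Δ → |P b₀ - P v| ≤ Δ →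
      Δ ≤ C₁ * (P b₀ - P r₀) → Δ ≤ C₁ * (P r₁ - P b₁) → P r₁ - P b₁ ≤ Δ →
      1024 * g * Δ ≤ v ^ d → 3 * P (v + 1) ≤ 4 * P r₁ → H * E ≤ v ^ (d - 1) → False := by
  have hg := G.one_le_g
  have hC := G.one_le_C
  set S₁ : ℤ := g * (d * (C * 2 ^ d) * 2 ^ d) * ((d + 1) * (4 + 8 * C₁)) with hS₁
  have hS₁0 : 0 ≤ S₁ := by positivity
  refine ⟨1024 * g * (16 * S₁ + 2 * g), max z₀ (max d (64 * g + 1)), ?_, ?_⟩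
  · have h1 : 1 ≤ 16 * S₁ + 2 * g := by linarith
    have h2 : 1 ≤ 1024 * g := by linarith
    exact one_le_mul_of_one_le_of_one_le h2 h1
  intro n v r₀ b₀ r₁ b₁ Δ E χ R hv hr₀ hb₀ hr₁ hb₁ h0 h1 hVc hr₀c hb₀c hr₁c hb₁c hVΔ hr₀Δ hb₀Δ
    hΔ0 hΔ1 h1Δ hΔX hr₁P hE
  have hvz : z₀ ≤ v := (le_max_left _ _).trans hv
  have hvd : (d : ℤ) ≤ v := ((le_max_left _ _).trans (le_max_right _ _)).trans hv
  have hvg : 64 * g + 1 ≤ v := ((le_max_right _ _).trans (le_max_right _ _)).trans hv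
  set X := v ^ d with hX
  have hXv : X = v * v ^ (d - 1) := by
    rw [hX, ← pow_succ']; congr 1; omega
  have hvX : v ≤ X := by
    have : 1 ≤ v ^ (d - 1) := one_le_pow₀ (by linarith)
    rw [hXv]; exact le_mul_of_one_le_right (by linarith) this
  have hΔpos : 0 < Δ := by linarith
  have hΔX' : 1024 * Δ ≤ X := by
    have : 1024 * Δ * 1 ≤ 1024 * Δ * g := mul_le_mul_of_nonneg_left hg (by linarith)
    linarith [mul_right_comm 1024 g Δ]
  -- one of the labels `v`, `v + 1` has an even value; half of it is the center of reflection
  obtain ⟨w, hw, hwP, hwΔ, hwc, c₀, hc₀⟩ : ∃ w, (w = v ∨ w = v + 1) ∧ 3 * P w ≤ 4 * P r₁ ∧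
      |P w - P v| ≤ Δ ∧ Clean P n χ E w ∧ ∃ c₀, P w = 2 * c₀ := by
    have hmono := G.mono hd hvz (by linarith : v ≤ v + 1)
    rcases G.even v with h | h
    · obtain ⟨c, hc⟩ := h
      refine ⟨v, Or.inl rfl, by linarith, by simpa using hΔpos.le, by simpa using hVc 0 (by omega),
        c, by linarith⟩
    · obtain ⟨c, hc⟩ := h
      exact ⟨v + 1, Or.inr rfl, hr₁P, by simpa using hVΔ 1 hd, by simpa using hVc 1 hd,
        c, by linarith⟩
  have hXP : X ≤ 2 * P v := G.pow_le hvz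
  have hXw : X ≤ 2 * P w := by
    rcases hw with rfl | rfl
    · exact hXP
    · linarith [G.mono hd hvz (by linarith : v ≤ v + 1)]
  obtain ⟨hwΔ1, hwΔ2⟩ := abs_le.1 hwΔ
  -- all numbers stay within `3 * A` of the center `c₀`
  set A := X / 64 with hA
  have hA1 : 64 * A ≤ X := by omega
  have hA2 : X ≤ 64 * A + 63 := by omega
  have hA0 : 0 ≤ A := by omega
  set k₀ := A / g with hk₀
  have hgk : g * k₀ ≤ A := Int.mul_ediv_self_le (by linarith)
  have hgk2 : A < g * k₀ + g := by
    have := Int.lt_mul_ediv_self_add (x := A) (k := g) (by linarith)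
    exact this
  have hk₀0 : 0 ≤ k₀ := Int.ediv_nonneg hA0 (by linarith)
  have hregion : ∀ y, |y - c₀| ≤ 3 * A → (1 ≤ y ∧ y ≤ n) ∧
      ∀ r, 3 * P w ≤ 4 * P r → P r ≤ n → 1 ≤ P r - y ∧ P r - y ≤ n := by
    intro y hy
    obtain ⟨hy1, hy2⟩ := abs_le.1 hy
    have := hwc.apply_le
    refine ⟨⟨by linarith, by linarith⟩, fun r h1 h2 => ⟨by linarith, by linarith⟩⟩
  have hVP : ∀ r, |P r - P v| ≤ Δ → 3 * P w ≤ 4 * P r := by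
    intro r hr
    have := abs_le.1 hr
    linarith
  set Y := (Finset.Icc (-k₀) k₀).image fun k => c₀ + g * k with hY
  have hgk' : ∀ k, -k₀ ≤ k ∧ k ≤ k₀ → -A ≤ g * k ∧ g * k ≤ A := by
    intro k hk
    have h1 : g * k ≤ g * k₀ := mul_le_mul_of_nonneg_left hk.2 (by linarith)
    have h2 : g * (-k₀) ≤ g * k := mul_le_mul_of_nonneg_left hk.1 (by linarith)
    constructor <;> linarith [mul_neg g k₀]
  have hYA : ∀ y ∈ Y, |y - c₀| ≤ A := by
    intro y hy
    rw [hY, Finset.mem_image] at hy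
    obtain ⟨k, hk, rfl⟩ := hy
    have := hgk' k (Finset.mem_Icc.1 hk)
    rw [abs_le]; constructor <;> linarith
  set red : ℕ → Bool := fun i => χ (v + i) == R with hred
  set pr : Fin (d + 1) ⊕ Bool → ℤ × ℤ := movePairs red v r₀ b₀ r₁ b₁ with hpr
  have hVi : ∀ i : Fin (d + 1), (i : ℕ) ≤ d := fun i => Nat.lt_succ_iff.1 i.2
  have hpr1 : ∀ i, χ (pr i).1 = R := by
    rintro (i | (_ | _))
    · simp only [hpr, movePairs, hred]
      split_ifs with h
      · simpa using h
      · exact hr₀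
    · exact hr₁
    · exact hr₀
  have hpr2 : ∀ i, χ (pr i).2 = !R := by
    rintro (i | (_ | _))
    · simp only [hpr, movePairs, hred]
      split_ifs with h
      · exact hb₀
      · have h : χ (v + (i : ℕ)) ≠ R := by simpa using h
        exact Bool.eq_not.2 h
    · exact hb₁
    · exact hb₀
  have hprc : ∀ i, Clean P n χ E (pr i).1 ∧ Clean P n χ E (pr i).2 := by
    rintro (i | (_ | _))
    · simp only [hpr, movePairs]
      split_ifs with h
      · exact ⟨hVc i (hVi i), hb₀c⟩
      · exact ⟨hr₀c, hVc i (hVi i)⟩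
    · exact ⟨hr₁c, hb₁c⟩
    · exact ⟨hr₀c, hb₀c⟩
  have hprP : ∀ i, 3 * P w ≤ 4 * P (pr i).1 := by
    rintro (i | (_ | _))
    · simp only [hpr, movePairs]
      split_ifs with h
      · exact hVP _ (hVΔ i (hVi i))
      · exact hVP _ hr₀Δ
    · exact hwP
    · exact hVP _ hr₀Δ
  have hprD : ∀ i, |P (pr i).2 - P (pr i).1| ≤ 2 * A := by
    have key : ∀ r b, |P r - P v| ≤ Δ → |P b - P v| ≤ Δ → |P b - P r| ≤ 2 * A := by
      intro r b hr hb
      obtain ⟨h1, h2⟩ := abs_le.1 hr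
      obtain ⟨h3, h4⟩ := abs_le.1 hb
      rw [abs_le]; constructor <;> linarith
    rintro (i | (_ | _))
    · simp only [hpr, movePairs]
      split_ifs with h
      · exact key _ _ (hVΔ i (hVi i)) hb₀Δ
      · exact key _ _ hr₀Δ (hVΔ i (hVi i))
    · show |P b₁ - P r₁| ≤ 2 * A
      rw [abs_le]; constructor <;> linarith
    · exact key _ _ hr₀Δ hb₀Δ
  -- translations by multiples of `g` almost preserve the color `R` on `Y`
  have hfd : ∀ k < d, 1 ≤ (Δ_[1] ^[k + 1] P) v := by
    intro k hk
    have := (G.fd (k + 1) hk 1 le_rfl v hvz).1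
    have h2 : 0 < v ^ (d - (k + 1)) := by
      have : 0 < v := by linarith
      positivity
    simp only [one_pow, one_mul] at this
    linarith
  have hQΔ : X ≤ g * (C * 2 ^ d * v) * (Δ_[1] ^[1] P) v := by
    have h1 := (G.fd 1 hd 1 le_rfl v hvz).1
    simp only [one_pow, one_mul] at h1
    have h2 : (2 : ℤ) ≤ 2 ^ d := by
      calc (2 : ℤ) = 2 ^ 1 := by norm_num
        _ ≤ 2 ^ d := pow_le_pow_right₀ (by norm_num) hd
    have h3 := hfd 0 hd
    have h0 : 0 ≤ v := by linarith
    have hD0 : 0 ≤ (Δ_[1] ^[1] P) v := by simpa using (zero_le_one.trans h3)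
    calc X = v * v ^ (d - 1) := hXv
      _ ≤ v * (2 * (Δ_[1] ^[1] P) v) := mul_le_mul_of_nonneg_left h1 h0
      _ = 1 * (1 * 2 * v) * (Δ_[1] ^[1] P) v := by ring
      _ ≤ _ := by gcongr
  have htrans : ∀ N, g ∣ N → |N| ≤ 2 * A →
      ((Y.filter fun y => χ y = R ∧ χ (y + N) ≠ R).card : ℤ) ≤ S₁ * v * (2 * E) := by
    intro N hN hNA
    obtain ⟨c, hcN, hcs⟩ := exists_moves (Q := C * 2 ^ d * v) hd red hg
      (by have : 0 ≤ v := by linarith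
          positivity) hfd (G.top v)
      (fun k hk => G.fwdDiff_le_mul hvz hvd hk) (by linarith) (by linarith) hVΔ hr₀Δ hb₀Δ hΔ0 hΔ1
      h1Δ hN (by linarith)
    have := card_moves_le hpr1 hpr2 (fun i => ⟨(hprc i).1.one_le, (hprc i).1.le⟩)
      (fun i => ⟨(hprc i).2.one_le, (hprc i).2.le⟩) (A := 2 * A) (E := 2 * E) hprD
      (fun i => by have h1 := (hprc i).1.card_le; have h2 := (hprc i).2.card_le; omega) Y
      (fun y hy o ho => by
        have h1 := abs_le.1 (hYA y hy)
        have h2 := abs_le.1 ho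
        have h3 := hregion (y + o) (by rw [abs_le]; constructor <;> linarith)
        exact ⟨h3.1, fun i => h3.2 _ (hprP i) (hprc i).1.apply_le⟩)
      _ c rfl 0 (by simpa using hA0) (by
        have hcN' : ∑ i, (c i : ℤ) * (P (pr i).2 - P (pr i).1) = N := hcN
        rw [zero_add, hcN']; exact hNA)
    have hcN' : ∑ i, (c i : ℤ) * (P (pr i).2 - P (pr i).1) = N := hcN
    simp only [zero_add, add_zero, hcN'] at this
    zify at this
    refine this.trans (mul_le_mul_of_nonneg_right ?_ (by positivity))
    push_cast at hcs ⊢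
    refine hcs.trans (le_of_eq ?_)
    rw [hS₁]; ring
  have hinj : Function.Injective fun k : ℤ => c₀ + g * k := by
    intro k k' h
    have h : c₀ + g * k = c₀ + g * k' := h
    have : g * k = g * k' := by linarith
    exact mul_left_cancel₀ (by linarith : g ≠ 0) this
  obtain ⟨μ, hμ⟩ := exists_majority (χ := χ) (R := R) Y
    ((Finset.Icc (-(2 * k₀)) (2 * k₀)).image fun k => g * k) (m := (S₁ * v * (2 * E)).toNat)
    (by
      intro y hy y' hy'
      rw [hY, Finset.mem_image] at hy hy'
      obtain ⟨k, hk, rfl⟩ := hy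
      obtain ⟨k', hk', rfl⟩ := hy'
      rw [Finset.mem_Icc] at hk hk'
      exact Finset.mem_image.2 ⟨k' - k, Finset.mem_Icc.2 ⟨by linarith, by linarith⟩, by ring⟩)
    (by
      refine Finset.card_image_le.trans ?_
      rw [hY, Finset.card_image_of_injective _ hinj, Int.card_Icc, Int.card_Icc]
      omega)
    (by
      intro N hN
      rw [Finset.mem_image] at hN
      obtain ⟨k, hk, rfl⟩ := hN
      rw [Finset.mem_Icc] at hk
      have h2 := htrans (g * k) (dvd_mul_right _ _) (by
        rw [abs_mul, abs_of_pos (by linarith : (0 : ℤ) < g)]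
        have : |k| ≤ 2 * k₀ := abs_le.2 ⟨by linarith, hk.2⟩
        have := mul_le_mul_of_nonneg_left this (by linarith : 0 ≤ g)
        linarith [mul_left_comm g 2 k₀])
      omega)
  have hμ' : 4 * (S₁ * v * (2 * E)).toNat = (4 * (S₁ * v * (2 * E))).toNat := by omega
  have hm0 : 0 ≤ S₁ * v * (2 * E) := by
    have : 0 ≤ v := by linarith
    positivity
  -- a label `q` of the majority color; if it is not `w`, then `q` and `w` give moves
  obtain ⟨q, hqμ, hqc, hqΔ, hqM⟩ : ∃ q, χ q = μ ∧ Clean P n χ E q ∧ |P q - P v| ≤ Δ ∧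
      (Y.filter fun y => χ y = μ ∧ χ (y + -(g - 1) * (P q - P w)) ≠ μ).card ≤
        (g - 1).toNat * (2 * E) := by
    by_cases hwμ : χ w = μ
    · exact ⟨w, hwμ, hwc, hwΔ, by simp⟩
    · obtain ⟨q, hqμ, hqc, hqΔ⟩ : ∃ q, χ q = μ ∧ Clean P n χ E q ∧ |P q - P v| ≤ Δ := by
        by_cases hR : R = μ
        · exact ⟨r₀, hr₀.trans hR, hr₀c, hr₀Δ⟩
        · refine ⟨b₀, ?_, hb₀c, hb₀Δ⟩
          rw [hb₀]; exact (Bool.eq_not.2 (Ne.symm hR)).symm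
      refine ⟨q, hqμ, hqc, hqΔ, ?_⟩
      obtain ⟨hq1, hq2⟩ := abs_le.1 hqΔ
      have hgD : |-(g - 1) * (P q - P w)| ≤ 2 * A := by
        have h1 : |P q - P w| ≤ 2 * Δ := by rw [abs_le]; constructor <;> linarith
        rw [abs_mul, abs_neg, abs_of_nonneg (by linarith : 0 ≤ g - 1)]
        have h2 := mul_le_mul_of_nonneg_left h1 (by linarith : 0 ≤ g - 1)
        linarith [sub_mul g 1 (2 * Δ), mul_left_comm g 2 Δ, mul_assoc 1024 g Δ]
      have := card_moves_le (ι := Unit) (r := fun _ => q) (b := fun _ => w) (fun _ => hqμ)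
        (fun _ => Bool.eq_not.2 hwμ) (fun _ => ⟨hqc.one_le, hqc.le⟩)
        (fun _ => ⟨hwc.one_le, hwc.le⟩) (A := 2 * A) (E := 2 * E)
        (fun _ => by rw [abs_le]; constructor <;> linarith)
        (fun _ => by have h1 := hqc.card_le; have h2 := hwc.card_le; omega) Y
        (fun y hy o ho => by
          have h1 := abs_le.1 (hYA y hy)
          have h2 := abs_le.1 ho
          have h3 := hregion (y + o) (by rw [abs_le]; constructor <;> linarith)
          exact ⟨h3.1, fun i => h3.2 _ (hVP _ hqΔ) hqc.apply_le⟩)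
        (g - 1).toNat (fun _ => (g - 1).toNat) (by simp) 0 (by simpa using hA0) (by
          simp only [Finset.univ_unique, Finset.sum_const, Finset.card_singleton, one_smul,
            zero_add, Int.toNat_of_nonneg (by linarith : 0 ≤ g - 1)]
          rw [show (g - 1) * (P w - P q) = -(g - 1) * (P q - P w) by ring]
          exact hgD)
      simp only [Finset.univ_unique, Finset.sum_const, Finset.card_singleton, one_smul,
            zero_add, add_zero, Int.toNat_of_nonneg (by linarith : 0 ≤ g - 1)] at this
      rw [show (g - 1) * (P w - P q) = -(g - 1) * (P q - P w) by ring] at this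
      exact this
  obtain ⟨hq1, hq2⟩ := abs_le.1 hqΔ
  have hDq : |P q - P w| ≤ 2 * Δ := by rw [abs_le]; constructor <;> linarith
  have hgD : |-(g - 1) * (P q - P w)| ≤ 2 * A := by
    rw [abs_mul, abs_neg, abs_of_nonneg (by linarith : 0 ≤ g - 1)]
    have h2 := mul_le_mul_of_nonneg_left hDq (by linarith : 0 ≤ g - 1)
    linarith [sub_mul g 1 (2 * Δ), mul_left_comm g 2 Δ, mul_assoc 1024 g Δ]
  have hfinal := card_le_of_reflect hg hk₀0 hY (by rw [← hc₀]; ring : P q = 2 * c₀ + (P q - P w))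
    hqμ hqc hμ hqM (by
      intro y hy
      have h1 := abs_le.1 (hYA y hy)
      have h2 := abs_le.1 hgD
      have h3 := hregion (y + -(g - 1) * (P q - P w)) (by rw [abs_le]; constructor <;> linarith)
      exact ⟨h3.1, h3.2 _ (hVP _ hqΔ) hqc.apply_le⟩)
  push_cast at hfinal
  rw [Int.toNat_of_nonneg hm0, Int.toNat_of_nonneg (by linarith : 0 ≤ g - 1)] at hfinal
  -- compare the sizes
  have hEX : 1024 * g * (16 * S₁ + 2 * g) * E * v ≤ X := by
    rw [hXv, mul_comm v]
    exact mul_le_mul_of_nonneg_right hE (by linarith)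
  have hE0 : (0 : ℤ) ≤ E := by positivity
  have hvE : (E : ℤ) ≤ E * v := le_mul_of_one_le_right hE0 (by linarith)
  have h3 : 16 * (S₁ * (E * v)) + 2 * g * E ≤ (16 * S₁ + 2 * g) * E * v := by
    have := mul_le_mul_of_nonneg_left hvE (by linarith : 0 ≤ 2 * g)
    linarith
  have h4 : 2 * k₀ + 1 ≤ (16 * S₁ + 2 * g) * E * v + 2 * Δ := by
    have h5 : 2 * (4 * (S₁ * v * (2 * (E : ℤ)))) = 16 * (S₁ * (E * v)) := by ring
    have h6 : (g - 1) * (2 * (E : ℤ)) = 2 * g * E - 2 * E := by ring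
    linarith
  have h5 := mul_le_mul_of_nonneg_left h4 (by linarith : 0 ≤ 1024 * g)
  have h6 : 1024 * g * ((16 * S₁ + 2 * g) * E * v + 2 * Δ) =
    1024 * g * (16 * S₁ + 2 * g) * E * v + 2 * (1024 * g * Δ) := by ring
  have h7 : 1024 * g * (2 * k₀ + 1) = 2048 * (g * k₀) + 1024 * g := by ring
  rw [h6, h7] at h5
  linarith

/-! ### Counting chains of edges -/

section
variable {P : ℤ → ℤ} {n : ℤ} {χ : ℤ → Bool}

/-- A family of labels that takes each value at most `m` times. -/
theorem sum_card_badAt_le_mul {ι : Type*} (s : Finset ι) (f : ι → ℤ) {m : ℕ}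
    (hf : ∀ ℓ, (s.filter fun i => f i = ℓ).card ≤ m) :
    ∑ i ∈ s, (badAt P n χ (f i)).card ≤ m * (badPairs P n χ).card := by
  classical
  rw [Finset.sum_comp (fun ℓ => (badAt P n χ ℓ).card) f]
  calc _ ≤ ∑ ℓ ∈ s.image f, m * (badAt P n χ ℓ).card :=
        Finset.sum_le_sum fun ℓ _ => by rw [smul_eq_mul]; exact Nat.mul_le_mul_right _ (hf ℓ)
    _ = m * ∑ ℓ ∈ s.image f, (badAt P n χ ℓ).card := by rw [Finset.mul_sum]
    _ ≤ _ := Nat.mul_le_mul_left _ (sum_card_badAt_le _ id (by simp [Set.InjOn]))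

/-- Where the number `y₀` is moved by the `i` moves along the labels `b j`, `r j` with `j < i`. -/
def moved (P : ℤ → ℤ) (b r : ℕ → ℤ) (y₀ : ℤ) (i : ℕ) : ℤ :=
  y₀ - ∑ j ∈ Finset.range i, (P (b j) - P (r j))

theorem moved_succ (b r : ℕ → ℤ) (y₀ : ℤ) (i : ℕ) :
    moved P b r y₀ (i + 1) = P (r i) - (P (b i) - moved P b r y₀ i) := by
  simp only [moved, Finset.sum_range_succ]; ring

/-- Double counting of chains. For each `k ∈ K` and `x ∈ X` a path in the graph of edges starts
at `x`, of color `R`, along an edge with label `w k`, and goes on along edges with labels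
`b 0, r k 0, b 1, r k 1, …, b m, r k m`. If it ends in a number of color `R`, then it contains a
bad edge. The position in the path, one bit `t k i`, and the edge determine `k` and `x`, so each
bad edge is counted as often as its label occurs among the possible labels `ρ i β`. The last
label `r k m` may depend on `k` in any way. -/
theorem card_chains_le {R : Bool} {K X : Finset ℤ} {w : ℤ → ℤ} {b : ℕ → ℤ} {r : ℤ → ℕ → ℤ}
    {ρ : ℕ → Bool → ℤ} {t : ℤ → ℕ → Bool} {m M : ℕ}
    (hw : ∀ k ∈ K, χ (w k) = R) (hwn : ∀ k ∈ K, 1 ≤ w k ∧ w k ≤ n) (hwi : Set.InjOn w K)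
    (hX : ∀ x ∈ X, χ x = R) (hXn : ∀ x ∈ X, 1 ≤ x ∧ x ≤ n)
    (hb : ∀ i ≤ m, χ (b i) = !R) (hbn : ∀ i ≤ m, 1 ≤ b i ∧ b i ≤ n)
    (hbi : Set.InjOn b (Finset.range (m + 1)))
    (hr : ∀ k ∈ K, ∀ i ≤ m, χ (r k i) = R) (hrn : ∀ k ∈ K, ∀ i ≤ m, 1 ≤ r k i ∧ r k i ≤ n)
    (hrρ : ∀ k ∈ K, ∀ i < m, r k i = ρ i (t k i))
    (hM : ∀ ℓ, ((Finset.range m ×ˢ Finset.univ).filter fun s : ℕ × Bool => ρ s.1 s.2 = ℓ).card ≤ M)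
    (hy : ∀ k ∈ K, ∀ x ∈ X, ∀ i ≤ m + 1, 1 ≤ moved P b (r k) (P (w k) - x) i ∧
      moved P b (r k) (P (w k) - x) i ≤ n)
    (hy' : ∀ k ∈ K, ∀ x ∈ X, ∀ i ≤ m, 1 ≤ P (b i) - moved P b (r k) (P (w k) - x) i ∧
      P (b i) - moved P b (r k) (P (w k) - x) i ≤ n)
    (hend : ∀ k ∈ K, ∀ x ∈ X, χ (moved P b (r k) (P (w k) - x) (m + 1)) = R)
    (hinj : ∀ i ≤ m, ∀ k ∈ K, ∀ k' ∈ K, ∀ x ∈ X, ∀ x' ∈ X, (i < m → t k i = t k' i) →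
      moved P b (r k) (P (w k) - x) i = moved P b (r k') (P (w k') - x') i → k = k' ∧ x = x') :
    K.card * X.card ≤ (M + 6) * (badPairs P n χ).card := by
  classical
  set y : ℤ × ℤ → ℕ → ℤ := fun s => moved P b (r s.1) (P (w s.1) - s.2) with hydef
  -- the pairs whose path has a bad edge with label `w k`; `b i`; `r k i`, `i < m`; `r k m`
  set F₀ := (K ×ˢ X).filter fun s => (s.2, w s.1) ∈ badPairs P n χ with hF₀
  set F₁ : ℕ × Bool → Finset (ℤ × ℤ) := fun q => (K ×ˢ X).filter fun s =>
    t s.1 q.1 = q.2 ∧ y s q.1 ∈ badAt P n χ (b q.1) with hF₁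
  set F₂ : ℕ × Bool → Finset (ℤ × ℤ) := fun q => (K ×ˢ X).filter fun s =>
    t s.1 q.1 = q.2 ∧ P (b q.1) - y s q.1 ∈ badAt P n χ (ρ q.1 q.2) with hF₂
  set F₃ := (K ×ˢ X).filter fun s => (P (b m) - y s m, r s.1 m) ∈ badPairs P n χ with hF₃
  have hcover : K ×ˢ X ⊆ (F₀ ∪ (Finset.range (m + 1) ×ˢ Finset.univ).biUnion F₁) ∪
      ((Finset.range m ×ˢ Finset.univ).biUnion F₂ ∪ F₃) := by
    rintro ⟨k, x⟩ hkx
    by_contra hnot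
    simp only [Finset.mem_union, Finset.mem_biUnion, Finset.mem_product, Finset.mem_univ,
      and_true, Finset.mem_range, not_or, not_exists, not_and] at hnot
    obtain ⟨⟨h0, h1⟩, h2, h3⟩ := hnot
    have hk := (Finset.mem_product.1 hkx).1
    have hx := (Finset.mem_product.1 hkx).2
    have hB : ∀ i ≤ m, y (k, x) i ∉ badAt P n χ (b i) := fun i hi hbad =>
      h1 (i, t k i) (Nat.lt_succ_iff.2 hi) (Finset.mem_filter.2 ⟨hkx, rfl, hbad⟩)
    have hA : ∀ i ≤ m, (P (b i) - y (k, x) i, r k i) ∉ badPairs P n χ := by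
      intro i hi hbad
      rcases hi.lt_or_eq with hi' | rfl
      · refine h2 (i, t k i) hi' (Finset.mem_filter.2 ⟨hkx, rfl, ?_⟩)
        rw [mem_badAt, ← hrρ k hk i hi']
        exact hbad
      · exact h3 (Finset.mem_filter.2 ⟨hkx, hbad⟩)
    have hcol : ∀ i ≤ m + 1, χ (y (k, x) i) = !R := by
      intro i
      induction i with
      | zero =>
        intro _
        have := hy k hk x hx 0 (by omega)
        simp only [moved, Finset.range_zero, Finset.sum_empty, sub_zero] at this
        simp only [hydef, moved, Finset.range_zero, Finset.sum_empty, sub_zero]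
        by_contra hc
        refine h0 (Finset.mem_filter.2 ⟨hkx, mem_badPairs.2 ⟨⟨hXn x hx, hwn k hk⟩, this, ?_, ?_⟩⟩)
        · rw [hX x hx, hw k hk]
        · rw [hw k hk]; simpa using hc
      | succ i ih =>
        intro hi
        have hi' : i ≤ m := by omega
        have hyi := ih (by omega)
        by_contra hc
        have hc' : χ (y (k, x) (i + 1)) = R := by simpa using hc
        have h1 := hy k hk x hx i (by omega)
        have h2 := hy k hk x hx (i + 1) hi
        have h3 := hy' k hk x hx i hi'
        by_cases hm : χ (P (b i) - y (k, x) i) = R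
        · refine hA i hi' (mem_badPairs.2 ⟨⟨h3, hrn k hk i hi'⟩, ?_, ?_, ?_⟩)
          · rw [moved_succ] at h2; exact h2
          · rw [hr k hk i hi']; exact hm
          · rw [hr k hk i hi', ← hc']
            simp only [hydef, moved_succ]
        · refine hB i hi' (mem_badAt.2 (mem_badPairs.2 ⟨⟨h1, hbn i hi'⟩, h3, ?_, ?_⟩))
          · rw [hb i hi']; exact hyi
          · rw [hb i hi']; exact Bool.eq_not.2 hm
    have h1 := hcol (m + 1) le_rfl
    rw [show χ (y (k, x) (m + 1)) = R from hend k hk x hx] at h1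
    simp at h1
  have c0 : F₀.card ≤ (badPairs P n χ).card := by
    refine Finset.card_le_card_of_injOn (fun s => (s.2, w s.1)) ?_ ?_
    · intro s hs
      exact (Finset.mem_filter.1 (Finset.mem_coe.1 hs)).2
    · rintro ⟨k, x⟩ hs ⟨k', x'⟩ hs' h
      have hs := Finset.mem_product.1 (Finset.mem_filter.1 (Finset.mem_coe.1 hs)).1
      have hs' := Finset.mem_product.1 (Finset.mem_filter.1 (Finset.mem_coe.1 hs')).1
      simp only [Prod.mk.injEq] at h
      exact Prod.ext (hwi hs.1 hs'.1 h.2) h.1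
  have c3 : F₃.card ≤ (badPairs P n χ).card := by
    refine Finset.card_le_card_of_injOn (fun s => (P (b m) - y s m, r s.1 m)) ?_ ?_
    · intro s hs
      exact (Finset.mem_filter.1 (Finset.mem_coe.1 hs)).2
    · rintro ⟨k, x⟩ hs ⟨k', x'⟩ hs' h
      have hs := Finset.mem_product.1 (Finset.mem_filter.1 (Finset.mem_coe.1 hs)).1
      have hs' := Finset.mem_product.1 (Finset.mem_filter.1 (Finset.mem_coe.1 hs')).1
      simp only [Prod.mk.injEq] at h
      have := hinj m le_rfl k hs.1 k' hs'.1 x hs.2 x' hs'.2 (fun h => absurd h (lt_irrefl _))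
        (by have := h.1; simp only [hydef] at this; linarith)
      rw [this.1, this.2]
  have c1 : ((Finset.range (m + 1) ×ˢ Finset.univ).biUnion F₁).card ≤
      4 * (badPairs P n χ).card := by
    calc _ ≤ ∑ q ∈ Finset.range (m + 1) ×ˢ (Finset.univ : Finset Bool), (F₁ q).card :=
          Finset.card_biUnion_le
      _ ≤ ∑ q ∈ Finset.range (m + 1) ×ˢ (Finset.univ : Finset Bool),
          (badAt P n χ (b q.1)).card := by
        refine Finset.sum_le_sum fun q hq => ?_
        refine Finset.card_le_card_of_injOn (fun s => y s q.1) ?_ ?_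
        · intro s hs
          exact (Finset.mem_filter.1 (Finset.mem_coe.1 hs)).2.2
        · rintro ⟨k, x⟩ hs ⟨k', x'⟩ hs' h
          have hs := Finset.mem_filter.1 (Finset.mem_coe.1 hs)
          have hs' := Finset.mem_filter.1 (Finset.mem_coe.1 hs')
          have hk := Finset.mem_product.1 hs.1
          have hk' := Finset.mem_product.1 hs'.1
          have hq := Finset.mem_range.1 (Finset.mem_product.1 hq).1
          have := hinj q.1 (by omega) k hk.1 k' hk'.1 x hk.2 x' hk'.2
            (fun _ => hs.2.1.trans hs'.2.1.symm) h
          rw [this.1, this.2]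
      _ = 2 * ∑ i ∈ Finset.range (m + 1), (badAt P n χ (b i)).card := by
        rw [Finset.sum_product, Finset.mul_sum]; simp
      _ ≤ 2 * (badPairs P n χ).card := Nat.mul_le_mul_left _ (sum_card_badAt_le _ _ hbi)
      _ ≤ _ := by omega
  have c2 : ((Finset.range m ×ˢ Finset.univ).biUnion F₂).card ≤ M * (badPairs P n χ).card := by
    calc _ ≤ ∑ q ∈ Finset.range m ×ˢ (Finset.univ : Finset Bool), (F₂ q).card :=
          Finset.card_biUnion_le
      _ ≤ ∑ q ∈ Finset.range m ×ˢ (Finset.univ : Finset Bool),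
          (badAt P n χ (ρ q.1 q.2)).card := by
        refine Finset.sum_le_sum fun q hq => ?_
        refine Finset.card_le_card_of_injOn (fun s => P (b q.1) - y s q.1) ?_ ?_
        · intro s hs
          exact (Finset.mem_filter.1 (Finset.mem_coe.1 hs)).2.2
        · rintro ⟨k, x⟩ hs ⟨k', x'⟩ hs' h
          have hs := Finset.mem_filter.1 (Finset.mem_coe.1 hs)
          have hs' := Finset.mem_filter.1 (Finset.mem_coe.1 hs')
          have hk := Finset.mem_product.1 hs.1
          have hk' := Finset.mem_product.1 hs'.1
          have hq := Finset.mem_range.1 (Finset.mem_product.1 hq).1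
          have := hinj q.1 (by omega) k hk.1 k' hk'.1 x hk.2 x' hk'.2
            (fun _ => hs.2.1.trans hs'.2.1.symm) (by
              simp only [hydef] at h; linarith)
          rw [this.1, this.2]
      _ ≤ _ := sum_card_badAt_le_mul _ (fun q : ℕ × Bool => ρ q.1 q.2) hM
  rw [← Finset.card_product]
  have h1 := (Finset.card_le_card hcover).trans (Finset.card_union_le _ _)
  have h2 := Finset.card_union_le F₀ ((Finset.range (m + 1) ×ˢ Finset.univ).biUnion F₁)
  have h3 := Finset.card_union_le ((Finset.range m ×ˢ Finset.univ).biUnion F₂) F₃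
  rw [add_mul]
  omega

end

/-! ### Gadgets built from finite differences -/

/-- The labels of the two states of a gadget of order `j + 1`: the multiset of all
`offsets (j + 1) true s` and that of all `offsets (j + 1) false s` are those of the indices that
appear with positive and with negative sign in a finite difference of order `j + 1`. They are
built like the Thue-Morse sequence. -/
def offsets : ℕ → Bool → ℕ → ℕ
  | 0, β, _ => if β then 1 else 0
  | j + 1, β, s => if s % 2 = 0 then offsets j β (s / 2) + 1 else offsets j (!β) (s / 2)

theorem offsets_le (j : ℕ) : ∀ β s, offsets j β s ≤ j + 1 := by
  induction j with
  | zero => intro β s; cases β <;> simp [offsets]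
  | succ j ih =>
    intro β s
    simp only [offsets]
    split_ifs
    · have := ih β (s / 2); omega
    · have := ih (!β) (s / 2); omega

theorem sum_range_two_mul (f : ℕ → ℤ) (N : ℕ) :
    ∑ s ∈ Finset.range (2 * N), f s = ∑ s ∈ Finset.range N, (f (2 * s) + f (2 * s + 1)) := by
  induction N with
  | zero => simp
  | succ N ih =>
    rw [Finset.sum_range_succ, ← ih, mul_add, mul_one, Finset.sum_range_succ,
      Finset.sum_range_succ]
    ring

/-- The two states of a gadget differ by a multiple of a finite difference; repeating it `2 ^ e`
times gives gadgets of different orders the same number of labels. -/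
theorem sum_offsets (e h : ℕ) (j : ℕ) : ∀ (F : ℤ → ℤ) (x : ℤ),
    ∑ s ∈ Finset.range (2 ^ (e + j)), (F (x + offsets j true s * h) - F (x + offsets j false s * h))
      = 2 ^ e * (Δ_[(h : ℤ)] ^[j + 1] F) x := by
  induction j with
  | zero => intro F x; simp [offsets, fwdDiff, mul_sub]
  | succ j ih =>
    intro F x
    rw [show 2 ^ (e + (j + 1)) = 2 * 2 ^ (e + j) by ring, sum_range_two_mul]
    have h2 : ∀ s, (2 * s) / 2 = s := fun s => by omega
    have h3 : ∀ s, (2 * s + 1) / 2 = s := fun s => by omega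
    have h4 : ∀ s, (2 * s) % 2 = 0 := fun s => by omega
    have h5 : ∀ s, ¬ (2 * s + 1) % 2 = 0 := fun s => by omega
    simp only [offsets, h2, h3, h4, h5, if_true, if_false, Bool.not_true, Bool.not_false]
    have h6 := ih F x
    have h7 := ih F (x + h)
    rw [Function.iterate_succ_apply', fwdDiff, mul_sub, ← h6, ← h7, ← Finset.sum_sub_distrib]
    refine Finset.sum_congr rfl fun s _ => ?_
    have h8 : ∀ a : ℕ, x + ((a + 1 : ℕ) : ℤ) * h = x + h + a * h := fun a => by push_cast; ring
    rw [h8, h8]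
    ring

/-- Greedy choice of digits `0` and `1`: the sums of some terms of a slowly decreasing sequence
approximate every number in their range up to `g`. -/
theorem exists_bits {g : ℤ} : ∀ (m : ℕ) (v : ℕ → ℤ), (∀ i < m, 0 ≤ v i) →
    (∀ i < m, v i ≤ g + ∑ j ∈ Finset.Ico (i + 1) m, v j) →
    ∀ τ : ℤ, 0 ≤ τ → τ < g + ∑ j ∈ Finset.range m, v j →
    ∃ t : ℕ → Bool, 0 ≤ τ - ∑ j ∈ Finset.range m, (if t j then v j else 0) ∧
      τ - ∑ j ∈ Finset.range m, (if t j then v j else 0) < g := by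
  intro m
  induction m with
  | zero => intro v _ _ τ h1 h2; exact ⟨fun _ => false, by simpa using h1, by simpa using h2⟩
  | succ m ih =>
    intro v hv0 hv τ h1 h2
    have hv' : ∀ i < m, v (i + 1) ≤ g + ∑ j ∈ Finset.Ico (i + 1) m, v (j + 1) := by
      intro i hi
      have := hv (i + 1) (by omega)
      rw [Finset.sum_Ico_add' (fun j => v j) (i + 1) m 1]
      exact this
    have hv00 := hv 0 (Nat.succ_pos _)
    have hr : ∑ j ∈ Finset.Ico (0 + 1) (m + 1), v j = ∑ j ∈ Finset.range m, v (j + 1) := by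
      rw [← Finset.sum_Ico_add' (fun j => v j) 0 m 1, Finset.range_eq_Ico]
    rw [hr] at hv00
    rw [Finset.sum_range_succ'] at h2
    have key : ∀ (β : Bool), 0 ≤ τ - (if β then v 0 else 0) →
        τ - (if β then v 0 else 0) < g + ∑ j ∈ Finset.range m, v (j + 1) →
        ∃ t : ℕ → Bool, 0 ≤ τ - ∑ j ∈ Finset.range (m + 1), (if t j then v j else 0) ∧
          τ - ∑ j ∈ Finset.range (m + 1), (if t j then v j else 0) < g := by
      intro β ha hb
      obtain ⟨t, ht1, ht2⟩ := ih (fun i => v (i + 1)) (fun i hi => hv0 _ (by omega)) hv' _ ha hb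
      refine ⟨fun j => if j = 0 then β else t (j - 1), ?_⟩
      rw [Finset.sum_range_succ']
      simp only [Nat.add_eq_zero_iff, one_ne_zero, and_false, if_false, Nat.add_sub_cancel,
        if_true]
      constructor <;> linarith
    by_cases hc : v 0 ≤ τ
    · exact key true (by simpa using hc) (by simp only [if_true]; linarith)
    · exact key false (by simpa using h1) (by
        simp only [Bool.false_eq_true, if_false, sub_zero]; linarith)

theorem mul_succ_le_two_pow {K L : ℕ} (h : 4 * K ≤ L) : K * (L + 1) ≤ 2 ^ L := by
  obtain ⟨a, b, rfl, hab, hba⟩ : ∃ a b, L = a + b ∧ a ≤ b ∧ b ≤ a + 1 :=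
    ⟨L / 2, L - L / 2, by omega, by omega, by omega⟩
  have ha : a + 1 ≤ 2 ^ a := Nat.lt_two_pow_self
  have hb : b + 1 ≤ 2 ^ b := Nat.lt_two_pow_self
  calc K * (a + b + 1) ≤ K * (2 * (a + 1)) := Nat.mul_le_mul_left _ (by omega)
    _ = (a + 1) * (2 * K) := by ring
    _ ≤ (a + 1) * (b + 1) := Nat.mul_le_mul_left _ (by omega)
    _ ≤ 2 ^ a * 2 ^ b := Nat.mul_le_mul ha hb
    _ = _ := by rw [pow_add]

/-- The effect of a gadget of order `j + 2` with step `h` near `z`, up to constants. -/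
theorem Growth.gadget_bounds {P : ℤ → ℤ} {e : ℕ} {C g z₀ : ℤ} (G : Growth P (e + 2) C g z₀)
    {j : ℕ} (hj : j ≤ e) {h x z : ℤ} (hh : 1 ≤ h) (hx : z₀ ≤ x) (hxz : z ≤ 2 * x) (hz : 0 ≤ z)
    (hxh : x + ((j + 2 : ℕ) : ℤ) * h ≤ z) :
    h ^ (j + 2) * z ^ (e - j) ≤ 2 * (2 ^ (e - j) * (Δ_[h] ^[j + 2] P) x) ∧
      2 ^ (e - j) * (Δ_[h] ^[j + 2] P) x ≤ C * 2 ^ e * (h ^ (j + 2) * z ^ (e - j)) := by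
  have hC := G.one_le_C
  obtain ⟨h1, h2⟩ := G.fd (j + 2) (by omega) h hh x hx
  rw [show e + 2 - (j + 2) = e - j by omega] at h1 h2
  have hx0 : 0 ≤ x := by linarith
  have h3 : z ^ (e - j) ≤ 2 ^ (e - j) * x ^ (e - j) := by
    rw [← mul_pow]; gcongr
  have h4 : (x + ((j + 2 : ℕ) : ℤ) * h) ^ (e - j) ≤ z ^ (e - j) := by
    gcongr
  have h5 : (2 : ℤ) ^ (e - j) ≤ 2 ^ e := pow_le_pow_right₀ (by norm_num) (by omega)
  have hp0 : 0 ≤ h ^ (j + 2) := by positivity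
  constructor
  · calc h ^ (j + 2) * z ^ (e - j) ≤ h ^ (j + 2) * (2 ^ (e - j) * x ^ (e - j)) := by gcongr
      _ = 2 ^ (e - j) * (h ^ (j + 2) * x ^ (e - j)) := by ring
      _ ≤ 2 ^ (e - j) * (2 * (Δ_[h] ^[j + 2] P) x) := by gcongr
      _ = _ := by ring
  · calc _ ≤ 2 ^ (e - j) * (C * (h ^ (j + 2) * z ^ (e - j))) := by
          refine mul_le_mul_of_nonneg_left (h2.trans ?_) (by positivity)
          gcongr
      _ ≤ 2 ^ e * (C * (h ^ (j + 2) * z ^ (e - j))) := by gcongr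
      _ = _ := by ring

/-- A power `4 ^ L` between `z` and `4 * z`; then `2 ^ L` is about `√z`, and exceeds any multiple of
`L`. -/
theorem exists_four_pow {K : ℕ} {z : ℤ} (hz : 4 ^ (4 * K + 1) ≤ z) :
    ∃ L : ℕ, z ≤ 4 ^ L ∧ (4 : ℤ) ^ L ≤ 4 * z ∧ K * (L + 1) ≤ 2 ^ L := by
  have hzpos : 0 < z := lt_of_lt_of_le (by positivity) hz
  have hle : z ≤ 4 ^ Nat.clog 4 z.toNat := by
    have := Nat.le_pow_clog (b := 4) (by norm_num) z.toNat
    zify at this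
    rwa [Int.toNat_of_nonneg hzpos.le] at this
  refine ⟨Nat.clog 4 z.toNat, hle, ?_, mul_succ_le_two_pow ?_⟩
  · have hz1 : 1 < z.toNat := by
      have : (4 : ℤ) ^ 1 ≤ 4 ^ (4 * K + 1) := pow_le_pow_right₀ (by norm_num) (by omega)
      omega
    have h1 := Nat.pow_pred_clog_lt_self (b := 4) (by norm_num) hz1
    have h2 := Nat.clog_pos (b := 4) (by norm_num) hz1
    obtain ⟨k, hk⟩ : ∃ k, Nat.clog 4 z.toNat = k + 1 := ⟨_, (Nat.succ_pred_eq_of_pos h2).symm⟩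
    rw [hk] at h1 ⊢
    simp only [Nat.pred_succ] at h1
    zify at h1
    rw [Int.toNat_of_nonneg hzpos.le] at h1
    rw [pow_succ]; linarith
  · by_contra! hlt
    have h2 : (4 : ℤ) ^ Nat.clog 4 z.toNat ≤ 4 ^ (4 * K) :=
      pow_le_pow_right₀ (by norm_num) hlt.le
    have h3 : (4 : ℤ) ^ (4 * K) < 4 ^ (4 * K + 1) :=
      pow_lt_pow_right₀ (by norm_num) (Nat.lt_succ_self _)
    linarith

set_option maxHeartbeats 1000000 in
/-- Gadgets near `z`. The `γ`-th gadget consists of `q` moves, and can be in two states, which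
shift a number by amounts that differ by `v γ`: a multiple of a finite difference of `P` of
order at least `2` with a step `2 ^ l`. The amounts `v γ` decrease slowly from `O(z ^ (d - 1))`
to `g`, so that every number in this range is approximated by the sum of some of them. There are
`O(log z)` gadgets, but each label appears in `O(1)` of them only. -/
theorem Growth.exists_gadgets {P : ℤ → ℤ} {d : ℕ} {C g z₀ : ℤ} (G : Growth P d C g z₀)
    (hd : 2 ≤ d) (B K : ℕ) :
    ∃ (M : ℕ) (z₁ : ℤ), ∀ z : ℤ, z₁ ≤ z → ∃ (q m U : ℕ) (ρ : ℕ → Bool → ℤ) (v : ℕ → ℤ),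
      0 < q ∧ (∀ γ < m, v γ =
        ∑ s ∈ Finset.range q, (P (ρ (γ * q + s) true) - P (ρ (γ * q + s) false))) ∧
      (∀ γ < m, 0 ≤ v γ) ∧ (∀ γ < m, v γ ≤ g + ∑ γ' ∈ Finset.Ico (γ + 1) m, v γ') ∧
      B * z ^ (d - 1) ≤ ∑ γ ∈ Finset.range m, v γ ∧
      (∀ i < m * q, ∀ β, ρ i β ≤ z ∧ z - U ≤ ρ i β) ∧
      (∀ ℓ, ((Finset.range (m * q) ×ˢ Finset.univ).filter
        fun s : ℕ × Bool => ρ s.1 s.2 = ℓ).card ≤ M) ∧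
      ((K * ((m * q + 1) * (m * q + 1 + U)) : ℕ) : ℤ) ≤ z := by
  obtain ⟨e₀, rfl⟩ : ∃ e₀, d = e₀ + 2 := ⟨d - 2, by omega⟩
  have hC := G.one_le_C
  obtain ⟨Cn, hCn⟩ := Int.eq_ofNat_of_zero_le (zero_le_one.trans hC)
  -- each kind of gadget is present `Rc` times, which compensates the ratio of the effects of
  -- consecutive kinds
  set Rc : ℕ := Cn * 4 ^ (e₀ + 2) + 2 * B + 1 with hRc
  have hRc0 : 0 < Rc := by omega
  set q : ℕ := 2 ^ (e₀ + 1) with hq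
  have hq0 : 0 < q := by positivity
  set c₁ : ℕ := (e₀ + 1) * Rc * q + 1 with hc₁
  set K' : ℕ := 4 * ((K + 2) * (c₁ * (c₁ + e₀ + 3))) with hK'
  refine ⟨(e₀ + 1) * (Rc * (q * (2 * (e₀ + 4)))), max (2 * z₀) (4 ^ (4 * K' + 1)), ?_⟩
  intro z hz
  have hz0 : 2 * z₀ ≤ z := (le_max_left _ _).trans hz
  have hz4 : (4 : ℤ) ^ (4 * K' + 1) ≤ z := (le_max_right _ _).trans hz
  have hz01 := G.one_le_z₀
  have hzpos : 0 < z := by linarith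
  -- the scale `2 ^ L`, about `√z`
  obtain ⟨L, hL1, hL3, hK'L⟩ := exists_four_pow hz4
  set m : ℕ := (e₀ + 1) * (L + 1) * Rc with hm
  set U : ℕ := (e₀ + 3) * 2 ^ L with hU
  have hmq : m * q + 1 ≤ c₁ * (L + 1) := by
    rw [hm, hc₁]
    have : (e₀ + 1) * (L + 1) * Rc * q = (e₀ + 1) * Rc * q * (L + 1) := by ring
    rw [this, add_mul ((e₀ + 1) * Rc * q) 1 (L + 1)]
    omega
  have hsize : (((K + 2) * ((m * q + 1) * (m * q + 1 + U)) : ℕ) : ℤ) ≤ z := by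
    have hL : L + 1 ≤ 2 ^ L := Nat.lt_two_pow_self
    have h1 : m * q + 1 + U ≤ (c₁ + e₀ + 3) * 2 ^ L := by
      have h2 := Nat.mul_le_mul_left c₁ hL
      have h3 := hmq.trans h2
      calc m * q + 1 + U ≤ c₁ * 2 ^ L + (e₀ + 3) * 2 ^ L := by
            rw [hU]; exact Nat.add_le_add_right h3 _
        _ = _ := by ring
    have h2 : 4 * ((K + 2) * ((m * q + 1) * (m * q + 1 + U))) ≤ 4 ^ L := by
      calc _ ≤ 4 * ((K + 2) * ((c₁ * (L + 1)) * ((c₁ + e₀ + 3) * 2 ^ L))) := by gcongr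
        _ = K' * (L + 1) * 2 ^ L := by rw [hK']; ring
        _ ≤ 2 ^ L * 2 ^ L := Nat.mul_le_mul_right _ hK'L
        _ = 4 ^ L := by rw [← mul_pow]; norm_num
    zify at h2
    push_cast
    linarith
  have hUz : 2 * (U : ℤ) ≤ z := by
    refine le_trans ?_ hsize
    have h1 : 1 ≤ m * q + 1 := by omega
    have : 2 * U ≤ (K + 2) * ((m * q + 1) * (m * q + 1 + U)) := by
      calc 2 * U ≤ (K + 2) * (1 * (m * q + 1 + U)) := Nat.mul_le_mul (by omega) (by omega)
        _ ≤ _ := by gcongr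
    exact_mod_cast this
  -- the `a`-th kind of gadgets has order `j a + 2` and step `2 ^ l a`; for each order the step
  -- decreases from `2 ^ L` to `1`
  set j : ℕ → ℕ := fun a => a / (L + 1) with hj
  set l : ℕ → ℕ := fun a => L - a % (L + 1) with hl
  set x : ℕ → ℤ := fun a => z - (j a + 3) * 2 ^ l a with hx
  set V : ℕ → ℤ := fun a => 2 ^ (e₀ - j a) * (Δ_[((2 ^ l a : ℕ) : ℤ)] ^[j a + 2] P) (x a) with hV
  set N : ℕ → ℤ := fun a => ((2 ^ l a : ℕ) : ℤ) ^ (j a + 2) * z ^ (e₀ - j a) with hN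
  have hjle : ∀ a < (e₀ + 1) * (L + 1), j a ≤ e₀ := fun a ha =>
    Nat.lt_succ_iff.1 ((Nat.div_lt_iff_lt_mul (Nat.succ_pos L)).2 ha)
  have hlL : ∀ a, (2 : ℕ) ^ l a ≤ 2 ^ L := fun a => Nat.pow_le_pow_right (by norm_num) (by
    simp only [hl]; omega)
  have hxU : ∀ a < (e₀ + 1) * (L + 1), z - U ≤ x a := by
    intro a ha
    have h1 : (j a + 3) * 2 ^ l a ≤ U := Nat.mul_le_mul (by have := hjle a ha; omega) (hlL a)
    zify at h1
    simp only [hx]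
    linarith
  have hfd : ∀ a < (e₀ + 1) * (L + 1), N a ≤ 2 * V a ∧ V a ≤ C * 2 ^ e₀ * N a := by
    intro a ha
    have hje := hjle a ha
    have hxa := hxU a ha
    have hx2 : z ≤ 2 * x a := by linarith
    have hxz : x a + ((j a + 2 : ℕ) : ℤ) * ((2 ^ l a : ℕ) : ℤ) ≤ z := by
      have : (0 : ℤ) ≤ 2 ^ l a := by positivity
      simp only [hx]; push_cast; linarith
    exact G.gadget_bounds hje (by exact_mod_cast Nat.one_le_two_pow) (by linarith) hx2 hzpos.le hxz
  have hN0 : ∀ a, 0 ≤ N a := fun a => by simp only [hN]; positivity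
  have hV0 : ∀ a < (e₀ + 1) * (L + 1), 0 ≤ V a := fun a ha => by
    have := (hfd a ha).1; have := hN0 a; linarith
  have hNstep : ∀ a, a + 1 < (e₀ + 1) * (L + 1) → N a ≤ 2 ^ (e₀ + 2) * N (a + 1) := by
    intro a ha
    have hd1 := Nat.div_add_mod a (L + 1)
    have hL0 : 0 < L + 1 := Nat.succ_pos L
    have hr1 := Nat.mod_lt a hL0
    have hje := hjle (a + 1) ha
    by_cases hlast : a % (L + 1) = L
    · have h1 : j (a + 1) = j a + 1 := by
        simp only [hj]
        rw [Nat.div_eq_iff hL0]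
        have : (a / (L + 1) + 1) * (L + 1) = (L + 1) * (a / (L + 1)) + (L + 1) := by ring
        omega
      have h2 : l (a + 1) = L := by
        simp only [hl]
        have : (a + 1) % (L + 1) = 0 := by
          rw [show a + 1 = (L + 1) * (a / (L + 1) + 1) by
            rw [mul_add, mul_one]; omega]
          exact Nat.mul_mod_right _ _
        omega
      have h3 : l a = 0 := by simp only [hl]; omega
      simp only [hN, h1, h2, h3]
      rw [show e₀ - j a = e₀ - (j a + 1) + 1 by omega, pow_succ z]
      -- the next order starts with step `2 ^ L ≥ √z`, which makes up for the lost factor `z`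
      have h4 : z ≤ (2 ^ L) ^ (j a + 1 + 2) := by
        calc z ≤ 4 ^ L := hL1
          _ = (2 ^ L) ^ 2 := by rw [← pow_mul, mul_comm, pow_mul]; norm_num
          _ ≤ _ := pow_le_pow_right₀ (one_le_pow₀ (by norm_num)) (by omega)
      push_cast
      simp only [one_pow, one_mul]
      have h5 : (1 : ℤ) ≤ 2 ^ (e₀ + 2) := one_le_pow₀ (by norm_num)
      calc z ^ (e₀ - (j a + 1)) * z ≤ z ^ (e₀ - (j a + 1)) * (2 ^ L) ^ (j a + 1 + 2) := by gcongr
        _ = 1 * ((2 ^ L) ^ (j a + 1 + 2) * z ^ (e₀ - (j a + 1))) := by ring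
        _ ≤ _ := by gcongr
    · have hdm : (a + 1) / (L + 1) = a / (L + 1) := by
        rw [Nat.div_eq_iff hL0]
        have : a / (L + 1) * (L + 1) = (L + 1) * (a / (L + 1)) := by ring
        omega
      have h1 : j (a + 1) = j a := hdm
      have h2 : l a = l (a + 1) + 1 := by
        have := Nat.div_add_mod (a + 1) (L + 1)
        have h6 := Nat.mod_lt (a + 1) hL0
        rw [hdm] at this
        simp only [hl]; omega
      simp only [hN, h1, h2]
      push_cast
      have h5 : (2 : ℤ) ^ (j a + 2) ≤ 2 ^ (e₀ + 2) := pow_le_pow_right₀ (by norm_num) (by omega)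
      calc _ = 2 ^ (j a + 2) * ((2 ^ l (a + 1)) ^ (j a + 2) * z ^ (e₀ - j a)) := by
            rw [pow_succ 2 (l (a + 1)), mul_pow]; ring
        _ ≤ _ := by gcongr
  have hVstep : ∀ a, a + 1 < (e₀ + 1) * (L + 1) → V a ≤ Rc * V (a + 1) := by
    intro a ha
    have h1 := (hfd a (by omega)).2
    have h2 := (hfd (a + 1) ha).1
    have h3 := hNstep a ha
    have h4 := hV0 (a + 1) ha
    have h5 : (C * 4 ^ (e₀ + 2) : ℤ) ≤ Rc := by rw [hRc, hCn]; push_cast; linarith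
    have h6 : (2 : ℤ) ^ e₀ * (2 ^ (e₀ + 2) * 2) ≤ 4 ^ (e₀ + 2) := by
      rw [show (4 : ℤ) = 2 * 2 by norm_num, mul_pow, pow_add]
      have : (0 : ℤ) < 2 ^ e₀ := by positivity
      nlinarith
    calc V a ≤ C * 2 ^ e₀ * (2 ^ (e₀ + 2) * (2 * V (a + 1))) := by
          refine h1.trans ?_
          gcongr
          exact h3.trans (by gcongr)
      _ = C * (2 ^ e₀ * (2 ^ (e₀ + 2) * 2)) * V (a + 1) := by ring
      _ ≤ C * 4 ^ (e₀ + 2) * V (a + 1) := by gcongr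
      _ ≤ _ := by gcongr
  have hblock : ∀ s : Finset ℕ, ∀ a, a < (e₀ + 1) * (L + 1) → (∀ γ ∈ s, γ < m) →
      Finset.Ico (a * Rc) ((a + 1) * Rc) ⊆ s → Rc * V a ≤ ∑ γ ∈ s, V (γ / Rc) := by
    intro s a ha hs hsub
    calc (Rc : ℤ) * V a = ∑ γ ∈ Finset.Ico (a * Rc) ((a + 1) * Rc), V a := by
          rw [Finset.sum_const, Nat.card_Ico, nsmul_eq_mul]
          congr 2
          rw [add_mul]; omega
      _ = ∑ γ ∈ Finset.Ico (a * Rc) ((a + 1) * Rc), V (γ / Rc) := by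
          refine Finset.sum_congr rfl fun γ hγ => ?_
          rw [Finset.mem_Ico] at hγ
          congr 1
          rw [eq_comm, Nat.div_eq_iff hRc0]
          rw [add_mul, one_mul] at hγ
          omega
      _ ≤ _ := Finset.sum_le_sum_of_subset_of_nonneg hsub fun γ hγ _ =>
          hV0 _ ((Nat.div_lt_iff_lt_mul hRc0).2 (hs γ hγ))
  -- the labels
  set ρ : ℕ → Bool → ℤ := fun i β =>
    x (i / q / Rc) + offsets (j (i / q / Rc) + 1) β (i % q) * 2 ^ l (i / q / Rc) with hρ
  have hρu : ∀ i β, ∃ u : ℕ, 1 ≤ u ∧ u ≤ j (i / q / Rc) + 3 ∧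
      ρ i β = z - u * 2 ^ l (i / q / Rc) := by
    intro i β
    have := offsets_le (j (i / q / Rc) + 1) β (i % q)
    refine ⟨j (i / q / Rc) + 3 - offsets (j (i / q / Rc) + 1) β (i % q), by omega, by omega, ?_⟩
    rw [Nat.cast_sub (by omega)]
    simp only [hρ, hx]
    push_cast; ring
  have hai : ∀ i < m * q, i / q / Rc < (e₀ + 1) * (L + 1) := fun i hi =>
    (Nat.div_lt_iff_lt_mul hRc0).2 ((Nat.div_lt_iff_lt_mul hq0).2 hi)
  refine ⟨q, m, U, ρ, fun γ => V (γ / Rc), hq0, ?_, ?_, ?_, ?_, ?_, ?_, ?_⟩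
  · intro γ hγ
    have ha : γ / Rc < (e₀ + 1) * (L + 1) := (Nat.div_lt_iff_lt_mul hRc0).2 hγ
    have h1 := sum_offsets (e₀ - j (γ / Rc)) (2 ^ l (γ / Rc)) (j (γ / Rc) + 1) P (x (γ / Rc))
    rw [show e₀ - j (γ / Rc) + (j (γ / Rc) + 1) = e₀ + 1 by have := hjle _ ha; omega] at h1
    simp only [hV]
    rw [← h1]
    refine Finset.sum_congr rfl fun s hs => ?_
    have hs := Finset.mem_range.1 hs
    have e1 : (γ * q + s) / q = γ := by
      rw [Nat.div_eq_iff hq0]; omega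
    have e2 : (γ * q + s) % q = s := by
      rw [Nat.add_comm, Nat.add_mul_mod_self_right, Nat.mod_eq_of_lt hs]
    simp only [hρ, e1, e2]
    push_cast; rfl
  · exact fun γ hγ => hV0 _ ((Nat.div_lt_iff_lt_mul hRc0).2 hγ)
  · intro γ hγ
    set a := γ / Rc with ha'
    have ha : a < (e₀ + 1) * (L + 1) := (Nat.div_lt_iff_lt_mul hRc0).2 hγ
    have hγa := Nat.div_add_mod γ Rc
    have hγr := Nat.mod_lt γ hRc0
    rw [← ha'] at hγa
    have hg1 := G.one_le_g
    by_cases hlast : a + 1 < (e₀ + 1) * (L + 1)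
    · have h1 := hblock (Finset.Ico (γ + 1) m) (a + 1) hlast
        (fun γ' h => (Finset.mem_Ico.1 h).2) (by
          refine Finset.Ico_subset_Ico ?_ ?_
          · rw [add_mul, one_mul, mul_comm a]; omega
          · exact Nat.mul_le_mul_right _ hlast)
      have h2 := hVstep a hlast
      linarith
    · have haL : a = (L + 1) * e₀ + L := by
        have : (e₀ + 1) * (L + 1) = (L + 1) * e₀ + L + 1 := by ring
        omega
      have h1 : j a = e₀ := by
        simp only [hj]
        rw [haL, Nat.mul_add_div (Nat.succ_pos L), Nat.div_eq_of_lt (Nat.lt_succ_self L), add_zero]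
      have h2 : l a = 0 := by
        simp only [hl]
        rw [haL, Nat.mul_add_mod, Nat.mod_eq_of_lt (Nat.lt_succ_self L), Nat.sub_self]
      have h3 : V a = g := by
        simp only [hV]
        rw [h1, h2]
        simpa using G.top (x a)
      show V a ≤ _
      rw [h3]
      have h4 : 0 ≤ ∑ γ' ∈ Finset.Ico (γ + 1) m, V (γ' / Rc) :=
        Finset.sum_nonneg fun γ' h =>
          hV0 _ ((Nat.div_lt_iff_lt_mul hRc0).2 (Finset.mem_Ico.1 h).2)
      linarith
  · have hG : 0 < (e₀ + 1) * (L + 1) := by positivity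
    have h1 := hblock (Finset.range m) 0 hG (fun γ h => Finset.mem_range.1 h) (by
      rw [Finset.range_eq_Ico]
      refine Finset.Ico_subset_Ico (by simp) ?_
      exact Nat.mul_le_mul_right _ (Nat.succ_le_of_lt hG))
    have h2 := (hfd 0 hG).1
    have h3 : z ^ (e₀ + 1) ≤ N 0 := by
      simp only [hN, hj, hl, Nat.zero_div, Nat.zero_mod, Nat.sub_zero, Nat.zero_add]
      calc z ^ (e₀ + 1) = z * z ^ e₀ := by ring
        _ ≤ 4 ^ L * z ^ e₀ := by gcongr
        _ = _ := by push_cast; rw [← pow_mul, mul_comm L, pow_mul]; norm_num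
    have h4 : (2 * B : ℤ) ≤ Rc := by
      rw [hRc]; push_cast
      have : (0 : ℤ) ≤ Cn * 4 ^ (e₀ + 2) := by positivity
      linarith
    rw [show e₀ + 2 - 1 = e₀ + 1 by omega]
    calc (B : ℤ) * z ^ (e₀ + 1) ≤ B * (2 * V 0) := by
          refine mul_le_mul_of_nonneg_left (h3.trans h2) (by positivity)
      _ = 2 * B * V 0 := by ring
      _ ≤ Rc * V 0 := mul_le_mul_of_nonneg_right h4 (hV0 0 hG)
      _ ≤ _ := h1
  · intro i hi β
    obtain ⟨u, hu1, hu2, hu⟩ := hρu i β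
    have hje := hjle _ (hai i hi)
    have h1 : u * 2 ^ l (i / q / Rc) ≤ U := Nat.mul_le_mul (by omega) (hlL _)
    zify at h1
    rw [hu]
    have : (0 : ℤ) ≤ u * 2 ^ l (i / q / Rc) := by positivity
    constructor <;> linarith
  · -- the order, the copy, the position in the gadget, the state and the multiple `u` of the step
    -- determine the step, as `ℓ = z - u * 2 ^ l`, and so the place where the label `ℓ` occurs
    intro ℓ
    choose u hu1 hu2 hu using hρu
    have hcard : (Finset.range (e₀ + 1) ×ˢ Finset.range Rc ×ˢ Finset.range q ×ˢ
        (Finset.univ : Finset Bool) ×ˢ Finset.range (e₀ + 4)).card =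
        (e₀ + 1) * (Rc * (q * (2 * (e₀ + 4)))) := by simp
    rw [← hcard]
    refine Finset.card_le_card_of_injOn (fun s => (j (s.1 / q / Rc), s.1 / q % Rc, s.1 % q, s.2,
      u s.1 s.2)) ?_ ?_
    · rintro ⟨i, β⟩ hs
      have hs := (Finset.mem_product.1 (Finset.mem_filter.1 (Finset.mem_coe.1 hs)).1).1
      have hi := Finset.mem_range.1 hs
      have h1 := hjle _ (hai i hi)
      have h2 := hu2 i β
      simp only [Finset.coe_product, Set.mem_prod, Finset.mem_coe, Finset.mem_range,
        Finset.mem_univ, true_and]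
      exact ⟨by omega, Nat.mod_lt _ hRc0, Nat.mod_lt _ hq0, by omega⟩
    · rintro ⟨i, β⟩ hs ⟨i', β'⟩ hs' h
      have hs := (Finset.mem_filter.1 (Finset.mem_coe.1 hs)).2
      have hs' := (Finset.mem_filter.1 (Finset.mem_coe.1 hs')).2
      simp only [Prod.mk.injEq] at h
      obtain ⟨h1, h2, h3, rfl, h5⟩ := h
      have h6 : (u i β : ℤ) * 2 ^ l (i / q / Rc) = u i β * 2 ^ l (i' / q / Rc) := by
        have e1 := hu i β
        have e2 := hu i' β
        simp only at hs hs'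
        rw [← h5] at e2
        linarith
      have h7 : l (i / q / Rc) = l (i' / q / Rc) := by
        have hu0 : (u i β : ℤ) ≠ 0 := by have := hu1 i β; omega
        have := mul_left_cancel₀ hu0 h6
        have : (2 : ℕ) ^ l (i / q / Rc) = 2 ^ l (i' / q / Rc) := by exact_mod_cast this
        exact Nat.pow_right_injective le_rfl this
      have h8 : i / q / Rc = i' / q / Rc := by
        have a1 := Nat.div_add_mod (i / q / Rc) (L + 1)
        have a2 := Nat.div_add_mod (i' / q / Rc) (L + 1)
        have a3 := Nat.mod_lt (i / q / Rc) (show 0 < L + 1 by omega)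
        have a4 := Nat.mod_lt (i' / q / Rc) (show 0 < L + 1 by omega)
        simp only [hj] at h1
        simp only [hl] at h7
        rw [h1] at a1
        omega
      have h9 : i / q = i' / q := by
        have a1 := Nat.div_add_mod (i / q) Rc
        have a2 := Nat.div_add_mod (i' / q) Rc
        rw [h8, h2] at a1
        omega
      have h10 : i = i' := by
        have a1 := Nat.div_add_mod i q
        have a2 := Nat.div_add_mod i' q
        rw [h9, h3] at a1
        omega
      rw [h10]
  · refine le_trans ?_ hsize
    have : K * ((m * q + 1) * (m * q + 1 + U)) ≤ (K + 2) * ((m * q + 1) * (m * q + 1 + U)) :=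
      Nat.mul_le_mul_right _ (by omega)
    exact_mod_cast this

/-! ### Labels with a single color switch -/

/-- Discrete intermediate value theorem. -/
theorem exists_le_lt_succ {P : ℤ → ℤ} {l u T : ℤ} (hlu : l ≤ u) (hl : P l ≤ T) (hu : T < P u) :
    ∃ r, l ≤ r ∧ r < u ∧ P r ≤ T ∧ T < P (r + 1) := by
  obtain ⟨r, ⟨h1, h2, h3⟩, h4⟩ := Int.exists_greatest_of_bdd
    (P := fun r => l ≤ r ∧ r < u ∧ P r ≤ T) ⟨u, fun z hz => hz.2.1.le⟩
    ⟨l, le_rfl, lt_of_le_of_ne hlu (by rintro rfl; linarith), hl⟩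
  refine ⟨r, h1, h2, h3, ?_⟩
  by_contra! h
  by_cases hr : r + 1 < u
  · have := h4 (r + 1) ⟨by linarith, hr, h⟩
    linarith
  · have : r + 1 = u := by linarith [Int.add_one_le_of_lt h2]
    rw [this] at h
    linarith

/-- A sum over consecutive gadgets of length `q`, where `t` gives their states, up to the `s`-th
move of the `a`-th gadget. -/
theorem sum_range_blocks {q m : ℕ} (hq : 0 < q) {f : ℕ → Bool → ℤ} {v : ℕ → ℤ}
    (hv : ∀ γ < m, v γ = ∑ s ∈ Finset.range q, (f (γ * q + s) true - f (γ * q + s) false))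
    (t : ℕ → Bool) {a s : ℕ} (ha : a ≤ m) (hs : s < q) :
    ∑ i ∈ Finset.range (a * q + s), (f i (t (i / q)) - f i false) =
      ∑ γ ∈ Finset.range a, (if t γ then v γ else 0) +
        ∑ s' ∈ Finset.range s, (f (a * q + s') (t a) - f (a * q + s') false) := by
  have hdiv : ∀ a s, s < q → (a * q + s) / q = a := fun a s hs => by
    rw [Nat.div_eq_iff hq]; omega
  rw [Finset.sum_range_add]
  congr 1
  · clear hs
    induction a with
    | zero => simp
    | succ a ih =>
      rw [add_mul, one_mul, Finset.sum_range_add, ih (by omega), Finset.sum_range_succ]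
      congr 1
      have : ∀ s ∈ Finset.range q, f (a * q + s) (t ((a * q + s) / q)) - f (a * q + s) false =
          f (a * q + s) (t a) - f (a * q + s) false := fun s hs => by
        rw [hdiv a s (Finset.mem_range.1 hs)]
      rw [Finset.sum_congr rfl this]
      cases h : t a
      · simp
      · simp [hv a (by omega)]
  · refine Finset.sum_congr rfl fun s' hs' => ?_
    rw [hdiv a s' ((Finset.mem_range.1 hs').trans hs)]

theorem moved_antitone {P : ℤ → ℤ} {b r : ℕ → ℤ} (h : ∀ i, P (r i) ≤ P (b i)) (y₀ : ℤ) :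
    Antitone (moved P b r y₀) := by
  refine antitone_nat_of_succ_le fun i => ?_
  rw [moved_succ]
  linarith [h i]

theorem Growth.le_self {P : ℤ → ℤ} {d : ℕ} {C g z₀ : ℤ} (G : Growth P d C g z₀) (hd : 2 ≤ d)
    {x : ℤ} (hx : z₀ ≤ x) (hx2 : 2 ≤ x) : x ≤ P x := by
  have h1 := G.pow_le hx
  have h2 : x ^ 2 ≤ x ^ d := pow_le_pow_right₀ (by linarith) hd
  nlinarith

/-- For a label `w` with `z / 4 ≤ w ≤ z / 2`, one more move and a choice of states of the gadgets
take the number `P w` to the interval `(z - g, z]`. -/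
theorem Growth.exists_last_move {P : ℤ → ℤ} {d : ℕ} {C g z₀ : ℤ} (G : Growth P d C g z₀)
    (hd : 2 ≤ d) {m : ℕ} {v : ℕ → ℤ} (hv0 : ∀ γ < m, 0 ≤ v γ)
    (hv : ∀ γ < m, v γ ≤ g + ∑ γ' ∈ Finset.Ico (γ + 1) m, v γ') {z w D : ℤ}
    (hvz : C * z ^ (d - 1) ≤ ∑ γ ∈ Finset.range m, v γ) (hzC : 8 * C * z₀ ≤ z)
    (hz4 : 8 * 4 ^ d ≤ z) (hD : P z ≤ D) (hDz : 8 * 4 ^ d * (D - P z) ≤ z ^ d)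
    (hw : z ≤ 4 * w) (hwz : 2 * w ≤ z) :
    ∃ (r : ℤ) (t : ℕ → Bool), z ≤ 8 * C * r ∧ r < z ∧
      (∀ a ≤ m, 0 ≤ ∑ γ ∈ Finset.range a, (if t γ then v γ else 0) ∧
        ∑ γ ∈ Finset.range a, (if t γ then v γ else 0) ≤ C * z ^ (d - 1)) ∧
      P w - D + P r + ∑ γ ∈ Finset.range m, (if t γ then v γ else 0) ≤ z ∧
      z - g < P w - D + P r + ∑ γ ∈ Finset.range m, (if t γ then v γ else 0) := by
  have hC := G.one_le_C
  have hz₀ := G.one_le_z₀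
  have hg := G.one_le_g
  have hCz : z₀ ≤ C * z₀ := le_mul_of_one_le_left (by linarith) hC
  have hCz' : C ≤ C * z₀ := le_mul_of_one_le_right (by linarith) hz₀
  have hzpos : 0 < z := by linarith
  have hwz₀ : z₀ ≤ w := by linarith
  have h4 : (0 : ℤ) < 4 ^ d := by positivity
  have hzd : z * z ^ (d - 1) = z ^ d := by rw [← pow_succ']; congr 1; omega
  have h4d : (4 : ℤ) * 4 ^ (d - 1) = 4 ^ d := by rw [← pow_succ']; congr 1; omega
  have hzd1 : z ≤ z ^ (d - 1) := by
    calc z = z ^ 1 := (pow_one z).symm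
      _ ≤ z ^ (d - 1) := pow_le_pow_right₀ (by linarith) (by omega)
  -- the required value of `P r`, up to the contribution of the gadgets
  set T := z - P w + D with hT
  -- a lower end `l` for the search of `r`, with `P l ≤ T`
  obtain ⟨l, hl1, hl2, hlz⟩ : ∃ l, z ≤ 8 * C * l ∧ 4 * C * l ≤ z ∧ l ≤ z := by
    have h1 := Int.emod_add_mul_ediv z (8 * C)
    have h2 := Int.emod_nonneg z (by linarith : 8 * C ≠ 0)
    have h3 := Int.emod_lt_of_pos z (by linarith : 0 < 8 * C)
    have h5 : 4 * C * (z / (8 * C) + 1) ≤ z := by linarith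
    refine ⟨z / (8 * C) + 1, by linarith, h5, ?_⟩
    have h6 : 0 ≤ z / (8 * C) + 1 := by
      have := Int.ediv_nonneg hzpos.le (by linarith : 0 ≤ 8 * C)
      linarith
    have h7 := le_mul_of_one_le_left h6 (by linarith : 1 ≤ 4 * C)
    linarith
  have hlz₀ : z₀ ≤ l := by
    have : 8 * C * z₀ ≤ 8 * C * l := hzC.trans hl1
    exact le_of_mul_le_mul_left this (by linarith)
  have hPl : 4 ^ d * P l ≤ z ^ d := by
    have h1 := G.le_pow hlz₀
    have h2 : C ≤ C ^ d := by
      calc C = C ^ 1 := (pow_one C).symm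
        _ ≤ C ^ d := pow_le_pow_right₀ hC (by omega)
    have hl0 : 0 ≤ l := by linarith
    calc 4 ^ d * P l ≤ 4 ^ d * (C ^ d * l ^ d) := by
          refine mul_le_mul_of_nonneg_left (h1.trans ?_) h4.le
          gcongr
      _ = (4 * C * l) ^ d := by rw [mul_pow, mul_pow]; ring
      _ ≤ z ^ d := by gcongr
  have hPw1 : z ^ d ≤ 4 ^ d * (P z - P w) := by
    have h1 := G.le_sub (by omega) hwz₀ (by linarith : w ≤ z)
    have h2 : z ^ (d - 1) ≤ 4 ^ (d - 1) * w ^ (d - 1) := by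
      rw [← mul_pow]; gcongr
    have hw0 : 0 ≤ w := by linarith
    calc z ^ d = z * z ^ (d - 1) := hzd.symm
      _ ≤ (2 * (z - w)) * (4 ^ (d - 1) * w ^ (d - 1)) :=
          mul_le_mul (by linarith) h2 (by positivity) (by linarith)
      _ = 2 * 4 ^ (d - 1) * ((z - w) * w ^ (d - 1)) := by ring
      _ ≤ 2 * 4 ^ (d - 1) * (2 * (P z - P w)) := by gcongr
      _ = _ := by rw [← h4d]; ring
  have hPw2 : z ^ d ≤ 2 * 4 ^ d * P w := by
    have h1 := G.pow_le hwz₀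
    calc z ^ d ≤ (4 * w) ^ d := by gcongr
      _ = 4 ^ d * w ^ d := mul_pow _ _ _
      _ ≤ 4 ^ d * (2 * P w) := by gcongr
      _ = _ := by ring
  have hlT : P l ≤ T := by
    have : P l ≤ P z - P w := le_of_mul_le_mul_left (hPl.trans hPw1) h4
    linarith
  have hTz : T < P z := by
    have h1 : 8 * 4 ^ d * z ≤ z ^ d := by
      rw [← hzd]
      calc 8 * 4 ^ d * z ≤ z * z := by gcongr
        _ ≤ z * z ^ (d - 1) := by gcongr
    have h2 : 0 < z ^ d := by positivity
    have h3 : 8 * 4 ^ d * T < 8 * 4 ^ d * P z := by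
      have : 8 * 4 ^ d * T = 8 * 4 ^ d * z + 8 * 4 ^ d * (D - P z) - 4 * (2 * 4 ^ d * P w) +
        8 * 4 ^ d * P z := by rw [hT]; ring
      linarith
    exact lt_of_mul_lt_mul_left h3 (by positivity)
  obtain ⟨r, hlr, hrz, hr1, hr2⟩ := exists_le_lt_succ hlz hlT hTz
  have hτ : T - P r < C * z ^ (d - 1) := by
    have h1 := G.sub_le (by omega) (hlz₀.trans hlr) (by linarith : r ≤ r + 1)
    have h2 : (r + 1) ^ (d - 1) ≤ z ^ (d - 1) := by
      have : 0 ≤ r + 1 := by linarith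
      gcongr
      linarith
    have h3 := mul_le_mul_of_nonneg_left h2 (by linarith : 0 ≤ C)
    rw [add_sub_cancel_left, one_mul] at h1
    linarith
  obtain ⟨t, ht1, ht2⟩ := exists_bits m v hv0 hv (T - P r) (by linarith) (by linarith)
  have hnn : ∀ γ < m, 0 ≤ (if t γ then v γ else 0) := fun γ hγ => by
    split_ifs
    · exact hv0 γ hγ
    · exact le_rfl
  refine ⟨r, t, ?_, hrz, fun a ha => ⟨?_, ?_⟩, by linarith, by linarith⟩
  · have : 8 * C * l ≤ 8 * C * r := mul_le_mul_of_nonneg_left hlr (by linarith)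
    linarith
  · exact Finset.sum_nonneg fun γ hγ => hnn γ ((Finset.mem_range.1 hγ).trans_le ha)
  · have : ∑ γ ∈ Finset.range a, (if t γ then v γ else 0) ≤
        ∑ γ ∈ Finset.range m, (if t γ then v γ else 0) :=
      Finset.sum_le_sum_of_subset_of_nonneg (Finset.range_subset_range.2 ha)
        fun γ hγ _ => hnn γ (Finset.mem_range.1 hγ)
    linarith

set_option maxHeartbeats 1000000 in
/-- If the color switches between `z` and `z + 1` only, then there are at least `c z²` bad edges:
for each of about `z` labels `w` there is a chain of moves that takes `P w` to `N ∈ (z - g, z]`.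
All moves are downward, and each consists of an edge with label above `z` and one with label at most
`z`. Hence, for about `z` values of `x`, the chain of edges from `x` through `P w - x` to `N - x`
contains a bad edge, because both `x` and `N - x` have the color of the labels below `z`. -/
theorem Growth.one_sided {P : ℤ → ℤ} {d : ℕ} {C g z₀ : ℤ} (G : Growth P d C g z₀) (hd : 2 ≤ d) :
    ∃ (c z₁ : ℤ), ∀ (n z : ℤ) (χ : ℤ → Bool) (R : Bool), z₁ ≤ z →
      (∀ x, z ≤ 8 * C * x → x ≤ z → χ x = R) → (∀ x, z < x → x ≤ 2 * z → χ x = !R) →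
      P (2 * z) ≤ n → z ^ 2 ≤ c * (badPairs P n χ).card := by
  have hC := G.one_le_C
  have hz₀ := G.one_le_z₀
  have hg := G.one_le_g
  obtain ⟨Cn, hCn⟩ := Int.eq_ofNat_of_zero_le (zero_le_one.trans hC)
  obtain ⟨M, z₁, hgad⟩ := G.exists_gadgets hd Cn (8 * 4 ^ d * (Cn * 2 ^ d) + 2)
  set F : ℤ := 2 * 4 ^ (d - 1) * (C + 2) with hF
  have hF1 : 1 ≤ F := by
    have : (1 : ℤ) ≤ 4 ^ (d - 1) := one_le_pow₀ (by norm_num)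
    rw [hF]
    have := mul_le_mul this (by linarith : (1 : ℤ) ≤ C + 2) (by norm_num) (by positivity)
    linarith
  refine ⟨64 * F * (M + 6), max z₁ (max (8 * C * z₀) (max (8 * 4 ^ d) (4 * g))), ?_⟩
  intro n z χ R hz hred hblue hn
  simp only [max_le_iff] at hz
  obtain ⟨hz1, hzC, hz4, hzg⟩ := hz
  have hCz : z₀ ≤ C * z₀ := le_mul_of_one_le_left (by linarith) hC
  have hzz₀ : z₀ ≤ z := by linarith
  obtain ⟨q, m, U, ρ, v, hq, hvs, hv0, hv, hvz, hρ, hmult, hsize⟩ := hgad z hz1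
  rw [← hCn] at hvz
  have hz2 : 2 ≤ z := by
    have : (0 : ℤ) < 4 ^ d := by positivity
    linarith
  have hzpos : 0 < z := by linarith
  have hsz : 2 * ((m * q : ℕ) + 1 + (U : ℤ)) ≤ z := by
    refine le_trans ?_ hsize
    have : 2 * (m * q + 1 + U) ≤
        (8 * 4 ^ d * (Cn * 2 ^ d) + 2) * ((m * q + 1) * (m * q + 1 + U)) := by
      calc 2 * (m * q + 1 + U) = 2 * (1 * (m * q + 1 + U)) := by ring
        _ ≤ _ := by gcongr <;> omega
    exact_mod_cast this
  -- the labels above `z` are distinct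
  set b : ℕ → ℤ := fun i => z + 1 + i with hb
  have hbz : ∀ i, z < b i := fun i => by simp only [hb]; linarith [Int.natCast_nonneg i]
  have hb2 : ∀ i ≤ m * q, b i ≤ 2 * z := fun i hi => by
    simp only [hb]
    have : (i : ℤ) ≤ (m * q : ℕ) := by exact_mod_cast hi
    linarith
  -- the displacement of all moves if each gadget is in its state `false`, without the last label
  set D : ℤ := ∑ i ∈ Finset.range (m * q), (P (b i) - P (ρ i false)) + P (b (m * q)) with hD
  have hρz : ∀ i < m * q, ∀ β, z₀ ≤ ρ i β ∧ ρ i β ≤ z ∧ z ≤ 2 * ρ i β := by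
    intro i hi β
    have h1 := hρ i hi β
    have h2 : 0 ≤ C * z₀ := by positivity
    refine ⟨by linarith, h1.1, by linarith⟩
  have hPρ : ∀ i < m * q, ∀ β, P (ρ i β) ≤ P (b i) := fun i hi β =>
    G.mono (by omega) (hρz i hi β).1 ((hρz i hi β).2.1.trans (hbz i).le)
  have hDz : P z ≤ D := by
    have h1 : 0 ≤ ∑ i ∈ Finset.range (m * q), (P (b i) - P (ρ i false)) :=
      Finset.sum_nonneg fun i hi => sub_nonneg.2 (hPρ i (Finset.mem_range.1 hi) false)
    have h2 := G.mono (by omega) hzz₀ (hbz (m * q)).le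
    linarith
  have hzd : z * z ^ (d - 1) = z ^ d := by rw [← pow_succ']; congr 1; omega
  have hDz' : 8 * 4 ^ d * (D - P z) ≤ z ^ d := by
    have key : ∀ x i, i ≤ m * q → z₀ ≤ x → z - U ≤ x → x ≤ z →
        P (b i) - P x ≤ C * (((m * q : ℕ) + 1 + (U : ℤ)) * (2 ^ d * z ^ (d - 1))) := by
      intro x i hi hx1 hx2 hx3
      have h1 := G.sub_le (by omega) hx1 (hx3.trans (hbz i).le)
      refine h1.trans (mul_le_mul_of_nonneg_left ?_ (by linarith))
      have h2 : (i : ℤ) ≤ (m * q : ℕ) := by exact_mod_cast hi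
      have h3 : b i ^ (d - 1) ≤ 2 ^ d * z ^ (d - 1) := by
        calc b i ^ (d - 1) ≤ (2 * z) ^ (d - 1) :=
              pow_le_pow_left₀ (hzpos.le.trans (hbz i).le) (hb2 i hi) _
          _ = 2 ^ (d - 1) * z ^ (d - 1) := mul_pow _ _ _
          _ ≤ _ := by
            have : (2 : ℤ) ^ (d - 1) ≤ 2 ^ d := pow_le_pow_right₀ (by norm_num) (by omega)
            gcongr
      refine mul_le_mul ?_ h3 (pow_nonneg (hzpos.le.trans (hbz i).le) _) (by positivity)
      simp only [hb]; linarith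
    have h1 : D - P z ≤ ((m * q : ℕ) + 1) *
        (C * (((m * q : ℕ) + 1 + (U : ℤ)) * (2 ^ d * z ^ (d - 1)))) := by
      have h2 : ∑ i ∈ Finset.range (m * q), (P (b i) - P (ρ i false)) ≤ (m * q : ℕ) •
          (C * (((m * q : ℕ) + 1 + (U : ℤ)) * (2 ^ d * z ^ (d - 1)))) := by
        have := Finset.sum_le_card_nsmul (Finset.range (m * q))
          (fun i => P (b i) - P (ρ i false)) _ fun i hi => by
            have hi := Finset.mem_range.1 hi
            exact key (ρ i false) i hi.le (hρz i hi false).1 (hρ i hi false).2 (hρ i hi false).1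
        rwa [Finset.card_range] at this
      have h3 := key z (m * q) le_rfl hzz₀ (by linarith [Int.natCast_nonneg U]) le_rfl
      rw [nsmul_eq_mul] at h2
      rw [hD, add_mul, one_mul]
      linarith
    have h4 : 8 * 4 ^ d * (C * 2 ^ d) * (((m * q : ℕ) + 1) * ((m * q : ℕ) + 1 + (U : ℤ))) ≤ z := by
      refine le_trans ?_ hsize
      rw [hCn]
      push_cast
      refine mul_le_mul_of_nonneg_right (by linarith) (by positivity)
    calc 8 * 4 ^ d * (D - P z) ≤ 8 * 4 ^ d * (((m * q : ℕ) + 1) *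
        (C * (((m * q : ℕ) + 1 + (U : ℤ)) * (2 ^ d * z ^ (d - 1))))) := by gcongr
      _ = 8 * 4 ^ d * (C * 2 ^ d) * (((m * q : ℕ) + 1) * ((m * q : ℕ) + 1 + (U : ℤ))) *
          z ^ (d - 1) := by ring
      _ ≤ z * z ^ (d - 1) := by gcongr
      _ = z ^ d := hzd
  -- the labels `w k` are spaced by `F`, so that their values differ by more than the gadgets move
  set w : ℤ → ℤ := fun k => z / 4 + 1 + F * k with hw
  set K : Finset ℤ := Finset.Icc 0 (z / (8 * F)) with hK
  set X : Finset ℤ := Finset.Icc (z / 4 + 1) (z / 2) with hX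
  have hwk : ∀ k ∈ K, z ≤ 4 * w k ∧ 2 * w k ≤ z := by
    intro k hk
    obtain ⟨hk1, hk2⟩ := Finset.mem_Icc.1 hk
    have h1 : F * k ≤ F * (z / (8 * F)) := mul_le_mul_of_nonneg_left hk2 (by linarith)
    have h2 : 8 * (F * (z / (8 * F))) ≤ z := by
      rw [← mul_assoc]; exact Int.mul_ediv_self_le (by linarith)
    have h3 : 0 ≤ F * k := mul_nonneg (by linarith) hk1
    have h4 : (64 : ℤ) ≤ z := by
      have : (4 : ℤ) ^ 2 ≤ 4 ^ d := pow_le_pow_right₀ (by norm_num) hd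
      linarith
    simp only [hw]
    constructor <;> omega
  have hex : ∀ k, ∃ (r : ℤ) (t : ℕ → Bool), k ∈ K → z ≤ 8 * C * r ∧ r < z ∧
      (∀ a ≤ m, 0 ≤ ∑ γ ∈ Finset.range a, (if t γ then v γ else 0) ∧
        ∑ γ ∈ Finset.range a, (if t γ then v γ else 0) ≤ C * z ^ (d - 1)) ∧
      P (w k) - D + P r + ∑ γ ∈ Finset.range m, (if t γ then v γ else 0) ≤ z ∧
      z - g < P (w k) - D + P r + ∑ γ ∈ Finset.range m, (if t γ then v γ else 0) := by
    intro k
    by_cases hk : k ∈ K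
    · obtain ⟨r, t, h⟩ := G.exists_last_move hd hv0 hv hvz hzC hz4 hDz hDz' (hwk k hk).1
        (hwk k hk).2
      exact ⟨r, t, fun _ => h⟩
    · exact ⟨0, fun _ => false, fun h => absurd h hk⟩
  choose r' t ht using hex
  set r : ℤ → ℕ → ℤ := fun k i => if i < m * q then ρ i (t k (i / q)) else r' k with hr
  set A : ℤ → ℕ → ℤ := fun k a => ∑ γ ∈ Finset.range a, (if t k γ then v γ else 0) with hA
  have hrr : ∀ k ∈ K, ∀ i, z₀ ≤ r k i ∧ r k i ≤ z ∧ z ≤ 8 * C * r k i := by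
    intro k hk i
    simp only [hr]
    split_ifs with hi
    · obtain ⟨h1, h2, h3⟩ := hρz i hi (t k (i / q))
      have : 2 * ρ i (t k (i / q)) ≤ 8 * C * ρ i (t k (i / q)) :=
        mul_le_mul_of_nonneg_right (by linarith) (by linarith)
      exact ⟨h1, h2, by linarith⟩
    · obtain ⟨h1, h2, _⟩ := ht k hk
      refine ⟨?_, h2.le, h1⟩
      exact le_of_mul_le_mul_left (hzC.trans h1) (by linarith : 0 < 8 * C)
  have hPr : ∀ k ∈ K, ∀ i, P (r k i) ≤ P (b i) := fun k hk i =>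
    G.mono (by omega) (hrr k hk i).1 ((hrr k hk i).2.1.trans (hbz i).le)
  have hmoved : ∀ k ∈ K, ∀ x, ∀ a ≤ m, ∀ s < q, a * q + s ≤ m * q →
      moved P b (r k) (P (w k) - x) (a * q + s) = P (w k) - x + A k a -
        ∑ i ∈ Finset.range (a * q + s), (P (b i) - P (ρ i false)) +
        ∑ s' ∈ Finset.range s, (P (ρ (a * q + s') (t k a)) - P (ρ (a * q + s') false)) := by
    intro k hk x a ha s hs has
    have h1 := sum_range_blocks (f := fun i β => P (ρ i β)) hq hvs (t k) ha hs
    simp only [hA, moved]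
    have h2 : ∑ i ∈ Finset.range (a * q + s), (P (b i) - P (r k i)) =
        ∑ i ∈ Finset.range (a * q + s), (P (b i) - P (ρ i false)) -
        ∑ i ∈ Finset.range (a * q + s), (P (ρ i (t k (i / q))) - P (ρ i false)) := by
      rw [← Finset.sum_sub_distrib]
      refine Finset.sum_congr rfl fun i hi => ?_
      have : i < m * q := (Finset.mem_range.1 hi).trans_le has
      simp only [hr, this, if_true]
      ring
    rw [h2, h1]
    ring
  have hend : ∀ k ∈ K, ∀ x, moved P b (r k) (P (w k) - x) (m * q + 1) =
      P (w k) - D + P (r' k) + A k m - x := by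
    intro k hk x
    have h1 := hmoved k hk x m le_rfl 0 hq (by simp)
    rw [moved_succ, ← add_zero (m * q), h1]
    simp only [add_zero, Finset.range_zero, Finset.sum_empty, hD]
    have : r k (m * q) = r' k := by simp [hr]
    rw [this]
    ring
  have hXx : ∀ x ∈ X, z < 4 * x ∧ 2 * x ≤ z := by
    intro x hx
    have := Finset.mem_Icc.1 hx
    omega
  have hendr : ∀ k ∈ K, ∀ x ∈ X, z ≤ 4 * moved P b (r k) (P (w k) - x) (m * q + 1) ∧
      moved P b (r k) (P (w k) - x) (m * q + 1) ≤ z := by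
    intro k hk x hx
    obtain ⟨_, _, _, h1, h2⟩ := ht k hk
    have h3 := hXx x hx
    rw [hend k hk x]
    simp only [hA]
    constructor <;> linarith
  have h4C : ∀ x, z ≤ 4 * x → z ≤ 8 * C * x := by
    intro x hx
    have : 4 * x ≤ 8 * C * x := mul_le_mul_of_nonneg_right (by linarith) (by linarith)
    linarith
  have hPz : P z ≤ n := (G.mono (by omega) hzz₀ (by linarith)).trans hn
  have h2zn : 2 * z ≤ n := (G.le_self hd (by linarith) (by linarith)).trans hn
  have hmn : ∀ k ∈ K, ∀ x ∈ X, ∀ i ≤ m * q + 1, 1 ≤ moved P b (r k) (P (w k) - x) i ∧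
      moved P b (r k) (P (w k) - x) i ≤ P (w k) - x := by
    intro k hk x hx i hi
    have hanti := moved_antitone (hPr k hk) (P (w k) - x)
    have h1 := hanti hi
    have h2 := hanti (Nat.zero_le i)
    have h3 := hendr k hk x hx
    simp only [moved, Finset.range_zero, Finset.sum_empty, sub_zero] at h2
    simp only [moved] at h1 h3 ⊢
    constructor
    · linarith
    · exact h2
  have hwz₀ : ∀ k ∈ K, z₀ ≤ w k := fun k hk => by
    have := (hwk k hk).1
    have : 0 ≤ C * z₀ := by positivity
    linarith
  have hPw : ∀ k ∈ K, P (w k) ≤ P z := fun k hk =>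
    G.mono (by omega) (hwz₀ k hk) (by linarith [(hwk k hk).2])
  have hbn : ∀ i, P z ≤ P (b i) := fun i => G.mono (by omega) hzz₀ (hbz i).le
  have hbn' : ∀ i ≤ m * q, P (b i) ≤ n := fun i hi =>
    (G.mono (by omega) (hzz₀.trans (hbz i).le) (hb2 i hi)).trans hn
  -- the numbers on the chains for `k < k'` are separated
  have hsep : ∀ i ≤ m * q, ∀ k ∈ K, ∀ k' ∈ K, ∀ x ∈ X, ∀ x' ∈ X, k < k' →
      (i < m * q → t k (i / q) = t k' (i / q)) →
      moved P b (r k) (P (w k) - x) i ≠ moved P b (r k') (P (w k') - x') i := by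
    intro i hi k hk k' hk' x hx x' hx' hkk htt heq
    have hdm : i / q * q + i % q = i := Nat.div_add_mod' i q
    have hmod := Nat.mod_lt i hq
    have ha : i / q ≤ m := Nat.div_le_of_le_mul (by rw [mul_comm]; exact hi)
    have h1 := hmoved k hk x (i / q) ha (i % q) hmod (by rw [hdm]; exact hi)
    have h2 := hmoved k' hk' x' (i / q) ha (i % q) hmod (by rw [hdm]; exact hi)
    have h3 : ∑ s' ∈ Finset.range (i % q), (P (ρ (i / q * q + s') (t k (i / q))) -
        P (ρ (i / q * q + s') false)) = ∑ s' ∈ Finset.range (i % q),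
        (P (ρ (i / q * q + s') (t k' (i / q))) - P (ρ (i / q * q + s') false)) := by
      rcases hi.lt_or_eq with hlt | rfl
      · rw [htt hlt]
      · rw [Nat.mul_mod_left]; simp
    rw [hdm] at h1 h2
    rw [h1, h2, h3] at heq
    have h4 := (ht k hk).2.2.1 (i / q) ha
    have h5 := (ht k' hk').2.2.1 (i / q) ha
    have h6 := hXx x hx
    have h7 := hXx x' hx'
    have h8 := G.le_sub (by omega) (hwz₀ k hk) (y := w k') (by
      simp only [hw]
      have := mul_le_mul_of_nonneg_left hkk.le (by linarith : 0 ≤ F)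
      linarith)
    have h9 : F ≤ w k' - w k := by
      have : F * 1 ≤ F * (k' - k) := mul_le_mul_of_nonneg_left (by linarith) (by linarith)
      simp only [hw]
      linarith
    have hwpos : 0 ≤ w k := by linarith [hwz₀ k hk]
    have h10 : z ^ (d - 1) ≤ 4 ^ (d - 1) * w k ^ (d - 1) := by
      rw [← mul_pow]
      exact pow_le_pow_left₀ hzpos.le (hwk k hk).1 _
    have h11 : (C + 2) * z ^ (d - 1) ≤ P (w k') - P (w k) := by
      have : 2 * ((C + 2) * z ^ (d - 1)) ≤ 2 * (P (w k') - P (w k)) := by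
        calc 2 * ((C + 2) * z ^ (d - 1)) ≤ 2 * ((C + 2) * (4 ^ (d - 1) * w k ^ (d - 1))) := by
              gcongr
          _ = F * w k ^ (d - 1) := by rw [hF]; ring
          _ ≤ (w k' - w k) * w k ^ (d - 1) := by gcongr
          _ ≤ _ := h8
      linarith
    have h12 : z ≤ z ^ (d - 1) := by
      calc z = z ^ 1 := (pow_one z).symm
        _ ≤ z ^ (d - 1) := pow_le_pow_right₀ (by linarith) (by omega)
    simp only [hA] at heq
    linarith
  have hcount := card_chains_le (P := P) (n := n) (χ := χ) (R := R) (K := K) (X := X) (w := w)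
    (b := b) (r := r) (ρ := ρ) (t := fun k i => t k (i / q)) (m := m * q) (M := M)
    (fun k hk => hred _ (h4C _ (hwk k hk).1) (by linarith [(hwk k hk).1, (hwk k hk).2]))
    (fun k hk => by have := hwk k hk; constructor <;> linarith)
    (fun k _ k' _ h => by
      simp only [hw] at h
      exact mul_left_cancel₀ (by linarith : F ≠ 0) (by linarith : F * k = F * k'))
    (fun x hx => hred _ (h4C _ (hXx x hx).1.le) (by linarith [(hXx x hx).1, (hXx x hx).2]))
    (fun x hx => by have := hXx x hx; constructor <;> linarith)
    (fun i hi => hblue _ (hbz i) (hb2 i hi))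
    (fun i hi => ⟨by linarith [hbz i], (hb2 i hi).trans h2zn⟩)
    (fun i _ i' _ h => by simp only [hb] at h; omega)
    (fun k hk i _ => hred _ (hrr k hk i).2.2 (hrr k hk i).2.1)
    (fun k hk i _ => by have := hrr k hk i; constructor <;> linarith)
    (fun k _ i hi => by simp only [hr, hi, if_true])
    hmult
    (fun k hk x hx i hi => by
      have h1 := hmn k hk x hx i hi
      have h2 := hPw k hk
      have h3 := hXx x hx
      exact ⟨h1.1, by linarith⟩)
    (fun k hk x hx i hi => by
      have h1 := hmn k hk x hx i (by omega)
      have h2 := hPw k hk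
      have h3 := hXx x hx
      have h4 := hbn i
      have h5 := hbn' i hi
      constructor <;> linarith)
    (fun k hk x hx => hred _ (h4C _ (hendr k hk x hx).1) (hendr k hk x hx).2)
    (fun i hi k hk k' hk' x hx x' hx' htt heq => by
      rcases lt_trichotomy k k' with h | rfl | h
      · exact absurd heq (hsep i hi k hk k' hk' x hx x' hx' h htt)
      · refine ⟨rfl, ?_⟩
        simp only [moved] at heq
        linarith
      · exact absurd heq.symm (hsep i hi k' hk' k hk x' hx' x hx h fun h => (htt h).symm))
  have hKc : z ≤ 8 * F * K.card := by
    rw [hK, Int.card_Icc, Int.toNat_of_nonneg (by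
      have := Int.ediv_nonneg hzpos.le (by linarith : 0 ≤ 8 * F); linarith)]
    have h1 := Int.emod_add_mul_ediv z (8 * F)
    have h2 := Int.emod_lt_of_pos z (by linarith : 0 < 8 * F)
    linarith
  have hXc : z ≤ 8 * X.card := by
    rw [hX, Int.card_Icc]
    omega
  calc z ^ 2 = z * z := sq z
    _ ≤ (8 * F * K.card) * (8 * X.card) := by gcongr
    _ = 64 * F * (K.card * X.card) := by ring
    _ ≤ 64 * F * ((M + 6) * (badPairs P n χ).card) := by
      refine mul_le_mul_of_nonneg_left ?_ (by linarith)
      exact_mod_cast hcount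
    _ = _ := by ring

/-! ### Degree at least three -/

theorem Bool.eq_of_ne_of_ne {a b c : Bool} (ha : a ≠ c) (hb : b ≠ c) : a = b := by
  revert a b c; decide

/-- If `χ` takes different values at `a` and `b`, then it leaves the color of `a` somewhere. -/
theorem exists_switch {χ : ℤ → Bool} {a b : ℤ} (hab : a ≤ b) (h : χ b ≠ χ a) :
    ∃ t, a ≤ t ∧ t < b ∧ χ t = χ a ∧ χ (t + 1) ≠ χ a := by
  obtain ⟨t, h1, h2, h3, h4⟩ := exists_le_lt_succ (P := fun x => if χ x = χ a then 0 else 1)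
    (T := 0) hab (by simp) (by simp [h])
  refine ⟨t, h1, h2, ?_, ?_⟩
  · by_contra h
    simp [h] at h3
  · intro h
    simp [h] at h4

/-- A label whose value is in range is in range itself. -/
theorem Growth.clean {P : ℤ → ℤ} {d : ℕ} {C g z₀ : ℤ} (G : Growth P d C g z₀) (hd : 2 ≤ d)
    {n ℓ m : ℤ} {χ : ℤ → Bool} {E : ℕ} (hℓ : z₀ ≤ ℓ) (hℓ2 : 2 ≤ ℓ) (hm : ℓ ≤ m) (hn : P m ≤ n)
    (hE : (badAt P n χ ℓ).card ≤ E) : Clean P n χ E ℓ := by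
  have h1 := G.mono (by omega) hℓ hm
  have h2 := G.le_self hd hℓ hℓ2
  exact ⟨by linarith, by linarith, by linarith, hE⟩

/-- If there are few bad edges, then the color cannot switch from `R` to `!R` and back at labels
of the same order of magnitude: the two switches would give an upward and a downward move. -/
theorem Growth.no_opposite_switch {P : ℤ → ℤ} {d : ℕ} {C g z₀ : ℤ} (G : Growth P d C g z₀)
    (hd : 2 ≤ d) {K : ℤ} (hK : 1 ≤ K) :
    ∃ H z₁ : ℤ, 1 ≤ H ∧ ∀ (n v t : ℤ) (χ : ℤ → Bool), z₁ ≤ v → v < t → t ≤ K * v →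
      P (2 * K * v) ≤ n → χ (v + 1) ≠ χ v → χ t ≠ χ v → χ (t + 1) = χ v →
      H * (badPairs P n χ).card ≤ v ^ (d - 1) → False := by
  have hC := G.one_le_C
  have hz₀ := G.one_le_z₀
  have hg := G.one_le_g
  set C₂ : ℤ := C * (d + 1) * (2 * K) ^ (d - 1) with hC₂
  have hC₂1 : 1 ≤ C₂ := by
    have h1 : (1 : ℤ) ≤ (2 * K) ^ (d - 1) := one_le_pow₀ (by linarith)
    have h2 : (1 : ℤ) ≤ C * (d + 1) :=
      one_le_mul_of_one_le_of_one_le hC (by linarith [Int.natCast_nonneg d])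
    exact one_le_mul_of_one_le_of_one_le h2 h1
  obtain ⟨H, z₁, hH, hts⟩ := G.two_sided (by omega) (C₁ := 2 * C₂) (by linarith)
  refine ⟨H, max z₁ (max z₀ (max d (1024 * g * C₂))), hH, ?_⟩
  intro n v t χ hv hvt htK hn hv1 ht ht1 hE
  simp only [max_le_iff] at hv
  obtain ⟨hvz₁, hvz₀, hvd, hvg⟩ := hv
  have hd2 : (2 : ℤ) ≤ d := by exact_mod_cast hd
  have hvK : v ≤ K * v := le_mul_of_one_le_left (by linarith) hK
  set X := v ^ (d - 1) with hX
  have hX0 : 0 ≤ X := pow_nonneg (by linarith) _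
  have hvX : v * X = v ^ d := by rw [hX, ← pow_succ']; congr 1; omega
  have hclean : ∀ ℓ, v ≤ ℓ → ℓ ≤ 2 * K * v → Clean P n χ (badPairs P n χ).card ℓ :=
    fun ℓ h1 h2 => G.clean hd (by linarith) (by linarith) h2 hn (card_badAt_le ℓ)
  have hstep : ∀ x (i : ℕ), v ≤ x → i ≤ d → x + i ≤ 2 * K * v →
      0 ≤ P (x + i) - P x ∧ P (x + i) - P x ≤ C₂ * X := by
    intro x i hx hi hxi
    have hi' : (i : ℤ) ≤ d := by exact_mod_cast hi
    have hi0 := Int.natCast_nonneg i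
    have h1 := G.sub_le (by omega) (by linarith : z₀ ≤ x) (by linarith : x ≤ x + i)
    have h2 := G.mono (by omega) (by linarith : z₀ ≤ x) (by linarith : x ≤ x + i)
    refine ⟨by linarith, h1.trans ?_⟩
    rw [add_sub_cancel_left]
    have h0 : 0 ≤ x + i := by linarith
    calc C * (i * (x + i) ^ (d - 1)) ≤ C * ((d + 1) * (2 * K * v) ^ (d - 1)) := by
          gcongr
          linarith
      _ = C₂ * X := by rw [hC₂, hX, mul_pow (2 * K) v]; ring
  have hlow : ∀ x, v ≤ x → C₂ * X ≤ 2 * C₂ * (P (x + 1) - P x) := by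
    intro x hx
    have h1 := G.le_sub (by omega) (by linarith : z₀ ≤ x) (by linarith : x ≤ x + 1)
    rw [add_sub_cancel_left, one_mul] at h1
    have h2 : X ≤ x ^ (d - 1) := pow_le_pow_left₀ (by linarith) hx _
    have h3 := mul_le_mul_of_nonneg_left (h2.trans h1) (by linarith : 0 ≤ C₂)
    linarith
  have hX1 : 1 ≤ X := one_le_pow₀ (by linarith)
  have hpos : 0 < C₂ * X := mul_pos (by linarith) (by linarith)
  have hb : ∀ x : ℤ, χ x ≠ χ v → χ x = !χ v := fun x h => Bool.eq_not.2 h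
  have hVΔ : ∀ i ≤ d, |P (v + (i : ℕ)) - P v| ≤ C₂ * X := by
    intro i hi
    have hi' : (i : ℤ) ≤ d := by exact_mod_cast hi
    have := hstep v i le_rfl hi (by linarith)
    rw [abs_of_nonneg this.1]; exact this.2
  have h1v := hVΔ 1 (by omega)
  have h1t := hstep t 1 hvt.le (by omega) (by push_cast; linarith)
  have h2v := hlow v le_rfl
  have h2t := hlow t hvt.le
  push_cast at h1v h1t
  refine hts n v v (v + 1) (t + 1) t (C₂ * X) (badPairs P n χ).card χ (χ v) hvz₁ rfl (hb _ hv1)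
    ht1 (hb _ ht) ?_ ?_ ?_ ?_ ?_ ?_ ?_ hVΔ ?_ h1v h2v h2t h1t.2 ?_ ?_ hE
  · exact G.lt (by omega) hvz₀ (by linarith)
  · exact G.lt (by omega) (by linarith) (by linarith)
  · intro i hi
    have hi' : (i : ℤ) ≤ d := by exact_mod_cast hi
    exact hclean _ (by linarith [Int.natCast_nonneg i]) (by linarith)
  · exact hclean _ le_rfl (by linarith)
  · exact hclean _ (by linarith) (by linarith)
  · exact hclean _ (by linarith) (by linarith)
  · exact hclean _ (by linarith) (by linarith)
  · rw [sub_self, abs_zero]; exact hpos.le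
  · rw [← hvX, ← mul_assoc]
    exact mul_le_mul_of_nonneg_right hvg hX0
  · have h1 := G.mono (by omega) (by linarith : z₀ ≤ v + 1) (by linarith : v + 1 ≤ t + 1)
    have h2 := G.pow_le (by linarith : z₀ ≤ v + 1)
    have h3 : 0 ≤ (v + 1) ^ d := pow_nonneg (by linarith) _
    linarith

set_option maxHeartbeats 400000 in
/-- The case `d ≥ 3`. If the color of the labels does not switch between `M` and `O(M ^ d)`, then
any `x`, `w` of order `M` give a bad edge. Otherwise it switches at some `u`. Fewer than `c * M ^ 2`
bad edges are few in comparison with `u ^ (d - 1)`, so there is no other switch at labels of the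
order of `u`, and chains of moves give about `u ^ 2` bad edges. -/
theorem Growth.sq_le_card_of_three_le {P : ℤ → ℤ} {d : ℕ} {C g z₀ : ℤ} (G : Growth P d C g z₀)
    (hd : 3 ≤ d) : ∃ c C' M₀ : ℤ, ∀ (n M : ℤ) (χ : ℤ → Bool), M₀ ≤ M → C' * M ^ (d ^ 2) ≤ n →
      M ^ 2 ≤ c * (badPairs P n χ).card := by
  have hC := G.one_le_C
  have hz₀ := G.one_le_z₀
  obtain ⟨H, z₁, hH, hsw⟩ := G.no_opposite_switch (by omega) (K := 8 * C) (by linarith)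
  obtain ⟨c₂, z₂, hos⟩ := G.one_sided (by omega)
  set U : ℤ := C * 2 ^ d with hU
  have hU2 : 2 ≤ U := by
    have h1 : (2 : ℤ) ^ 1 ≤ 2 ^ d := pow_le_pow_right₀ (by norm_num) (by omega)
    have h2 := mul_le_mul hC h1 (by norm_num) (by linarith)
    linarith
  refine ⟨max 1 (max c₂ (64 * C ^ 2 * H)), C * (16 * C * U) ^ d,
    max 6 (max (8 * C * z₀) (max (8 * C * z₁) z₂)), ?_⟩
  intro n M χ hM hn
  simp only [max_le_iff] at hM
  obtain ⟨hM6, hMz₀, hMz₁, hMz₂⟩ := hM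
  have hCz : z₀ ≤ C * z₀ := le_mul_of_one_le_left (by linarith) hC
  set S := (badPairs P n χ).card with hS
  have hS0 : (0 : ℤ) ≤ S := Int.natCast_nonneg _
  by_contra! hlt
  have hcS : ∀ c', c' ≤ max 1 (max c₂ (64 * C ^ 2 * H)) → c' * S < M ^ 2 := fun c' hc' =>
    (mul_le_mul_of_nonneg_right hc' hS0).trans_lt hlt
  have hMd : M ^ 2 ≤ M ^ d := pow_le_pow_right₀ (by linarith) (by omega)
  have hMsq : 6 * M ≤ M ^ 2 := by rw [sq]; exact mul_le_mul_of_nonneg_right hM6 (by linarith)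
  have hUM : M ≤ U * M ^ d := by
    have : 1 * M ^ d ≤ U * M ^ d := mul_le_mul_of_nonneg_right (by linarith) (by positivity)
    linarith
  have hnU : P (16 * C * (U * M ^ d)) ≤ n := by
    have h1 : U * M ^ d ≤ 16 * C * (U * M ^ d) :=
      le_mul_of_one_le_left (by positivity) (by linarith)
    refine (G.le_pow (by linarith)).trans (le_trans (le_of_eq ?_) hn)
    rw [← mul_assoc (16 * C), mul_pow (16 * C * U), ← pow_mul, ← sq]
    ring
  by_cases hconst : ∀ x, M ≤ x → x ≤ U * M ^ d → χ x = χ M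
  · -- no switch
    have hle : U * M ^ d ≤ n := by
      have h1 : U * M ^ d ≤ 16 * C * (U * M ^ d) :=
        le_mul_of_one_le_left (by positivity) (by linarith)
      exact h1.trans ((G.le_self (by omega) (by linarith) (by linarith)).trans hnU)
    have hsub : Finset.Ico M (2 * M) ×ˢ Finset.Ico M (2 * M) ⊆ badPairs P n χ := by
      rintro ⟨x, w⟩ hxw
      simp only [Finset.mem_product, Finset.mem_Ico] at hxw
      obtain ⟨⟨hx1, hx2⟩, hw1, hw2⟩ := hxw
      have h1 := G.le_pow (by linarith : z₀ ≤ w)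
      have h2 := G.pow_le (by linarith : z₀ ≤ w)
      have h3 : M ^ d ≤ w ^ d := pow_le_pow_left₀ (by linarith) hw1 _
      have h4 : C * w ^ d ≤ U * M ^ d := by
        have : w ^ d ≤ (2 * M) ^ d := pow_le_pow_left₀ (by linarith) hw2.le _
        rw [mul_pow] at this
        have := mul_le_mul_of_nonneg_left this (by linarith : 0 ≤ C)
        rw [hU]; linarith
      have h5 : 2 * M ≤ U * M ^ d := by
        have : 1 * M ^ d ≤ U * M ^ d := mul_le_mul_of_nonneg_right (by linarith) (by positivity)
        linarith
      rw [mem_badPairs, hconst x (by linarith) (by linarith), hconst w (by linarith) (by linarith),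
        hconst (P w - x) (by linarith) (by linarith)]
      refine ⟨⟨⟨by linarith, by linarith⟩, by linarith, by linarith⟩, ⟨by linarith, by linarith⟩,
        rfl, rfl⟩
    have h1 := Finset.card_le_card hsub
    rw [Finset.card_product, Int.card_Ico] at h1
    zify at h1
    rw [Int.toNat_of_nonneg (by linarith)] at h1
    have h2 := hcS 1 (le_max_left _ _)
    rw [show 2 * M - M = M by ring, ← sq] at h1
    linarith
  · push Not at hconst
    obtain ⟨x, hx1, hx2, hx3⟩ := hconst
    obtain ⟨u, hu1, hu2, hu3, hu4⟩ := exists_switch hx1 hx3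
    rw [← hu3] at hu4
    have huU : 16 * C * u ≤ 16 * C * (U * M ^ d) :=
      mul_le_mul_of_nonneg_left (by linarith) (by linarith)
    have hPn : ∀ x, z₀ ≤ x → x ≤ 16 * C * u → P x ≤ n := fun x h1 h2 =>
      (G.mono (by omega) h1 (h2.trans huU)).trans hnU
    have hHv : ∀ v, M ≤ 8 * C * v → H * S ≤ v ^ (d - 1) := by
      intro v hv
      have hvpos : 0 < v := by
        by_contra! h
        have : 8 * C * v ≤ 0 := mul_nonpos_of_nonneg_of_nonpos (by linarith) h
        linarith
      have h1 := hcS (64 * C ^ 2 * H) ((le_max_right _ _).trans (le_max_right _ _))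
      have h2 : M ^ 2 ≤ (8 * C * v) ^ 2 := pow_le_pow_left₀ (by linarith) hv _
      have h3 : 64 * C ^ 2 * (H * S) ≤ 64 * C ^ 2 * v ^ 2 := by
        have : (8 * C * v) ^ 2 = 64 * C ^ 2 * v ^ 2 := by ring
        linarith
      have h4 : H * S ≤ v ^ 2 := le_of_mul_le_mul_left h3 (by positivity)
      exact h4.trans (pow_le_pow_right₀ (by linarith) (by omega))
    have hMu : M ≤ 8 * C * u := hu1.trans (le_mul_of_one_le_left (by linarith) (by linarith))
    have h8 : ∀ {a v : ℤ}, 8 * C * a ≤ 8 * C * v → a ≤ v := fun h =>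
      le_of_mul_le_mul_left h (by linarith)
    have huC : u ≤ C * u := le_mul_of_one_le_left (by linarith) hC
    have hlow : ∀ x, u ≤ 8 * C * x → x ≤ u → χ x = χ u := by
      intro x h1 h2
      by_contra h3
      obtain ⟨t, ht1, ht2, ht3, ht4⟩ := exists_switch h2 (Ne.symm h3)
      rw [← ht3] at ht4 h3
      have h5 : 8 * C * x ≤ 8 * C * t := mul_le_mul_of_nonneg_left ht1 (by linarith)
      refine hsw n t u χ (h8 (by linarith)) ht2 (by linarith) (hPn _ ?_ ?_) ht4 (Ne.symm h3) ?_
        (hHv t (by linarith))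
      · linarith
      · have : C * t ≤ C * u := mul_le_mul_of_nonneg_left ht2.le (by linarith)
        linarith
      · exact Bool.eq_of_ne_of_ne hu4 h3
    have hhigh : ∀ x, u < x → x ≤ 2 * u → χ x = !χ u := by
      intro x h1 h2
      by_contra h3
      have h4 : χ x = χ u := by simpa using h3
      obtain ⟨t, ht1, ht2, ht3, ht4⟩ := exists_switch (χ := χ) (a := u + 1) (b := x) (by linarith)
        (by rw [h4]; exact Ne.symm hu4)
      refine hsw n u t χ (h8 (by linarith)) (by linarith) (by linarith) (hPn _ ?_ ?_) hu4
        (by rw [ht3]; exact hu4) ?_ (hHv u hMu)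
      · linarith
      · linarith
      · exact Bool.eq_of_ne_of_ne ht4 (Ne.symm hu4)
    have h1 := hos n u χ (χ u) (by linarith) hlow hhigh (hPn _ (by linarith) (by linarith))
    have h2 := hcS c₂ ((le_max_left _ _).trans (le_max_right _ _))
    have h3 : M ^ 2 ≤ u ^ 2 := pow_le_pow_left₀ (by linarith) hu1 _
    linarith

/-! ### Colors of most labels in degree two -/

/-- Among `B.card + 1` disjoint intervals of length `s`, one avoids `B`. -/
theorem exists_run (B : Finset ℤ) (s : ℕ) (l : ℤ) :
    ∃ v, l ≤ v ∧ v ≤ l + s * B.card ∧ ∀ i < s, v + (i : ℕ) ∉ B := by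
  by_contra! h
  have h' : ∀ j : ℕ, ∃ i : ℕ, j ≤ B.card → i < s ∧ l + s * j + i ∈ B := by
    intro j
    by_cases hj : j ≤ B.card
    · obtain ⟨i, hi⟩ := h (l + s * j) (by linarith [show (0 : ℤ) ≤ s * j by positivity]) (by
        have : (s : ℤ) * j ≤ s * B.card := by gcongr
        linarith)
      exact ⟨i, fun _ => hi⟩
    · exact ⟨0, fun h => absurd h hj⟩
  choose i hi using h'
  have := Finset.card_le_card_of_injOn (s := Finset.range (B.card + 1)) (t := B)
    (fun j => l + s * j + i j)
    (fun j hj => (hi j (by simpa [Nat.lt_succ_iff] using hj)).2) (by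
      intro j hj j' hj' hjj
      have h1 := (hi j (by simpa [Nat.lt_succ_iff] using hj)).1
      have h2 := (hi j' (by simpa [Nat.lt_succ_iff] using hj')).1
      have h3 : s * j + i j = s * j' + i j' := by
        have : l + s * j + i j = l + s * j' + i j' := hjj
        zify; linarith
      have h4 : (s * j + i j) / s = j := by
        rw [Nat.mul_add_div (by omega), Nat.div_eq_of_lt h1, add_zero]
      have h5 : (s * j' + i j') / s = j' := by
        rw [Nat.mul_add_div (by omega), Nat.div_eq_of_lt h2, add_zero]
      rw [← h4, ← h5, h3])
  simp at this

/-- If two elements outside of `B` have different colors, then so do two consecutive elements of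
the complement of `B` between them. The number `N` only serves the induction. -/
theorem exists_adjacent {χ : ℤ → Bool} {B : Finset ℤ} : ∀ (N : ℕ) (p q : ℤ), p < q → q ≤ p + N →
    p ∉ B → q ∉ B → χ q ≠ χ p → ∃ u u', p ≤ u ∧ u < u' ∧ u' ≤ q ∧ u ∉ B ∧ u' ∉ B ∧ χ u' ≠ χ u ∧
      ∀ x, u < x → x < u' → x ∈ B := by
  intro N
  induction N with
  | zero => intro p q h1 h2; push_cast at h2; linarith
  | succ N ih =>
    intro p q hpq hN hp hq hχ
    by_cases h : ∀ x, p < x → x < q → x ∈ B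
    · exact ⟨p, q, le_rfl, hpq, le_rfl, hp, hq, hχ, h⟩
    · push Not at h
      obtain ⟨x, hx1, hx2, hx⟩ := h
      push_cast at hN
      by_cases hc : χ x = χ p
      · obtain ⟨u, u', h1, h2, h3, h4⟩ := ih x q hx2 (by linarith) hx hq (by rwa [hc])
        exact ⟨u, u', by linarith, h2, h3, h4⟩
      · obtain ⟨u, u', h1, h2, h3, h4⟩ := ih p x hx1 (by linarith) hp hx hc
        exact ⟨u, u', h1, h2, by linarith, h4⟩

/-- Labels `p < q` outside of `B`, of the order of `z`, of colors `c` and `!c`, and with a distance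
between `z / (4 * k)` and `z / k`. They give a move along two edges. -/
def Rises (χ : ℤ → Bool) (B : Finset ℤ) (K k z : ℤ) (c : Bool) (p q : ℤ) : Prop :=
  z ≤ K * p ∧ q ≤ K * z ∧ p ∉ B ∧ q ∉ B ∧ z ≤ 4 * k * (q - p) ∧ k * (q - p) ≤ z ∧
    χ p = c ∧ χ q = !c

/-- If the labels of the order of `z` outside of a small set `B` have few bad edges, then the color
of these labels cannot change in both directions. -/
theorem Growth.not_rises {P : ℤ → ℤ} {C g z₀ : ℤ} (G : Growth P 2 C g z₀) {K k : ℤ} (hK : 1 ≤ K)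
    (hk : 2048 * g * C * K ^ 3 ≤ k) :
    ∃ H z₁ : ℤ, 1 ≤ H ∧ ∀ (n z : ℤ) (χ : ℤ → Bool) (B : Finset ℤ) (E : ℕ), z₁ ≤ z →
      P (K * z) ≤ n → (∀ ℓ, z ≤ K * ℓ → ℓ ≤ K * z → ℓ ∉ B → (badAt P n χ ℓ).card ≤ E) →
      24 * k * B.card ≤ z → H * E ≤ z →
      ∀ c p q p' q', Rises χ B K k z c p q → Rises χ B K k z (!c) p' q' → False := by
  have hC := G.one_le_C
  have hz₀ := G.one_le_z₀
  have hg := G.one_le_g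
  have hK3 : 1 ≤ K ^ 3 := one_le_pow₀ hK
  have hgC : 1 ≤ g * C := one_le_mul_of_one_le_of_one_le hg hC
  have hk1 : 1 ≤ k := by
    have : 1 ≤ g * C * K ^ 3 := one_le_mul_of_one_le_of_one_le hgC hK3
    linarith
  obtain ⟨H, z₁, hH, hts⟩ := G.two_sided (by norm_num) (C₁ := 16 * C * K ^ 2 * k) (by
    have h1 : 1 ≤ K ^ 2 := one_le_pow₀ hK
    have h2 := one_le_mul_of_one_le_of_one_le (one_le_mul_of_one_le_of_one_le hC h1) hk1
    linarith)
  refine ⟨K * H, max (K * z₁) (max (2 * K * z₀) (16 * k)),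
    one_le_mul_of_one_le_of_one_le hK hH, ?_⟩
  intro n z χ B E hz hn hgood hB hE
  simp only [max_le_iff] at hz
  obtain ⟨hzz₁, hzz₀, hzk⟩ := hz
  have hzpos : 0 < z := by linarith
  have hKz₀ : 1 ≤ K * z₀ := one_le_mul_of_one_le_of_one_le hK hz₀
  have hcancel : ∀ {x y : ℤ}, K * x ≤ K * y → x ≤ y := fun h =>
    le_of_mul_le_mul_left h (by linarith)
  have hlab : ∀ ℓ, z ≤ K * ℓ → z₁ ≤ ℓ ∧ z₀ ≤ ℓ ∧ 2 ≤ ℓ := by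
    intro ℓ h
    exact ⟨hcancel (by linarith), hcancel (by linarith),
      hcancel (by linarith [mul_le_mul_of_nonneg_left hz₀ (by linarith : 0 ≤ 2 * K)])⟩
  have hclean : ∀ ℓ, z ≤ K * ℓ → ℓ ≤ K * z → ℓ ∉ B → Clean P n χ E ℓ := fun ℓ h1 h2 h3 =>
    G.clean le_rfl (hlab ℓ h1).2.1 (hlab ℓ h1).2.2 h2 hn (hgood ℓ h1 h2 h3)
  -- the lower pair hosts the run of consecutive labels
  have key : ∀ c p q p' q', p ≤ p' → Rises χ B K k z c p q → Rises χ B K k z (!c) p' q' →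
      False := by
    rintro c p q p' q' hpp ⟨h1, h2, h3, h4, h5, h6, h7, h8⟩ ⟨h1', h2', h3', h4', h5', h6', h7', h8'⟩
    obtain ⟨v, hv1, hv2, hv3⟩ := exists_run B 3 p
    have hlt : ∀ {x y : ℤ}, z ≤ 4 * k * (y - x) → 0 < y - x := fun {x y} h => by
      by_contra! h'
      have : 4 * k * (y - x) ≤ 0 := mul_nonpos_of_nonneg_of_nonpos (by linarith) h'
      linarith
    have hvq : ∀ x, z ≤ 4 * k * (x - p) → v + 2 ≤ x := by
      intro x hx
      have hv2' : v ≤ p + 3 * B.card := by exact_mod_cast hv2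
      have h9 : 4 * k * (3 * B.card + 2) ≤ 4 * k * (x - p) := by linarith
      have := le_of_mul_le_mul_left h9 (by linarith : 0 < 4 * k)
      linarith
    have hvq1 := hvq q h5
    have hvq2 : v + 2 ≤ q' := hvq q' (by
      have : 4 * k * (q' - p') ≤ 4 * k * (q' - p) :=
        mul_le_mul_of_nonneg_left (by linarith) (by linarith)
      linarith)
    have hKp : ∀ x, p ≤ x → z ≤ K * x := fun x hx =>
      h1.trans (mul_le_mul_of_nonneg_left hx (by linarith))
    have hpq := hlt h5
    have hpq' := hlt h5'
    have hp := hlab p h1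
    have hp' := hlab p' h1'
    have hv := hlab v (hKp v hv1)
    have hlow : ∀ x y, z ≤ K * x → z ≤ 4 * k * (y - x) → 0 < y - x →
        z ^ 2 ≤ 8 * K * k * (P y - P x) := by
      intro x y hx hxy h0
      have e1 := G.le_sub (by norm_num) (hlab x hx).2.1 (by linarith : x ≤ y)
      rw [show 2 - 1 = 1 from rfl, pow_one] at e1
      calc z ^ 2 = z * z := sq z
        _ ≤ (4 * k * (y - x)) * (K * x) := mul_le_mul hxy hx hzpos.le (by positivity)
        _ = 4 * k * K * ((y - x) * x) := by ring
        _ ≤ 4 * k * K * (2 * (P y - P x)) := by gcongr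
        _ = _ := by ring
    have hupp : ∀ x y, z ≤ K * x → k * (y - x) ≤ z → 0 < y - x → y ≤ K * z →
        k * (P y - P x) ≤ C * K * z ^ 2 := by
      intro x y hx hxy h0 hy
      have e1 := G.sub_le (by norm_num) (hlab x hx).2.1 (by linarith : x ≤ y)
      rw [show 2 - 1 = 1 from rfl, pow_one] at e1
      have hy0 : 0 ≤ y := by linarith [(hlab x hx).2.2]
      calc k * (P y - P x) ≤ k * (C * ((y - x) * y)) := by gcongr
        _ = C * (k * (y - x)) * y := by ring
        _ ≤ C * z * (K * z) := by gcongr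
        _ = _ := by ring
    have l0 := hlow p q h1 h5 hpq
    have l1 := hlow p' q' h1' h5' hpq'
    have u0 := hupp p q h1 h6 hpq h2
    have u1 := hupp p' q' h1' h6' hpq' h2'
    have m0 := G.lt (by norm_num) hp.2.1 (by linarith : p < q)
    have m1 := G.lt (by norm_num) hp'.2.1 (by linarith : p' < q')
    set Δ := P q - P p + (P q' - P p') with hΔ
    have hkΔ : k * Δ ≤ 2 * C * K * z ^ 2 := by rw [hΔ, mul_add]; linarith
    have hΔ1 : ∀ D, z ^ 2 ≤ 8 * K * k * D → Δ ≤ 16 * C * K ^ 2 * k * D := by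
      intro D hD
      have hΔ0 : 0 ≤ Δ := by linarith
      have e1 : Δ ≤ k * Δ := le_mul_of_one_le_left hΔ0 hk1
      have e2 := mul_le_mul_of_nonneg_left hD (by positivity : 0 ≤ 2 * C * K)
      calc Δ ≤ 2 * C * K * (8 * K * k * D) := by linarith
        _ = _ := by ring
    have hmono : ∀ x, p ≤ x → x ≤ q → P p ≤ P x ∧ P x ≤ P q := fun x e1 e2 =>
      ⟨G.mono (by norm_num) hp.2.1 e1, G.mono (by norm_num) (hp.2.1.trans e1) e2⟩
    have habs : ∀ x, p ≤ x → x ≤ q → |P x - P v| ≤ Δ := by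
      intro x e1 e2
      have e3 := hmono x e1 e2
      have e4 := hmono v hv1 (by linarith)
      rw [abs_le]; constructor <;> linarith
    refine hts n v p q q' p' Δ E χ c hv.1 h7 h8 (by rw [h8', Bool.not_not]) h7' m0 m1 ?_
      (hclean p h1 (by linarith) h3) (hclean q (hKp q (by linarith)) h2 h4)
      (hclean q' (hKp q' (by linarith)) h2' h4') (hclean p' h1' (by linarith) h3') ?_
      (habs p le_rfl (by linarith)) (habs q (by linarith) le_rfl) (hΔ1 _ l0) (hΔ1 _ l1)
      (by linarith) ?_ ?_ ?_
    · intro i hi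
      have hi' : (i : ℤ) ≤ 2 := by exact_mod_cast hi
      exact hclean _ (hKp _ (by linarith [Int.natCast_nonneg i])) (by linarith)
        (hv3 i (by omega))
    · intro i hi
      have hi' : (i : ℤ) ≤ 2 := by exact_mod_cast hi
      exact habs _ (by linarith [Int.natCast_nonneg i]) (by linarith)
    · have e1 : z ^ 2 ≤ (K * v) ^ 2 := pow_le_pow_left₀ hzpos.le (hKp v hv1) _
      have hΔ0 : 0 ≤ Δ := by linarith
      have e2 : 2048 * g * C * K ^ 3 * Δ ≤ 2 * C * K * z ^ 2 :=
        (mul_le_mul_of_nonneg_right hk hΔ0).trans hkΔ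
      have e3 : 2 * C * K ^ 3 * (1024 * g * Δ) ≤ 2 * C * K ^ 3 * v ^ 2 := by
        calc _ = 2048 * g * C * K ^ 3 * Δ := by ring
          _ ≤ 2 * C * K * z ^ 2 := e2
          _ ≤ 2 * C * K * (K * v) ^ 2 := by gcongr
          _ = _ := by ring
      exact le_of_mul_le_mul_left e3 (by positivity)
    · have e1 := G.mono (by norm_num) (by linarith [hv.2.1] : z₀ ≤ v + 1)
        (by linarith : v + 1 ≤ q')
      have e2 := G.pow_le (by linarith [hv.2.1] : z₀ ≤ v + 1)
      have e3 : 0 ≤ (v + 1) ^ 2 := sq_nonneg _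
      linarith
    · rw [show 2 - 1 = 1 from rfl, pow_one]
      refine hcancel ?_
      rw [← mul_assoc]
      exact hE.trans (hKp v hv1)
  intro c p q p' q' h h'
  rcases le_total p p' with hp | hp
  · exact key c p q p' q' hp h h'
  · exact key (!c) p' q' p q hp h' (by rwa [Bool.not_not])

/-- If the color never changes from `c` to `!c` at a distance of the order of `z / k`, then this
also holds for larger distances: above a label of color `c`, the labels outside of `B` have the
color `c`, and below one of color `!c` they have the color `!c`, except at distance less than
`z / (4 * k)`. The distance is covered in steps to elements outside of `B`. -/
theorem eq_of_forall_not_rises {χ : ℤ → Bool} {B : Finset ℤ} {K k z : ℤ} {c : Bool} (hk : 1 ≤ k)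
    (hK : 1 ≤ K) (hB : 8 * k * (B.card + 2) ≤ z) (h : ∀ p q, ¬ Rises χ B K k z c p q) {u : ℤ}
    (hu : u ∉ B) :
    (χ u = c → z ≤ K * u → ∀ (N : ℕ) (ℓ : ℤ), ℓ ≤ u + N → z ≤ 4 * k * (ℓ - u) → ℓ ≤ K * z →
      ℓ ∉ B → χ ℓ = c) ∧
    (χ u = (!c) → u ≤ K * z → ∀ (N : ℕ) (ℓ : ℤ), u ≤ ℓ + N → z ≤ 4 * k * (u - ℓ) → z ≤ K * ℓ →
      ℓ ∉ B → χ ℓ = !c) := by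
  have hpos : 0 < 8 * k * ((B.card : ℤ) + 2) := by positivity
  have h4k : ∀ {x y : ℤ}, 4 * k * x ≤ 4 * k * y → x ≤ y := fun h =>
    le_of_mul_le_mul_left h (by linarith)
  have hk4 : ∀ {x y : ℤ}, x ≤ y → 4 * k * x ≤ 4 * k * y := fun h =>
    mul_le_mul_of_nonneg_left h (by linarith)
  -- the distance `s` is the least allowed one
  obtain ⟨s, hs1, hs2⟩ : ∃ s : ℤ, z ≤ 4 * k * s ∧ 4 * k * s < z + 4 * k := by
    have h1 := Int.emod_add_mul_ediv (z - 1) (4 * k)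
    have h2 := Int.emod_nonneg (z - 1) (by linarith : 4 * k ≠ 0)
    have h3 := Int.emod_lt_of_pos (z - 1) (by linarith : 0 < 4 * k)
    exact ⟨(z - 1) / (4 * k) + 1, by linarith, by linarith⟩
  have hsB : (B.card : ℤ) + 1 ≤ s := h4k (by linarith)
  constructor
  · intro hc hKu N
    induction N with
    | zero =>
      intro ℓ h1 h2
      exfalso
      push_cast at h1
      have : 4 * k * (ℓ - u) ≤ 4 * k * 0 := hk4 (by linarith)
      linarith
    | succ N ih =>
      intro ℓ h1 h2 h3 h4
      push_cast at h1
      by_contra hne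
      have hne' : χ ℓ = !c := Bool.eq_not.2 hne
      by_cases hd : k * (ℓ - u) ≤ z
      · exact h u ℓ ⟨hKu, h3, hu, h4, h2, hd, hc, hne'⟩
      · obtain ⟨v, hv1, hv2, hv3⟩ := exists_run B 1 (ℓ - s - B.card)
        have hv3 : v ∉ B := by simpa using hv3 0 (by norm_num)
        push_cast at hv2
        have e1 : z ≤ 4 * k * (ℓ - v) := hs1.trans (hk4 (by linarith))
        have e2 : 4 * k * (ℓ - v) ≤ 2 * z := by
          have := hk4 (by linarith : ℓ - v ≤ s + B.card)
          linarith
        have e3 : z ≤ 4 * k * (v - u) := by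
          have : 4 * k * (v - u) = 4 * (k * (ℓ - u)) - 4 * k * (ℓ - v) := by ring
          linarith
        have e4 : v ≤ ℓ := by linarith
        have e5 : χ v = c := ih v (by linarith) e3 (by linarith) hv3
        refine h v ℓ ⟨?_, h3, hv3, h4, e1, by linarith, e5, hne'⟩
        have : u ≤ v := by
          have : 4 * k * 0 ≤ 4 * k * (v - u) := by linarith
          linarith [h4k this]
        exact hKu.trans (mul_le_mul_of_nonneg_left this (by linarith))
  · intro hc hKu N
    induction N with
    | zero =>
      intro ℓ h1 h2
      exfalso
      push_cast at h1
      have : 4 * k * (u - ℓ) ≤ 4 * k * 0 := hk4 (by linarith)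
      linarith
    | succ N ih =>
      intro ℓ h1 h2 h3 h4
      push_cast at h1
      by_contra hne
      have hne' : χ ℓ = c := by simpa using Bool.eq_not.2 hne
      by_cases hd : k * (u - ℓ) ≤ z
      · exact h ℓ u ⟨h3, hKu, h4, hu, h2, hd, hne', hc⟩
      · obtain ⟨v, hv1, hv2, hv3⟩ := exists_run B 1 (ℓ + s)
        have hv3 : v ∉ B := by simpa using hv3 0 (by norm_num)
        push_cast at hv2
        have e1 : z ≤ 4 * k * (v - ℓ) := hs1.trans (hk4 (by linarith))
        have e2 : 4 * k * (v - ℓ) ≤ 2 * z := by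
          have := hk4 (by linarith : v - ℓ ≤ s + B.card)
          linarith
        have e3 : z ≤ 4 * k * (u - v) := by
          have : 4 * k * (u - v) = 4 * (k * (u - ℓ)) - 4 * k * (v - ℓ) := by ring
          linarith
        have e4 : ℓ ≤ v := by linarith
        have e5 : χ v = !c := ih v (by linarith) e3
          (h3.trans (mul_le_mul_of_nonneg_left e4 (by linarith))) hv3
        refine h ℓ v ⟨h3, ?_, h4, hv3, e1, by linarith, hne', e5⟩
        have : v ≤ u := by
          have : 4 * k * 0 ≤ 4 * k * (u - v) := by linarith
          linarith [h4k this]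
        linarith

/-! ### Chains of three edges from an identity of squares -/

set_option maxHeartbeats 1000000 in
/-- If most labels of the order of `u` have the color `R` below `u` and `!R` above `u`, then there
are at least `c u²` bad edges. The identity `(2 * j - 1) ^ 2 + (4 * h) ^ 2 = (2 * j + 1) ^ 2` with
`j = 2 * h ^ 2` gives labels `w₀ < u`, `w₁ < u`, `w₂ > u`, linear in a parameter `t`, such that
`P w₀ + P w₁ - P w₂ = lam * t + μ` is of the order of `u`. Then an edge with label `w₀`, one with
label `w₂` and one with label `w₁` lead from `x` to `lam * t + μ - x`. -/
theorem Growth.sq_le_card_of_separated {P : ℤ → ℤ} {C g z₀ : ℤ} (G : Growth P 2 C g z₀)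
    {a b e h j : ℤ} (hP : ∀ x, P x = a * x ^ 2 + b * x + e) (ha : 1 ≤ a) (hh : h = a + 1)
    (hj : j = 2 * h ^ 2) :
    ∃ z₁ : ℤ, ∀ (n u : ℤ) (χ : ℤ → Bool) (R : Bool) (B : Finset ℤ), z₁ ≤ u →
      (∀ ℓ, u ≤ 16 * j * ℓ → 4 * j * ℓ ≤ (4 * j - 1) * u → ℓ ∉ B → χ ℓ = R) →
      (∀ ℓ, (4 * j + 1) * u ≤ 4 * j * ℓ → ℓ ≤ 2 * u → ℓ ∉ B → χ ℓ = !R) →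
      P (2 * u) ≤ n → 96 * j ^ 2 * B.card ≤ u →
      u ^ 2 ≤ 1536 * j ^ 3 * (badPairs P n χ).card := by
  classical
  have hz₀ := G.one_le_z₀
  have hh2 : 2 ≤ h := by linarith
  have hjh : 4 * h ≤ j := by nlinarith
  have hj8 : 8 ≤ j := by linarith
  -- the shifts `j * m`, `(j - 1) * m` of the labels `w₀`, `w₂` below add `2 * a * m` to the slope,
  -- which brings it between `1` and `2 * a`
  obtain ⟨m, hm1, hm2⟩ : ∃ m, 1 ≤ 2 * a * m + b * (4 * h - 2) ∧
      2 * a * m + b * (4 * h - 2) ≤ 2 * a := by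
    have h1 := Int.emod_add_mul_ediv (b * (4 * h - 2) - 1) (2 * a)
    have h2 := Int.emod_nonneg (b * (4 * h - 2) - 1) (by linarith : 2 * a ≠ 0)
    have h3 := Int.emod_lt_of_pos (b * (4 * h - 2) - 1) (by linarith : 0 < 2 * a)
    exact ⟨-((b * (4 * h - 2) - 1) / (2 * a)), by linarith, by linarith⟩
  set lam := 2 * a * m + b * (4 * h - 2) with hlam
  set μ := a * (2 * j - 1) * m ^ 2 + b * m + e with hμ
  refine ⟨max (16 * j ^ 3 * |m|) (max (16 * j ^ 2 * |μ|) (max (16 * j * z₀) (512 * j ^ 2))), ?_⟩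
  intro n u χ R B hu hlow hhigh hn hB
  simp only [max_le_iff] at hu
  obtain ⟨hum, huμ, huz, huj⟩ := hu
  have hupos : 0 < u := lt_of_lt_of_le (by positivity) huj
  have hjz : z₀ ≤ 16 * j * z₀ := le_mul_of_one_le_left (by linarith) (by linarith)
  obtain ⟨hm3, hm4⟩ := abs_le.1 (le_refl |m|)
  have hjm1 : 16 * j ^ 3 * m ≤ u := (mul_le_mul_of_nonneg_left hm4 (by positivity)).trans hum
  have hjm2 : -u ≤ 16 * j ^ 3 * m := by
    have := mul_le_mul_of_nonneg_left hm3 (by positivity : 0 ≤ 16 * j ^ 3)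
    linarith
  have hjm1' : 16 * j ^ 2 * ((j - 1) * m) ≤ u := by
    rcases le_total 0 m with h0 | h0
    · have : 0 ≤ 16 * j ^ 2 * m := by positivity
      linarith
    · have : 16 * j ^ 2 * ((j - 1) * m) ≤ 0 := mul_nonpos_of_nonneg_of_nonpos (by positivity)
        (mul_nonpos_of_nonneg_of_nonpos (by linarith) h0)
      linarith
  have hjm2' : -u ≤ 16 * j ^ 2 * ((j - 1) * m) := by
    rcases le_total 0 m with h0 | h0
    · have : 0 ≤ 16 * j ^ 2 * ((j - 1) * m) := mul_nonneg (by positivity)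
        (mul_nonneg (by linarith) h0)
      linarith
    · have : 16 * j ^ 2 * m ≤ 0 := mul_nonpos_of_nonneg_of_nonpos (by positivity) h0
      linarith
  obtain ⟨hμ3, hμ4⟩ := abs_le.1 (le_refl |μ|)
  have hjμ1 : 16 * j ^ 2 * μ ≤ u := (mul_le_mul_of_nonneg_left hμ4 (by positivity)).trans huμ
  have hjμ2 : -u ≤ 16 * j ^ 2 * μ := by
    have := mul_le_mul_of_nonneg_left hμ3 (by positivity : 0 ≤ 16 * j ^ 2)
    linarith
  set J := 16 * j ^ 2 with hJ
  have hJpos : 0 < J := by positivity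
  set w₀ : ℤ → ℤ := fun t => (2 * j - 1) * t + j * m with hw₀
  set w₁ : ℤ → ℤ := fun t => 4 * h * t with hw₁
  set w₂ : ℤ → ℤ := fun t => (2 * j + 1) * t + (j - 1) * m with hw₂
  have hid : ∀ t, P (w₀ t) + P (w₁ t) - P (w₂ t) = lam * t + μ := by
    intro t
    simp only [hP, hw₀, hw₁, hw₂, hlam, hμ]
    rw [hj]; ring
  set T₀ : Finset ℤ := Finset.Icc ((8 * j - 1) * u / J + 1) ((8 * j + 1) * u / J) with hT₀
  set I : Finset ℤ := Finset.Icc (u / (16 * j) + 1) (u / (8 * j)) with hI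
  have hT₀b : ∀ t ∈ T₀, (8 * j - 1) * u ≤ J * t ∧ J * t ≤ (8 * j + 1) * u := by
    intro t ht
    obtain ⟨h1, h2⟩ := Finset.mem_Icc.1 ht
    have h3 := Int.lt_mul_ediv_self_add (x := (8 * j - 1) * u) hJpos
    have h4 : J * ((8 * j + 1) * u / J) ≤ (8 * j + 1) * u := Int.mul_ediv_self_le hJpos.ne'
    have h5 := mul_le_mul_of_nonneg_left h1 hJpos.le
    have h6 := mul_le_mul_of_nonneg_left h2 hJpos.le
    constructor <;> linarith
  have hIb : ∀ x ∈ I, u ≤ 16 * j * x ∧ 8 * j * x ≤ u := by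
    intro x hx
    obtain ⟨h1, h2⟩ := Finset.mem_Icc.1 hx
    have h3 := Int.lt_mul_ediv_self_add (x := u) (by linarith : 0 < 16 * j)
    have h4 : 8 * j * (u / (8 * j)) ≤ u := Int.mul_ediv_self_le (by linarith)
    have h5 := mul_le_mul_of_nonneg_left h1 (by linarith : 0 ≤ 16 * j)
    have h6 := mul_le_mul_of_nonneg_left h2 (by linarith : 0 ≤ 8 * j)
    constructor <;> linarith
  have hjj : ∀ {x y : ℤ}, j * x ≤ j * y → x ≤ y := fun h => le_of_mul_le_mul_left h (by linarith)
  have hju : 8 * u ≤ j * u := mul_le_mul_of_nonneg_right hj8 hupos.le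
  have hjju : 8 * (j * u) ≤ j * (j * u) :=
    mul_le_mul_of_nonneg_right hj8 (mul_nonneg (by linarith) hupos.le)
  have hhu : 0 ≤ h * u := mul_nonneg (by linarith) hupos.le
  have hhju : 4 * (h * (j * u)) ≤ j * (j * u) := by
    rw [← mul_assoc]
    exact mul_le_mul_of_nonneg_right hjh (mul_nonneg (by linarith) hupos.le)
  have hhu4 : 4 * (h * u) ≤ j * u := by
    rw [← mul_assoc]
    exact mul_le_mul_of_nonneg_right hjh hupos.le
  -- the positions of the labels
  have hb₀ : ∀ t ∈ T₀, u ≤ 16 * j * w₀ t ∧ 4 * j * w₀ t ≤ (4 * j - 1) * u := by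
    intro t ht
    obtain ⟨h1, h2⟩ := hT₀b t ht
    have h3 := mul_le_mul_of_nonneg_left h1 (by linarith : 0 ≤ 2 * j - 1)
    have h4 := mul_le_mul_of_nonneg_left h2 (by linarith : 0 ≤ 2 * j - 1)
    have e1 : j * (16 * j * w₀ t) = (2 * j - 1) * (J * t) + 16 * j ^ 3 * m := by
      simp only [hw₀, hJ]; ring
    constructor
    · refine hjj ?_
      rw [e1]
      linarith
    · refine hjj ?_
      linarith
  have hb₁ : ∀ t ∈ T₀, u ≤ 16 * j * w₁ t ∧ 4 * j * w₁ t ≤ (4 * j - 1) * u := by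
    intro t ht
    obtain ⟨h1, h2⟩ := hT₀b t ht
    have h3 := mul_le_mul_of_nonneg_left h1 (by linarith : 0 ≤ 4 * h)
    have h4 := mul_le_mul_of_nonneg_left h2 (by linarith : 0 ≤ 4 * h)
    have e1 : j * (16 * j * w₁ t) = 4 * h * (J * t) := by
      simp only [hw₁, hJ]; ring
    have e2 : 2 * (j * u) ≤ h * (j * u) :=
      mul_le_mul_of_nonneg_right hh2 (mul_nonneg (by linarith) hupos.le)
    constructor
    · refine hjj ?_
      rw [e1]
      linarith
    · -- `8 * h + 2 ≤ 4 * j` holds as `j = 2 * h ^ 2`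
      refine hjj ?_
      have e3 : 2 * (h * (h * (j * u))) = j * (j * u) := by rw [hj]; ring
      have e4 : 2 * (h * (j * u)) ≤ h * (h * (j * u)) :=
        mul_le_mul_of_nonneg_right hh2 (mul_nonneg (by linarith)
          (mul_nonneg (by linarith) hupos.le))
      linarith
  have hb₂ : ∀ t ∈ T₀, (4 * j + 1) * u ≤ 4 * j * w₂ t ∧ w₂ t ≤ 2 * u := by
    intro t ht
    obtain ⟨h1, h2⟩ := hT₀b t ht
    have h3 := mul_le_mul_of_nonneg_left h1 (by linarith : 0 ≤ 2 * j + 1)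
    have h4 := mul_le_mul_of_nonneg_left h2 (by linarith : 0 ≤ 2 * j + 1)
    have e1 : 4 * (j * (4 * j * w₂ t)) = (2 * j + 1) * (J * t) + J * ((j - 1) * m) := by
      simp only [hw₂, hJ]; ring
    constructor
    · refine hjj ?_
      linarith
    · refine hjj (hjj ?_)
      linarith
  have hbN : ∀ t ∈ T₀, ∀ x ∈ I, u ≤ 16 * j * (lam * t + μ - x) ∧
      4 * j * (lam * t + μ - x) ≤ (4 * j - 1) * u := by
    intro t ht x hx
    obtain ⟨h1, h2⟩ := hT₀b t ht
    obtain ⟨h3, h4⟩ := hIb x hx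
    have ht0 : 0 ≤ J * t := le_trans (mul_nonneg (by linarith) hupos.le) h1
    have h5 := mul_le_mul_of_nonneg_right hm1 ht0
    have h6 := mul_le_mul_of_nonneg_right hm2 ht0
    have h7 := mul_le_mul_of_nonneg_left h2 (by linarith : 0 ≤ 2 * a)
    have e1 : j * (16 * j * (lam * t + μ - x)) = lam * (J * t) + J * μ - 2 * (j * (8 * j * x)) := by
      rw [hJ]; ring
    have e2 := mul_le_mul_of_nonneg_left h4 (by linarith : 0 ≤ j)
    have e3 := mul_le_mul_of_nonneg_left h3 (by linarith : 0 ≤ j)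
    constructor
    · refine hjj ?_
      rw [e1]
      linarith
    · refine hjj ?_
      have e4 : a = h - 1 := by linarith
      rw [e4] at h7 h6
      linarith
  have hmon : ∀ {x y : ℤ}, z₀ ≤ x → x ≤ y → P x ≤ P y := fun h1 h2 => G.mono (by norm_num) h1 h2
  have hlab : ∀ ℓ, u ≤ 16 * j * ℓ → ℓ ≤ 2 * u → (1 ≤ ℓ ∧ ℓ ≤ n) ∧ z₀ ≤ ℓ ∧ u ≤ P ℓ ∧ P ℓ ≤ n := by
    intro ℓ h1 h2
    have h3 : z₀ ≤ ℓ := le_of_mul_le_mul_left (huz.trans h1) (by linarith)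
    have h4 : u ≤ P ℓ := by
      have h5 := G.pow_le h3
      have h6 : u ^ 2 ≤ (16 * j * ℓ) ^ 2 := pow_le_pow_left₀ hupos.le h1 _
      have h7 : 512 * j ^ 2 * u ≤ 512 * j ^ 2 * P ℓ := by
        calc 512 * j ^ 2 * u ≤ u * u := mul_le_mul_of_nonneg_right huj hupos.le
          _ ≤ (16 * j * ℓ) ^ 2 := by rw [← sq]; exact h6
          _ = 256 * j ^ 2 * ℓ ^ 2 := by ring
          _ ≤ 256 * j ^ 2 * (2 * P ℓ) := by gcongr
          _ = _ := by ring
      exact le_of_mul_le_mul_left h7 (by positivity)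
    have h5 := hmon h3 h2
    have h6 : 2 * u ≤ n := by
      refine le_trans (G.le_self le_rfl ?_ ?_) hn <;> linarith
    exact ⟨⟨by linarith, by linarith⟩, h3, h4, by linarith⟩
  have h4u : ∀ {ℓ : ℤ}, 4 * j * ℓ ≤ (4 * j - 1) * u → ℓ ≤ u := fun {ℓ} h1 => by
    refine le_of_mul_le_mul_left (a := 4 * j) ?_ (by linarith)
    linarith
  have hw₂u : ∀ t ∈ T₀, u ≤ w₂ t := fun t ht => by
    refine le_of_mul_le_mul_left (a := 4 * j) ?_ (by linarith)
    linarith [(hb₂ t ht).1]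
  have h16 : ∀ {ℓ : ℤ}, u ≤ ℓ → u ≤ 16 * j * ℓ := fun {ℓ} h1 => by
    have : 1 * ℓ ≤ 16 * j * ℓ := mul_le_mul_of_nonneg_right (by linarith) (by linarith)
    linarith
  -- the pairs `(t, x)`
  set T := T₀.filter fun t => w₀ t ∉ B ∧ w₁ t ∉ B ∧ w₂ t ∉ B with hT
  set Ω := (T ×ˢ I).filter fun s => s.2 ∉ B ∧ lam * s.1 + μ - s.2 ∉ B with hΩ
  have hTc : T₀.card ≤ T.card + 3 * B.card := by
    have hcount : ∀ w : ℤ → ℤ, Function.Injective w →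
        (T₀.filter fun t => w t ∈ B).card ≤ B.card := fun w hw =>
      Finset.card_le_card_of_injOn w (fun t ht => (Finset.mem_filter.1 (Finset.mem_coe.1 ht)).2)
        hw.injOn
    have hlin : ∀ p q : ℤ, p ≠ 0 → Function.Injective fun t : ℤ => p * t + q := by
      intro p q hp t t' h
      have h : p * t + q = p * t' + q := h
      exact mul_left_cancel₀ hp (by linarith)
    have h0 := hcount w₀ (hlin _ _ (by linarith))
    have h1 := hcount w₁ (by simpa using hlin (4 * h) 0 (by linarith))
    have h2 := hcount w₂ (hlin _ _ (by linarith))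
    have hsub : T₀ ⊆ T ∪ ((T₀.filter fun t => w₀ t ∈ B) ∪ ((T₀.filter fun t => w₁ t ∈ B) ∪
        (T₀.filter fun t => w₂ t ∈ B))) := by
      intro t ht
      simp only [hT, Finset.mem_union, Finset.mem_filter, ht, true_and]
      tauto
    have h3 := Finset.card_le_card hsub
    have h4 := Finset.card_union_le T ((T₀.filter fun t => w₀ t ∈ B) ∪
      ((T₀.filter fun t => w₁ t ∈ B) ∪ (T₀.filter fun t => w₂ t ∈ B)))
    have h5 := Finset.card_union_le (T₀.filter fun t => w₀ t ∈ B)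
      ((T₀.filter fun t => w₁ t ∈ B) ∪ (T₀.filter fun t => w₂ t ∈ B))
    have h6 := Finset.card_union_le (T₀.filter fun t => w₁ t ∈ B) (T₀.filter fun t => w₂ t ∈ B)
    omega
  have hΩc : T.card * I.card ≤ Ω.card + 2 * (T.card * B.card) := by
    rw [← Finset.card_product, ← Finset.card_product]
    have hsub : T ×ˢ I ⊆ Ω ∪ (T ×ˢ B ∪
        (T ×ˢ I).filter fun s => lam * s.1 + μ - s.2 ∈ B) := by
      rintro ⟨t, x⟩ hs
      have hs' := Finset.mem_product.1 hs
      simp only [hΩ, Finset.mem_union, Finset.mem_filter, hs, true_and, Finset.mem_product, hs'.1]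
      tauto
    have h1 := Finset.card_le_card hsub
    have h2 := Finset.card_union_le Ω (T ×ˢ B ∪
        (T ×ˢ I).filter fun s => lam * s.1 + μ - s.2 ∈ B)
    have h3 := Finset.card_union_le (T ×ˢ B)
        ((T ×ˢ I).filter fun s => lam * s.1 + μ - s.2 ∈ B)
    have h4 : ((T ×ˢ I).filter fun s => lam * s.1 + μ - s.2 ∈ B).card ≤ (T ×ˢ B).card := by
      refine Finset.card_le_card_of_injOn (fun s => (s.1, lam * s.1 + μ - s.2)) ?_ ?_
      · intro s hs
        have hs := Finset.mem_filter.1 (Finset.mem_coe.1 hs)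
        exact Finset.mem_coe.2 (Finset.mem_product.2 ⟨(Finset.mem_product.1 hs.1).1, hs.2⟩)
      · rintro ⟨t, x⟩ _ ⟨t', x'⟩ _ h
        simp only [Prod.mk.injEq] at h
        obtain ⟨rfl, h⟩ := h
        rw [Prod.mk.injEq]
        exact ⟨rfl, by linarith⟩
    omega
  have hbad : Ω.card ≤ 3 * (badPairs P n χ).card := by
    set f₀ : ℤ × ℤ → ℤ × ℤ := fun s => (s.2, w₀ s.1) with hf₀
    set f₂ : ℤ × ℤ → ℤ × ℤ := fun s => (P (w₀ s.1) - s.2, w₂ s.1) with hf₂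
    set f₁ : ℤ × ℤ → ℤ × ℤ := fun s => (P (w₂ s.1) - (P (w₀ s.1) - s.2), w₁ s.1) with hf₁
    have hcount : ∀ f : ℤ × ℤ → ℤ × ℤ, Function.Injective f →
        (Ω.filter fun s => f s ∈ badPairs P n χ).card ≤ (badPairs P n χ).card := fun f hf =>
      Finset.card_le_card_of_injOn f (fun t ht => (Finset.mem_filter.1 (Finset.mem_coe.1 ht)).2)
        hf.injOn
    have c0 := hcount f₀ (by
      rintro ⟨t, x⟩ ⟨t', x'⟩ h
      simp only [hf₀, hw₀, Prod.mk.injEq] at h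
      obtain ⟨rfl, h⟩ := h
      rw [mul_left_cancel₀ (by linarith : 2 * j - 1 ≠ 0)
        (by linarith : (2 * j - 1) * t = (2 * j - 1) * t')])
    have c2 := hcount f₂ (by
      rintro ⟨t, x⟩ ⟨t', x'⟩ h
      simp only [hf₂, Prod.mk.injEq] at h
      obtain ⟨h1, h2⟩ := h
      simp only [hw₂] at h2
      have h3 : t = t' := mul_left_cancel₀ (by linarith : 2 * j + 1 ≠ 0) (by linarith)
      subst h3
      rw [Prod.mk.injEq]
      exact ⟨rfl, by linarith⟩)
    have c1 := hcount f₁ (by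
      rintro ⟨t, x⟩ ⟨t', x'⟩ h
      simp only [hf₁, Prod.mk.injEq] at h
      obtain ⟨h1, h2⟩ := h
      simp only [hw₁] at h2
      have h3 : t = t' := mul_left_cancel₀ (by linarith : 4 * h ≠ 0) (by linarith)
      subst h3
      rw [Prod.mk.injEq]
      exact ⟨rfl, by linarith⟩)
    have hsub : Ω ⊆ (Ω.filter fun s => f₀ s ∈ badPairs P n χ) ∪
        ((Ω.filter fun s => f₂ s ∈ badPairs P n χ) ∪
          (Ω.filter fun s => f₁ s ∈ badPairs P n χ)) := by
      rintro ⟨t, x⟩ hs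
      by_contra hnot
      simp only [Finset.mem_union, Finset.mem_filter, hs, true_and, not_or, hf₀, hf₁, hf₂] at hnot
      obtain ⟨n0, n2, n1⟩ := hnot
      obtain ⟨hs1, hxB, hNB⟩ := Finset.mem_filter.1 hs
      obtain ⟨htT, hx⟩ := Finset.mem_product.1 hs1
      obtain ⟨ht, hB0, hB1, hB2⟩ := Finset.mem_filter.1 htT
      dsimp only at hxB hNB htT hx ht hB0 hB1 hB2
      obtain ⟨x1, x2⟩ := hIb x hx
      have x3 : 4 * j * x ≤ (4 * j - 1) * u := by linarith
      have x4 : x ≤ u := h4u x3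
      have x0 : 0 < x := by
        by_contra! hneg
        have : 16 * j * x ≤ 0 := mul_nonpos_of_nonneg_of_nonpos (by linarith) hneg
        linarith
      have b0 := hb₀ t ht
      have b1 := hb₁ t ht
      have b2 := hb₂ t ht
      have bN := hbN t ht x hx
      have l0 := hlab _ b0.1 (by linarith [h4u b0.2])
      have l1 := hlab _ b1.1 (by linarith [h4u b1.2])
      have l2 := hlab _ (h16 (hw₂u t ht)) b2.2
      have lN := hlab _ bN.1 (by linarith [h4u bN.2])
      have cx := hlow x x1 x3 hxB
      have cN := hlow _ bN.1 bN.2 hNB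
      have cw0 := hlow _ b0.1 b0.2 hB0
      have cw1 := hlow _ b1.1 b1.2 hB1
      have cw2 := hhigh _ b2.1 b2.2 hB2
      have hm02 := hmon l0.2.1 ((h4u b0.2).trans (hw₂u t ht))
      have hNe : P (w₁ t) - (P (w₂ t) - (P (w₀ t) - x)) = lam * t + μ - x := by
        rw [← hid t]; ring
      rw [mem_badPairs] at n0 n1 n2
      have x5 : 64 * x ≤ u := by
        have : 64 * x ≤ 8 * j * x := mul_le_mul_of_nonneg_right (by linarith) x0.le
        linarith
      have r0 : 1 ≤ P (w₀ t) - x ∧ P (w₀ t) - x ≤ n := ⟨by linarith, by linarith⟩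
      have r2 : 1 ≤ P (w₂ t) - (P (w₀ t) - x) ∧ P (w₂ t) - (P (w₀ t) - x) ≤ n :=
        ⟨by linarith, by linarith⟩
      have g0 : χ (P (w₀ t) - x) = !R := by
        by_contra hc
        have hc : χ (P (w₀ t) - x) = R := by simpa using hc
        exact n0 ⟨⟨⟨by linarith, by linarith⟩, l0.1⟩, r0, by rw [cx, cw0], by rw [hc, cw0]⟩
      have g2 : χ (P (w₂ t) - (P (w₀ t) - x)) = R := by
        by_contra hc
        exact n2 ⟨⟨r0, l2.1⟩, r2, by rw [g0, cw2], by rw [cw2]; exact Bool.eq_not.2 hc⟩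
      refine n1 ⟨⟨r2, l1.1⟩, ?_, by rw [g2, cw1], ?_⟩
      · rw [hNe]; exact lN.1
      · rw [hNe, cN, cw1]
    have h1 := Finset.card_le_card hsub
    have h2 := Finset.card_union_le (Ω.filter fun s => f₀ s ∈ badPairs P n χ)
      ((Ω.filter fun s => f₂ s ∈ badPairs P n χ) ∪ (Ω.filter fun s => f₁ s ∈ badPairs P n χ))
    have h3 := Finset.card_union_le (Ω.filter fun s => f₂ s ∈ badPairs P n χ)
      (Ω.filter fun s => f₁ s ∈ badPairs P n χ)
    omega
  have hT₀u : 2 * u - J ≤ J * T₀.card := by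
    have h1 := Int.lt_mul_ediv_self_add (x := (8 * j + 1) * u) hJpos
    have h2 : J * ((8 * j - 1) * u / J) ≤ (8 * j - 1) * u := Int.mul_ediv_self_le hJpos.ne'
    have h3 : (8 * j + 1) * u / J - (8 * j - 1) * u / J ≤ T₀.card := by
      rw [hT₀, Int.card_Icc]; omega
    have h4 := mul_le_mul_of_nonneg_left h3 hJpos.le
    linarith
  have hIu : u - 16 * j ≤ 16 * j * I.card := by
    have h1 := Int.lt_mul_ediv_self_add (x := u) (by linarith : 0 < 8 * j)
    have h2 : 16 * j * (u / (16 * j)) ≤ u := Int.mul_ediv_self_le (by linarith)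
    have h3 : u / (8 * j) - u / (16 * j) ≤ I.card := by
      rw [hI, Int.card_Icc]; omega
    have h4 := mul_le_mul_of_nonneg_left h3 (by linarith : 0 ≤ 16 * j)
    linarith
  zify at hTc hΩc hbad
  set β : ℤ := (B.card : ℤ) with hβ
  have hβ0 : 0 ≤ β := Int.natCast_nonneg _
  have hβj : 8 * (j * β) ≤ j * (j * β) :=
    mul_le_mul_of_nonneg_right hj8 (mul_nonneg (by linarith) hβ0)
  have hj2 : 8 * j ≤ j ^ 2 := by rw [sq]; exact mul_le_mul_of_nonneg_right hj8 (by linarith)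
  have hTu : u ≤ J * T.card := by
    have h1 := mul_le_mul_of_nonneg_left hTc hJpos.le
    have h2 : J * (T.card + 3 * β) = J * T.card + 48 * (j ^ 2 * β) := by rw [hJ]; ring
    linarith
  have hIu' : u ≤ 32 * j * (I.card - 2 * β) := by linarith
  have hTI : T.card * (I.card - 2 * β) ≤ 3 * (badPairs P n χ).card := by linarith
  calc u ^ 2 = u * u := sq u
    _ ≤ (J * T.card) * (32 * j * (I.card - 2 * β)) :=
        mul_le_mul hTu hIu' hupos.le (by positivity)
    _ = J * 32 * j * (T.card * (I.card - 2 * β)) := by ring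
    _ ≤ J * 32 * j * (3 * (badPairs P n χ).card) := by gcongr
    _ = _ := by rw [hJ]; ring

/-! ### Degree two -/

/-- If all labels between `M` and `4 * C * M ^ 2` outside of a small set `B` have the same color,
then almost all pairs of labels `x`, `w` of the order of `M` give a bad edge. -/
theorem Growth.sq_le_card_of_const {P : ℤ → ℤ} {C g z₀ : ℤ} (G : Growth P 2 C g z₀) {n M : ℤ}
    {χ : ℤ → Bool} {R : Bool} {B : Finset ℤ} (hM : z₀ ≤ M) (hM6 : 6 ≤ M)
    (hn : 4 * C * M ^ 2 ≤ n) (hR : ∀ ℓ, M ≤ ℓ → ℓ ≤ 4 * C * M ^ 2 → ℓ ∉ B → χ ℓ = R)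
    (hB : 8 * B.card ≤ M) : M ^ 2 ≤ 16 * ((badPairs P n χ).card + B.card) := by
  classical
  have hC := G.one_le_C
  set X := Finset.Ico M (2 * M) with hX
  set K := Finset.Icc 0 (M / 4) with hK
  set w : ℤ → ℤ := fun k => M + 4 * k with hw
  have hwb : ∀ k ∈ K, M ≤ w k ∧ w k ≤ 2 * M := by
    intro k hk
    have := Finset.mem_Icc.1 hk
    simp only [hw]
    constructor <;> omega
  have hM2 : M ^ 2 = M * M := sq M
  have h6M : 6 * M ≤ M ^ 2 := by rw [hM2]; exact mul_le_mul_of_nonneg_right hM6 (by linarith)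
  have hCM : M ^ 2 ≤ C * M ^ 2 := le_mul_of_one_le_left (by positivity) hC
  have hPw : ∀ k ∈ K, ∀ x ∈ X, M ≤ P (w k) - x ∧ P (w k) - x ≤ 4 * C * M ^ 2 := by
    intro k hk x hx
    obtain ⟨h1, h2⟩ := hwb k hk
    obtain ⟨h3, h4⟩ := Finset.mem_Ico.1 hx
    have h5 := G.pow_le (by linarith : z₀ ≤ w k)
    have h6 := G.le_pow (by linarith : z₀ ≤ w k)
    have h7 : M ^ 2 ≤ w k ^ 2 := pow_le_pow_left₀ (by linarith) h1 _
    have h8 : w k ^ 2 ≤ (2 * M) ^ 2 := pow_le_pow_left₀ (by linarith) h2 _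
    have h9 := mul_le_mul_of_nonneg_left h8 (by linarith : 0 ≤ C)
    constructor <;> linarith
  set K' := K.filter fun k => w k ∉ B with hK'
  set X' := X.filter fun x => x ∉ B with hX'
  have hXc : M ≤ X'.card + B.card := by
    have h1 : X ⊆ X' ∪ B := by
      intro x hx
      simp only [hX', Finset.mem_union, Finset.mem_filter, hx, true_and]
      tauto
    have h2 := (Finset.card_le_card h1).trans (Finset.card_union_le _ _)
    rw [hX, Int.card_Ico] at h2
    omega
  have hwi : Function.Injective w := fun k k' h => by simp only [hw] at h; linarith
  have hKc : M < 4 * (K'.card + B.card) := by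
    have h1 : K ⊆ K' ∪ K.filter fun k => w k ∈ B := by
      intro x hx
      simp only [hK', Finset.mem_union, Finset.mem_filter, hx, true_and]
      tauto
    have h2 := (Finset.card_le_card h1).trans (Finset.card_union_le _ _)
    have h3 : (K.filter fun k => w k ∈ B).card ≤ B.card :=
      Finset.card_le_card_of_injOn w (fun k hk => (Finset.mem_filter.1 (Finset.mem_coe.1 hk)).2)
        hwi.injOn
    have h4 : K.card = (M / 4 + 1 - 0).toNat := Int.card_Icc _ _
    omega
  have hcard : (K' ×ˢ X').card ≤ (badPairs P n χ).card + B.card := by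
    have hcover : K' ×ˢ X' ⊆ ((K' ×ˢ X').filter fun s => (s.2, w s.1) ∈ badPairs P n χ) ∪
        ((K' ×ˢ X').filter fun s => P (w s.1) - s.2 ∈ B) := by
      rintro ⟨k, x⟩ hs
      simp only [Finset.mem_union, Finset.mem_filter, hs, true_and]
      by_contra! hnot
      obtain ⟨hk, hx⟩ := Finset.mem_product.1 hs
      obtain ⟨hk, hkB⟩ := Finset.mem_filter.1 hk
      obtain ⟨hx, hxB⟩ := Finset.mem_filter.1 hx
      dsimp only at hk hkB hx hxB
      have h1 := hPw k hk x hx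
      have h2 := hwb k hk
      have h3 := Finset.mem_Ico.1 hx
      refine hnot.1 (mem_badPairs.2 ⟨⟨⟨?_, ?_⟩, ?_, ?_⟩, ⟨?_, ?_⟩, ?_, ?_⟩)
      any_goals linarith
      · rw [hR x (by linarith) (by linarith) hxB, hR _ h2.1 (by linarith) hkB]
      · rw [hR _ h1.1 h1.2 hnot.2, hR _ h2.1 (by linarith) hkB]
    refine (Finset.card_le_card hcover).trans ((Finset.card_union_le _ _).trans
      (add_le_add ?_ ?_))
    · refine Finset.card_le_card_of_injOn (fun s => (s.2, w s.1))
        (fun s hs => (Finset.mem_filter.1 (Finset.mem_coe.1 hs)).2) ?_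
      rintro ⟨k, x⟩ _ ⟨k', x'⟩ _ h
      simp only [Prod.mk.injEq] at h
      exact Prod.ext (hwi h.2) h.1
    · refine Finset.card_le_card_of_injOn (fun s => P (w s.1) - s.2)
        (fun s hs => (Finset.mem_filter.1 (Finset.mem_coe.1 hs)).2) ?_
      -- `P (w (k + 1)) - P (w k)` exceeds the length `M` of the range of `x`
      have key : ∀ k k' x x', k ∈ K → x ∈ X → x' ∈ X → k < k' →
          P (w k) - x ≠ P (w k') - x' := by
        intro k k' x x' hk hx hx' hkk h
        have h1 := G.le_sub (by norm_num) (hM.trans (hwb k hk).1) (y := w k') (by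
          simp only [hw]; linarith)
        rw [show 2 - 1 = 1 from rfl, pow_one] at h1
        have h2 : 4 * M ≤ (w k' - w k) * w k :=
          mul_le_mul (by simp only [hw]; linarith [Int.add_one_le_of_lt hkk]) (hwb k hk).1
            (by linarith) (by simp only [hw]; linarith)
        have h3 := Finset.mem_Ico.1 hx
        have h4 := Finset.mem_Ico.1 hx'
        linarith
      rintro ⟨k, x⟩ hs ⟨k', x'⟩ hs' h
      obtain ⟨hk, hx⟩ := Finset.mem_product.1 (Finset.mem_filter.1 (Finset.mem_coe.1 hs)).1
      obtain ⟨hk', hx'⟩ := Finset.mem_product.1 (Finset.mem_filter.1 (Finset.mem_coe.1 hs')).1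
      have hk := (Finset.mem_filter.1 hk).1
      have hx := (Finset.mem_filter.1 hx).1
      have hk' := (Finset.mem_filter.1 hk').1
      have hx' := (Finset.mem_filter.1 hx').1
      dsimp only at hk hx hk' hx' h
      rcases lt_trichotomy k k' with hlt | rfl | hlt
      · exact absurd h (key k k' x x' hk hx hx' hlt)
      · rw [Prod.mk.injEq]; exact ⟨rfl, by linarith⟩
      · exact absurd h.symm (key k' k x' x hk' hx' hx hlt)
  rw [Finset.card_product] at hcard
  zify at hcard
  have h1 : M ≤ 8 * K'.card := by linarith
  have h2 : M ≤ 2 * X'.card := by linarith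
  calc M ^ 2 = M * M := sq M
    _ ≤ (8 * K'.card) * (2 * X'.card) := mul_le_mul h1 h2 (by linarith) (by positivity)
    _ = 16 * (K'.card * X'.card) := by ring
    _ ≤ _ := by linarith

set_option maxHeartbeats 1000000 in
/-- The case `d = 2`. Fewer than `c * M ^ 2` bad edges only imply that all labels outside of a set
`B` of size less than a small multiple of `M` have few bad edges. If these do not have a constant
color between `M` and `O(M ^ 2)`, then two consecutive ones `u < u'` have different colors. As the
color changes in one direction only, it is almost constant below and above `u`. -/
theorem Growth.sq_le_card_of_quadratic {P : ℤ → ℤ} {C g z₀ : ℤ} (G : Growth P 2 C g z₀)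
    {a b e : ℤ} (hP : ∀ x, P x = a * x ^ 2 + b * x + e) (ha : 1 ≤ a) :
    ∃ c C' M₀ : ℤ, ∀ (n M : ℤ) (χ : ℤ → Bool), M₀ ≤ M → C' * M ^ (2 ^ 2) ≤ n →
      M ^ 2 ≤ c * (badPairs P n χ).card := by
  classical
  have hC := G.one_le_C
  have hz₀ := G.one_le_z₀
  have hg := G.one_le_g
  obtain ⟨j, hj⟩ : ∃ j, j = 2 * (a + 1) ^ 2 := ⟨_, rfl⟩
  have hj8 : 8 ≤ j := by
    have : 2 ^ 2 ≤ (a + 1) ^ 2 := pow_le_pow_left₀ (by norm_num) (by linarith) _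
    linarith
  obtain ⟨z₁, hsep⟩ := G.sq_le_card_of_separated hP ha rfl hj
  set K := 16 * j with hK
  have hK1 : 128 ≤ K := by linarith
  obtain ⟨k, hk⟩ : ∃ k, k = 2048 * g * C * K ^ 3 := ⟨_, rfl⟩
  obtain ⟨H, z₂, hH, hnr⟩ := G.not_rises (by linarith : 1 ≤ K) hk.ge
  have hkj : 96 * j ^ 2 ≤ k := by
    have h1 : 1 ≤ g * C := one_le_mul_of_one_le_of_one_le hg hC
    have h2 : K ^ 2 ≤ K ^ 3 := pow_le_pow_right₀ (by linarith) (by norm_num)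
    have h3 : 2048 * K ^ 3 ≤ k := by
      rw [hk, show 2048 * g * C * K ^ 3 = g * C * (2048 * K ^ 3) by ring]
      exact le_mul_of_one_le_left (by positivity) h1
    have h4 : K ^ 2 = 256 * j ^ 2 := by rw [hK]; ring
    have h5 : 0 ≤ j ^ 2 := sq_nonneg j
    linarith
  have hj2 : 8 * j ≤ j ^ 2 := by rw [sq]; exact mul_le_mul_of_nonneg_right hj8 (by linarith)
  have hk1 : 1 ≤ k := by linarith
  set U := 4 * C with hU
  set Θ := 24 * k with hΘ
  refine ⟨max 32 (max (1536 * j ^ 3) (Θ * H)) + 1, C * (K * U) ^ 2,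
    max 6 (max z₀ (max z₁ (max z₂ (64 * k)))), ?_⟩
  intro n M χ hM hn
  simp only [max_le_iff] at hM
  obtain ⟨hM6, hMz₀, hMz₁, hMz₂, hMk⟩ := hM
  set S := (badPairs P n χ).card with hS
  have hS0 : (0 : ℤ) ≤ S := Int.natCast_nonneg _
  by_contra! hlt
  have hcS : ∀ c', c' ≤ max 32 (max (1536 * j ^ 3) (Θ * H)) → c' * S < M ^ 2 := fun c' hc' =>
    (mul_le_mul_of_nonneg_right (by linarith) hS0).trans_lt hlt
  have hM2 : M ^ 2 = M * M := sq M
  have hMM : 6 * M ≤ M ^ 2 := by rw [hM2]; exact mul_le_mul_of_nonneg_right hM6 (by linarith)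
  have hUM : 4 * M ^ 2 ≤ U * M ^ 2 := mul_le_mul_of_nonneg_right (by linarith) (by positivity)
  have hKUM : 128 * (U * M ^ 2) ≤ K * (U * M ^ 2) :=
    mul_le_mul_of_nonneg_right hK1 (by positivity)
  have hUM0 : 0 ≤ U * M ^ 2 := by positivity
  have hnU : P (K * (U * M ^ 2)) ≤ n := by
    refine (G.le_pow (by linarith)).trans (le_trans (le_of_eq ?_) hn)
    ring
  have hUn : U * M ^ 2 ≤ n := by
    refine le_trans ?_ hnU
    refine le_trans ?_ (G.le_self le_rfl (by linarith) (by linarith))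
    linarith
  -- the labels with more than `E` bad edges, where `E` is about `M / H`
  set E : ℕ := (M / H).toNat with hE
  set B : Finset ℤ := (Finset.Icc 1 (K * (U * M ^ 2))).filter fun ℓ =>
    E < (badAt P n χ ℓ).card with hB
  have hgood : ∀ ℓ, 1 ≤ ℓ → ℓ ≤ K * (U * M ^ 2) → ℓ ∉ B → (badAt P n χ ℓ).card ≤ E := by
    intro ℓ h1 h2 h3
    by_contra! h4
    exact h3 (Finset.mem_filter.2 ⟨Finset.mem_Icc.2 ⟨h1, h2⟩, h4⟩)
  have hE0 : 0 ≤ M / H := Int.ediv_nonneg (by linarith) (by linarith)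
  have hEM : H * E ≤ M := by
    rw [hE, Int.toNat_of_nonneg hE0]
    exact Int.mul_ediv_self_le (by linarith)
  have hΘB : Θ * B.card ≤ M := by
    have h1 : (E + 1) * B.card ≤ S := by
      have h2 := Finset.card_nsmul_le_sum B (fun ℓ => (badAt P n χ ℓ).card) (E + 1)
        (fun ℓ hℓ => (Finset.mem_filter.1 hℓ).2)
      rw [smul_eq_mul, mul_comm] at h2
      exact h2.trans (sum_card_badAt_le B id (by simp [Set.InjOn]))
    have h2 : M ≤ H * (E + 1) := by
      rw [hE, Int.toNat_of_nonneg hE0]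
      have := Int.lt_mul_ediv_self_add (x := M) (k := H) (by linarith)
      linarith
    have h3 := hcS (Θ * H) ((le_max_right _ _).trans (le_max_right _ _))
    zify at h1
    have h4 : M * (Θ * B.card) ≤ M * M := by
      calc M * (Θ * B.card) ≤ H * (E + 1) * (Θ * B.card) := by gcongr
        _ = Θ * H * ((E + 1) * B.card) := by ring
        _ ≤ Θ * H * S := by gcongr
        _ ≤ M * M := by linarith
    exact le_of_mul_le_mul_left h4 (by linarith)
  have hβ0 : (0 : ℤ) ≤ B.card := Int.natCast_nonneg _
  have hkβ : (B.card : ℤ) ≤ k * B.card := le_mul_of_one_le_left hβ0 hk1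
  have hjβ : 96 * j ^ 2 * B.card ≤ k * B.card := mul_le_mul_of_nonneg_right hkj hβ0
  by_cases hconst : ∃ R, ∀ ℓ, M ≤ ℓ → ℓ ≤ U * M ^ 2 → ℓ ∉ B → χ ℓ = R
  · obtain ⟨R, hR⟩ := hconst
    have h1 := G.sq_le_card_of_const hMz₀ hM6 hUn hR (by linarith)
    have h2 := hcS 32 (le_max_left _ _)
    linarith
  · push Not at hconst
    obtain ⟨p, hp1, hp2, hp3, -⟩ := hconst true
    obtain ⟨q, hq1, hq2, hq3, hq4⟩ := hconst (χ p)
    obtain ⟨u, u', hu1, huu, hu2, hu, hu', hχ, hadj⟩ : ∃ u u', M ≤ u ∧ u < u' ∧ u' ≤ U * M ^ 2 ∧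
        u ∉ B ∧ u' ∉ B ∧ χ u' ≠ χ u ∧ ∀ x, u < x → x < u' → x ∈ B := by
      rcases lt_trichotomy p q with hpq | rfl | hpq
      · obtain ⟨u, u', h1, h2, h3, h4⟩ := exists_adjacent (q - p).toNat p q hpq (by omega) hp3 hq3
          hq4
        exact ⟨u, u', by linarith, h2, by linarith, h4⟩
      · exact absurd rfl hq4
      · obtain ⟨u, u', h1, h2, h3, h4⟩ := exists_adjacent (p - q).toNat q p hpq (by omega) hq3 hp3
          (Ne.symm hq4)
        exact ⟨u, u', by linarith, h2, by linarith, h4⟩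
    have huU : K * u ≤ K * (U * M ^ 2) := mul_le_mul_of_nonneg_left (by linarith) (by linarith)
    have hnu : P (K * u) ≤ n := by
      have h1 : 128 * u ≤ K * u := mul_le_mul_of_nonneg_right hK1 (by linarith)
      exact (G.mono (by norm_num) (by linarith) huU).trans hnU
    have hKu : 128 * u ≤ K * u := mul_le_mul_of_nonneg_right hK1 (by linarith)
    have hu'B : u' ≤ u + B.card + 1 := by
      have h1 : Finset.Ioo u u' ⊆ B := fun x hx => hadj x (Finset.mem_Ioo.1 hx).1
        (Finset.mem_Ioo.1 hx).2
      have h2 := Finset.card_le_card h1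
      rw [Int.card_Ioo] at h2
      omega
    have hgood' : ∀ ℓ, u ≤ K * ℓ → ℓ ≤ K * u → ℓ ∉ B → (badAt P n χ ℓ).card ≤ E := by
      intro ℓ h1 h2 h3
      refine hgood ℓ ?_ (by linarith) h3
      by_contra! h4
      have : K * ℓ ≤ 0 := mul_nonpos_of_nonneg_of_nonpos (by linarith) (by linarith)
      linarith
    have hno := hnr n u χ B E (by linarith) hnu hgood' (by linarith) (by linarith)
    -- the direction in which the color does not change
    obtain ⟨c, hc⟩ : ∃ c, ∀ p q, ¬ Rises χ B K k u c p q := by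
      by_contra! hall
      obtain ⟨p, q, h⟩ := hall true
      obtain ⟨p', q', h'⟩ := hall false
      exact hno true p q p' q' h h'
    have hK0 : (1 : ℤ) ≤ K := by linarith
    have hBk : 8 * k * ((B.card : ℤ) + 2) ≤ u := by linarith
    have heq : ∀ {v}, v ∉ B → _ := fun {v} hv => eq_of_forall_not_rises hk1 hK0 hBk hc (u := v) hv
    have huK : u ≤ K * u := by linarith
    have huK' : u ≤ K * u' := huK.trans (mul_le_mul_of_nonneg_left huu.le (by linarith))
    have hu'K : u' ≤ K * u := by linarith
    obtain ⟨v, v', hv, hv', hvu, hvu', hvc, hvc', hvK, hvK'⟩ : ∃ v v', v ∉ B ∧ v' ∉ B ∧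
        (u ≤ v ∧ v ≤ u') ∧ (u ≤ v' ∧ v' ≤ u') ∧ χ v = c ∧ χ v' = (!c) ∧ u ≤ K * v ∧
        v' ≤ K * u := by
      by_cases hcu : χ u = c
      · exact ⟨u, u', hu, hu', ⟨le_rfl, huu.le⟩, ⟨huu.le, le_rfl⟩, hcu,
          by rw [← hcu]; exact Bool.eq_not.2 hχ, huK, hu'K⟩
      · refine ⟨u', u, hu', hu, ⟨huu.le, le_rfl⟩, ⟨le_rfl, huu.le⟩, ?_, Bool.eq_not.2 hcu, huK',
          by linarith⟩
        exact Bool.eq_of_ne_of_ne hχ (Ne.symm hcu)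
    have hjk : ∀ {x y : ℤ}, 4 * j * x ≤ 4 * j * y → x ≤ y := fun h =>
      le_of_mul_le_mul_left h (by linarith)
    have hju : 2 * (4 * j * ((B.card : ℤ) + 1)) ≤ u := by
      have : 8 * j * B.card ≤ j ^ 2 * B.card := mul_le_mul_of_nonneg_right hj2 hβ0
      linarith
    have hku : 4 * j * u ≤ k * u := mul_le_mul_of_nonneg_right (by linarith) (by linarith)
    have h1 := hsep n u χ (!c) B (by linarith)
      (fun ℓ h1 h2 h3 => by
        refine (heq hv').2 hvc' hvK' (v' - ℓ).toNat ℓ (by omega) (hjk ?_) h1 h3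
        have h4 : u ≤ 2 * (4 * j * (v' - ℓ)) := by
          have : 4 * j * u ≤ 4 * j * v' := mul_le_mul_of_nonneg_left hvu'.1 (by linarith)
          linarith
        have h5 := mul_le_mul_of_nonneg_left h4 (by linarith : 0 ≤ k)
        linarith)
      (fun ℓ h1 h2 h3 => by
        rw [Bool.not_not]
        refine (heq hv).1 hvc hvK (ℓ - v).toNat ℓ (by omega) (hjk ?_) (by linarith) h3
        have h4 : u ≤ 2 * (4 * j * (ℓ - v)) := by
          have : 4 * j * v ≤ 4 * j * (u + B.card + 1) :=
            mul_le_mul_of_nonneg_left (by linarith) (by linarith)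
          linarith
        have h5 := mul_le_mul_of_nonneg_left h4 (by linarith : 0 ≤ k)
        linarith)
      ((G.mono (by norm_num) (by linarith) (by linarith : 2 * u ≤ K * u)).trans hnu)
      (by linarith)
    have h2 := hcS (1536 * j ^ 3) ((le_max_left _ _).trans (le_max_right _ _))
    have h3 : M ^ 2 ≤ u ^ 2 := pow_le_pow_left₀ (by linarith) hu1 _
    linarith

/-! ### The lower bound -/

/-- Bad edges are monochromatic solutions. The coloring of the integers that extends `φ` by `φ 0`
to negative numbers only matters on positive numbers. -/
theorem card_badPairs_le_card_monoSolutions (p : ℤ[X]) (n : ℕ) (φ : ℕ → Bool) :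
    (badPairs (fun x => p.eval x) n fun x => φ x.toNat).card ≤ (monoSolutions p n φ).card := by
  refine Finset.card_le_card_of_injOn
    (fun s => (s.1.toNat, (p.eval s.2 - s.1).toNat, s.2.toNat)) ?_ ?_
  · rintro ⟨x, w⟩ hs
    obtain ⟨⟨⟨h1, h2⟩, h3, h4⟩, ⟨h5, h6⟩, h7, h8⟩ := mem_badPairs.1 (Finset.mem_coe.1 hs)
    refine Finset.mem_coe.2 (Finset.mem_filter.2 ⟨?_, ?_, ?_, ?_⟩)
    · simp only [Finset.mem_product, Finset.mem_Icc]
      omega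
    · simp only
      rw [Int.toNat_of_nonneg (by linarith), Int.toNat_of_nonneg (by linarith),
        Int.toNat_of_nonneg (by linarith)]
      ring
    · exact h7.trans h8.symm
    · exact h8
  · rintro ⟨x, w⟩ hs ⟨x', w'⟩ hs' h
    obtain ⟨⟨h1, h3⟩, _⟩ := mem_badPairs.1 (Finset.mem_coe.1 hs)
    obtain ⟨⟨h1', h3'⟩, _⟩ := mem_badPairs.1 (Finset.mem_coe.1 hs')
    simp only [Prod.mk.injEq] at h ⊢
    omega

/-- There are at least about `M ^ 2` bad edges if `M` is about `n ^ (1 / d ^ 2)`. -/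
theorem exists_sq_le_card {p : ℤ[X]} {d : ℕ} (hd : 2 ≤ d) (hp : p.natDegree = d)
    (hlead : 0 < p.leadingCoeff) (hodd : ¬ IsOddPoly p) :
    ∃ c C' M₀ : ℤ, ∀ (n M : ℤ) (χ : ℤ → Bool), M₀ ≤ M → C' * M ^ (d ^ 2) ≤ n →
      M ^ 2 ≤ c * (badPairs (fun x => p.eval x) n χ).card := by
  obtain ⟨C, g, z₀, G⟩ := exists_growth p hp hlead hodd
  rcases hd.lt_or_eq with h | rfl
  · exact G.sq_le_card_of_three_le h
  · refine G.sq_le_card_of_quadratic (a := p.coeff 2) (b := p.coeff 1) (e := p.coeff 0) ?_ ?_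
    · intro x
      rw [eval_eq_sum_range, hp]
      simp only [Finset.sum_range_succ, Finset.sum_range_zero]
      ring
    · rw [leadingCoeff, hp] at hlead
      linarith

/-- The lower bound for one polynomial. -/
theorem exists_rpow_le_card {p : ℤ[X]} {d : ℕ} (hd : 2 ≤ d) (hp : p.natDegree = d)
    (hlead : 0 < p.leadingCoeff) (hodd : ¬ IsOddPoly p) :
    ∃ c : ℝ, 0 < c ∧ ∀ᶠ n : ℕ in atTop, ∀ φ : ℕ → Bool,
      c * (n : ℝ) ^ (2 / (d : ℝ) ^ 2) ≤ (monoSolutions p n φ).card := by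
  obtain ⟨c, C', M₀, h⟩ := exists_sq_le_card hd hp hlead hodd
  set c₁ : ℝ := max 1 (c : ℝ) with hc₁
  set C₁ : ℝ := max 1 (C' : ℝ) with hC₁
  have hc₁0 : 0 < c₁ := lt_of_lt_of_le one_pos (le_max_left _ _)
  have hC₁0 : 0 < C₁ := lt_of_lt_of_le one_pos (le_max_left _ _)
  have hD : (d ^ 2 : ℕ) ≠ 0 := by positivity
  have hDpos : (0 : ℝ) < ((d ^ 2 : ℕ) : ℝ)⁻¹ := by positivity
  set r : ℕ → ℝ := fun n => ((n : ℝ) / C₁) ^ ((d ^ 2 : ℕ) : ℝ)⁻¹ with hr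
  have hrt : Tendsto r atTop atTop :=
    (tendsto_rpow_atTop hDpos).comp (tendsto_natCast_atTop_atTop.atTop_div_const hC₁0)
  refine ⟨1 / (4 * c₁ * C₁ ^ (2 / (d : ℝ) ^ 2)), by positivity, ?_⟩
  filter_upwards [hrt.eventually_ge_atTop 2, hrt.eventually_ge_atTop (M₀ + 1)] with n h2 hM₀ φ
  have hn0 : 0 ≤ (n : ℝ) / C₁ := by positivity
  set M : ℤ := ⌊r n⌋ with hM
  have hM1 : (M : ℝ) ≤ r n := Int.floor_le _
  have hM2 : r n < M + 1 := Int.lt_floor_add_one _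
  have hM0 : (0 : ℝ) ≤ M := by linarith
  have hrD : r n ^ (d ^ 2) = n / C₁ := Real.rpow_inv_natCast_pow hn0 hD
  have hMn : C' * M ^ (d ^ 2) ≤ (n : ℤ) := by
    have h1 : (M : ℝ) ^ (d ^ 2) ≤ n / C₁ := by
      rw [← hrD]; exact pow_le_pow_left₀ hM0 hM1 _
    have h3 : (C' : ℝ) * (M : ℝ) ^ (d ^ 2) ≤ n := by
      calc (C' : ℝ) * (M : ℝ) ^ (d ^ 2) ≤ C₁ * (n / C₁) :=
            mul_le_mul (le_max_right _ _) h1 (by positivity) hC₁0.le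
        _ = n := by field_simp
    exact_mod_cast h3
  have h4 := h n M (fun x => φ x.toNat) (by
    have : (M₀ : ℝ) < M + 1 := by linarith
    have : M₀ < M + 1 := by exact_mod_cast this
    linarith) hMn
  have h5 := card_badPairs_le_card_monoSolutions p n φ
  have h6 : (M : ℝ) ^ 2 ≤ c₁ * (monoSolutions p n φ).card := by
    have h7 : ((M ^ 2 : ℤ) : ℝ) ≤
        ((c * (badPairs (fun x => p.eval x) n fun x => φ x.toNat).card : ℤ) : ℝ) := by
      exact_mod_cast h4
    push_cast at h7
    refine h7.trans ?_
    refine mul_le_mul (le_max_right _ _) (by exact_mod_cast h5) (by positivity) hc₁0.le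
  have h8 : r n ^ 2 ≤ 4 * (M : ℝ) ^ 2 := by
    have : r n ≤ 2 * M := by linarith
    calc r n ^ 2 ≤ (2 * M) ^ 2 := pow_le_pow_left₀ (by linarith) this _
      _ = _ := by ring
  have h9 : r n ^ 2 = (n : ℝ) ^ (2 / (d : ℝ) ^ 2) / C₁ ^ (2 / (d : ℝ) ^ 2) := by
    rw [← Real.div_rpow (by positivity) hC₁0.le, hr, ← Real.rpow_natCast, ← Real.rpow_mul hn0]
    congr 1
    push_cast
    ring
  have hCr : 0 < C₁ ^ (2 / (d : ℝ) ^ 2) := by positivity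
  rw [h9, div_le_iff₀ hCr] at h8
  rw [div_mul_eq_mul_div, one_mul, div_le_iff₀ (by positivity)]
  calc (n : ℝ) ^ (2 / (d : ℝ) ^ 2) ≤ 4 * (M : ℝ) ^ 2 * C₁ ^ (2 / (d : ℝ) ^ 2) := h8
    _ ≤ 4 * (c₁ * (monoSolutions p n φ).card) * C₁ ^ (2 / (d : ℝ) ^ 2) := by gcongr
    _ = _ := by ring

theorem finite_nonOddPolys (d K : ℕ) : (nonOddPolys d K).Finite := by
  have h1 : (Set.univ.pi fun _ : Fin (d + 1) => Set.Icc (-(K : ℤ)) K).Finite :=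
    Set.Finite.pi fun _ => Set.finite_Icc _ _
  refine (h1.image fun f => ∑ i : Fin (d + 1), monomial (i : ℕ) (f i)).subset ?_
  rintro p ⟨hd, _, _, hK⟩
  refine ⟨fun i => p.coeff i, ?_, ?_⟩
  · rintro i -
    have h2 : (p.coeff i).natAbs ≤ K := by
      rw [← hK, polyNorm, hd]
      have := Finset.single_le_sum (f := fun i => (p.coeff i).natAbs) (fun _ _ => Nat.zero_le _)
        (Finset.mem_range.2 i.2)
      exact le_add_left this
    show -(K : ℤ) ≤ p.coeff i ∧ p.coeff i ≤ K
    omega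
  · simp only
    rw [Fin.sum_univ_eq_sum_range (fun i => monomial i (p.coeff i)) (d + 1)]
    exact (p.as_sum_range' (d + 1) (by omega)).symm

/-- The lower bound, uniformly for all polynomials of a given degree and norm: there are only
finitely many. -/
theorem exists_forall_rpow_le_card {d : ℕ} (hd : 2 ≤ d) (K : ℕ) :
    ∃ c : ℝ, 0 < c ∧ ∀ᶠ n : ℕ in atTop, ∀ p ∈ nonOddPolys d K, ∀ φ : ℕ → Bool,
      c * (n : ℝ) ^ (2 / (d : ℝ) ^ 2) ≤ (monoSolutions p n φ).card := by
  have h : ∀ p : ℤ[X], ∃ c : ℝ, 0 < c ∧ (p ∈ nonOddPolys d K → ∀ᶠ n : ℕ in atTop, ∀ φ : ℕ → Bool,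
      c * (n : ℝ) ^ (2 / (d : ℝ) ^ 2) ≤ (monoSolutions p n φ).card) := by
    intro p
    by_cases hp : p ∈ nonOddPolys d K
    · obtain ⟨c, hc, h⟩ := exists_rpow_le_card hd hp.1 hp.2.1 hp.2.2.1
      exact ⟨c, hc, fun _ => h⟩
    · exact ⟨1, one_pos, fun h => absurd h hp⟩
  choose c hc h using h
  have hfin := finite_nonOddPolys d K
  obtain ⟨c₀, hc₀, hle⟩ : ∃ c₀ : ℝ, 0 < c₀ ∧ ∀ p ∈ nonOddPolys d K, c₀ ≤ c p := by
    rcases (nonOddPolys d K).eq_empty_or_nonempty with h0 | h0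
    · exact ⟨1, one_pos, by simp [h0]⟩
    · obtain ⟨p, hp, hmin⟩ := Set.exists_min_image _ c hfin h0
      exact ⟨c p, hc p, hmin⟩
  refine ⟨c₀, hc₀, ?_⟩
  filter_upwards [(eventually_all_finite hfin).2 fun p hp => h p hp] with n hn p hp φ
  refine le_trans ?_ (hn p hp φ)
  exact mul_le_mul_of_nonneg_right (hle p hp) (by positivity)

/-! ### A coloring with few solutions -/

/-- The upper bound for one polynomial. With `N` the largest `m ≤ n` with `p m ≤ 2 n`, the coloring
by `m > N ∨ p m ≤ 2 N` has few monochromatic solutions `x + y = p z`. Indeed `z ≤ N`, as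
`p z ≤ 2 n`. If `p z > 2 N`, then one of `x`, `y` is larger than `N` and has another color than
`z`. Otherwise the one of `x`, `y` that is at most `N` has the color of `z`, so it is, like `z`,
among the `O(n ^ (1 / d ^ 2))` numbers `m ≤ N` with `p m ≤ 2 N`. -/
theorem exists_card_le_rpow {p : ℤ[X]} {d : ℕ} (hd : 2 ≤ d) (hp : p.natDegree = d)
    (hlead : 0 < p.leadingCoeff) (hodd : ¬ IsOddPoly p) :
    ∃ C : ℝ, 0 < C ∧ ∀ n : ℕ, 1 ≤ n → ∃ φ : ℕ → Bool,
      ((monoSolutions p n φ).card : ℝ) ≤ C * (n : ℝ) ^ (2 / (d : ℝ) ^ 2) := by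
  classical
  obtain ⟨C, g, z₀, G⟩ := exists_growth p hp hlead hodd
  have hz₀ := G.one_le_z₀
  have hz₀' : (1 : ℝ) ≤ z₀ := by exact_mod_cast hz₀
  refine ⟨2 * (z₀ + 16) ^ 2, by positivity, fun n hn => ?_⟩
  set s := (Finset.Icc 1 n).filter fun m : ℕ => p.eval (m : ℤ) ≤ 2 * n with hs
  set N := s.sup id with hN
  set B := (Finset.Icc 1 N).filter fun m : ℕ => p.eval (m : ℤ) ≤ 2 * N with hB
  refine ⟨fun m => decide (N < m ∨ p.eval (m : ℤ) ≤ 2 * N), ?_⟩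
  have hsol : ∀ t ∈ monoSolutions p n fun m => decide (N < m ∨ p.eval (m : ℤ) ≤ 2 * N),
      t.2.2 ∈ B ∧ (t.1 ∈ B ∨ t.2.1 ∈ B) ∧ (t.1 : ℤ) + t.2.1 = p.eval (t.2.2 : ℤ) := by
    rintro ⟨x, y, z⟩ ht
    obtain ⟨h1, h2, h3, h4⟩ := Finset.mem_filter.1 ht
    simp only [Finset.mem_product, Finset.mem_Icc] at h1
    simp only at h2 h3 h4
    have hzN : z ≤ N := by
      have : z ∈ s := Finset.mem_filter.2 ⟨Finset.mem_Icc.2 h1.2.2, by rw [← h2]; omega⟩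
      exact Finset.le_sup (f := id) this
    by_cases hz : p.eval (z : ℤ) ≤ 2 * N
    · have hx : N < x ∨ p.eval (x : ℤ) ≤ 2 * N := by simpa [hz] using h3.trans h4
      have hy : N < y ∨ p.eval (y : ℤ) ≤ 2 * N := by simpa [hz] using h4
      refine ⟨Finset.mem_filter.2 ⟨Finset.mem_Icc.2 ⟨h1.2.2.1, hzN⟩, hz⟩, ?_, h2⟩
      rcases le_or_gt x N with hxN | hxN
      · exact Or.inl (Finset.mem_filter.2 ⟨Finset.mem_Icc.2 ⟨h1.1.1, hxN⟩, by
          rcases hx with hx | hx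
          · omega
          · exact hx⟩)
      · have hyN : y ≤ N := by omega
        exact Or.inr (Finset.mem_filter.2 ⟨Finset.mem_Icc.2 ⟨h1.2.1.1, hyN⟩, by
          rcases hy with hy | hy
          · omega
          · exact hy⟩)
    · exfalso
      have hz' : ¬ (N < z ∨ p.eval (z : ℤ) ≤ 2 * N) := by
        push Not at hz ⊢; exact ⟨hzN, hz⟩
      have hy : ¬ (N < y ∨ p.eval (y : ℤ) ≤ 2 * N) := by
        intro hy
        simp only [hy, hz', decide_true, decide_false] at h4
        exact absurd h4 (by decide)
      have hx : ¬ (N < x ∨ p.eval (x : ℤ) ≤ 2 * N) := by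
        intro hx
        simp only [hx, hy, decide_true, decide_false] at h3
        exact absurd h3 (by decide)
      omega
  have hcard : (monoSolutions p n fun m => decide (N < m ∨ p.eval (m : ℤ) ≤ 2 * N)).card ≤
      2 * (B.card * B.card) := by
    rw [show 2 * (B.card * B.card) = (B ×ˢ B).card + (B ×ˢ B).card by
      rw [Finset.card_product, two_mul]]
    set S := monoSolutions p n fun m => decide (N < m ∨ p.eval (m : ℤ) ≤ 2 * N) with hS
    have hsub : S ⊆ (S.filter fun t => t.1 ∈ B) ∪ (S.filter fun t => t.2.1 ∈ B) := by
      intro t ht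
      simp only [Finset.mem_union, Finset.mem_filter, ht, true_and]
      exact (hsol t ht).2.1
    refine (Finset.card_le_card hsub).trans ((Finset.card_union_le _ _).trans
      (add_le_add ?_ ?_))
    · refine Finset.card_le_card_of_injOn (fun t => (t.1, t.2.2)) ?_ ?_
      · intro t ht
        have ht := Finset.mem_filter.1 (Finset.mem_coe.1 ht)
        exact Finset.mem_coe.2 (Finset.mem_product.2 ⟨ht.2, (hsol t ht.1).1⟩)
      · rintro ⟨x, y, z⟩ ht ⟨x', y', z'⟩ ht' h
        have e1 := (hsol _ (Finset.mem_filter.1 (Finset.mem_coe.1 ht)).1).2.2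
        have e2 := (hsol _ (Finset.mem_filter.1 (Finset.mem_coe.1 ht')).1).2.2
        simp only [Prod.mk.injEq] at h e1 e2 ⊢
        obtain ⟨rfl, rfl⟩ := h
        refine ⟨rfl, ?_, rfl⟩
        omega
    · refine Finset.card_le_card_of_injOn (fun t => (t.2.1, t.2.2)) ?_ ?_
      · intro t ht
        have ht := Finset.mem_filter.1 (Finset.mem_coe.1 ht)
        exact Finset.mem_coe.2 (Finset.mem_product.2 ⟨ht.2, (hsol t ht.1).1⟩)
      · rintro ⟨x, y, z⟩ ht ⟨x', y', z'⟩ ht' h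
        have e1 := (hsol _ (Finset.mem_filter.1 (Finset.mem_coe.1 ht)).1).2.2
        have e2 := (hsol _ (Finset.mem_filter.1 (Finset.mem_coe.1 ht')).1).2.2
        simp only [Prod.mk.injEq] at h e1 e2 ⊢
        obtain ⟨rfl, rfl⟩ := h
        refine ⟨?_, rfl, rfl⟩
        omega
  -- the size of `B`
  have hD : (d ^ 2 : ℕ) ≠ 0 := by positivity
  set ρ : ℝ := (n : ℝ) ^ ((d ^ 2 : ℕ) : ℝ)⁻¹ with hρ
  have hn1 : (1 : ℝ) ≤ n := by exact_mod_cast hn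
  have hρ1 : 1 ≤ ρ := Real.one_le_rpow hn1 (by positivity)
  have hρD : ρ ^ (d ^ 2) = n := Real.rpow_inv_natCast_pow (by positivity) hD
  have hmB : ∀ m ∈ B, (m : ℝ) ≤ (z₀ + 16) * ρ := by
    intro m hm
    obtain ⟨h1, h2⟩ := Finset.mem_filter.1 hm
    obtain ⟨h1, hmN⟩ := Finset.mem_Icc.1 h1
    rcases lt_or_ge (m : ℤ) z₀ with hmz | hmz
    · have : (m : ℝ) ≤ z₀ := by exact_mod_cast hmz.le
      nlinarith
    · have hs0 : s.Nonempty := by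
        by_contra hs0
        have : N = 0 := by rw [hN, Finset.not_nonempty_iff_eq_empty.1 hs0]; rfl
        omega
      obtain ⟨N', hN's, hN'⟩ := Finset.exists_mem_eq_sup s hs0 id
      have hNs : p.eval (N : ℤ) ≤ 2 * n := by
        rw [hN, hN']
        exact (Finset.mem_filter.1 hN's).2
      have h3 := G.pow_le hmz
      have h4 := G.pow_le (x := N) (by omega)
      have h5 : (m : ℤ) ^ d ≤ 4 * N := by linarith
      have h6 : (N : ℤ) ^ d ≤ 4 * n := by linarith
      have h7 : (m : ℤ) ^ (d ^ 2) ≤ 16 ^ (d ^ 2) * n := by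
        calc (m : ℤ) ^ (d ^ 2) = ((m : ℤ) ^ d) ^ d := by rw [← pow_mul, sq]
          _ ≤ (4 * N) ^ d := pow_le_pow_left₀ (by positivity) h5 _
          _ = 4 ^ d * (N : ℤ) ^ d := mul_pow _ _ _
          _ ≤ 4 ^ d * (4 * n) := by gcongr
          _ = 4 ^ (d + 1) * n := by ring
          _ ≤ 4 ^ (2 * d ^ 2) * n := by
            have : d + 1 ≤ 2 * d ^ 2 := by nlinarith
            gcongr
            norm_num
          _ = _ := by rw [pow_mul]; norm_num
      have h8 : (m : ℝ) ^ (d ^ 2) ≤ (16 * ρ) ^ (d ^ 2) := by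
        rw [mul_pow, hρD]
        exact_mod_cast h7
      have h9 : (m : ℝ) ≤ 16 * ρ := le_of_pow_le_pow_left₀ hD (by positivity) h8
      nlinarith
  have hBc : (B.card : ℝ) ≤ (z₀ + 16) * ρ := by
    have h0 : 0 ≤ ((z₀ : ℝ) + 16) * ρ := by positivity
    have hsub : B ⊆ Finset.Icc 1 ⌊((z₀ : ℝ) + 16) * ρ⌋₊ := by
      intro m hm
      have h1 := (Finset.mem_Icc.1 (Finset.mem_filter.1 hm).1).1
      exact Finset.mem_Icc.2 ⟨h1, Nat.le_floor (hmB m hm)⟩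
    have h1 := Finset.card_le_card hsub
    rw [Nat.card_Icc, Nat.add_sub_cancel] at h1
    exact (Nat.cast_le.2 h1).trans (Nat.floor_le h0)
  have hρ2 : ρ ^ 2 = (n : ℝ) ^ (2 / (d : ℝ) ^ 2) := by
    rw [hρ, ← Real.rpow_natCast, ← Real.rpow_mul (by positivity)]
    congr 1
    push_cast
    ring
  calc ((monoSolutions p n _).card : ℝ) ≤ 2 * (B.card * B.card) := by exact_mod_cast hcard
    _ ≤ 2 * (((z₀ + 16) * ρ) * ((z₀ + 16) * ρ)) := by gcongr
    _ = 2 * (z₀ + 16) ^ 2 * ρ ^ 2 := by ring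
    _ = _ := by rw [hρ2]

theorem exists_forall_card_le_rpow {d : ℕ} (hd : 2 ≤ d) (K : ℕ) :
    ∃ C : ℝ, 0 < C ∧ ∀ n : ℕ, 1 ≤ n → ∀ p ∈ nonOddPolys d K, ∃ φ : ℕ → Bool,
      ((monoSolutions p n φ).card : ℝ) ≤ C * (n : ℝ) ^ (2 / (d : ℝ) ^ 2) := by
  have h : ∀ p : ℤ[X], ∃ C : ℝ, 0 < C ∧ (p ∈ nonOddPolys d K → ∀ n : ℕ, 1 ≤ n → ∃ φ : ℕ → Bool,
      ((monoSolutions p n φ).card : ℝ) ≤ C * (n : ℝ) ^ (2 / (d : ℝ) ^ 2)) := by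
    intro p
    by_cases hp : p ∈ nonOddPolys d K
    · obtain ⟨C, hC, h⟩ := exists_card_le_rpow hd hp.1 hp.2.1 hp.2.2.1
      exact ⟨C, hC, fun _ => h⟩
    · exact ⟨1, one_pos, fun h => absurd h hp⟩
  choose C hC h using h
  obtain ⟨C₀, hC₀, hle⟩ : ∃ C₀ : ℝ, 0 < C₀ ∧ ∀ p ∈ nonOddPolys d K, C p ≤ C₀ := by
    rcases (nonOddPolys d K).eq_empty_or_nonempty with h0 | h0
    · exact ⟨1, one_pos, by simp [h0]⟩
    · obtain ⟨p, hp, hmax⟩ := Set.exists_max_image _ C (finite_nonOddPolys d K) h0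
      exact ⟨C p, hC p, hmax⟩
  refine ⟨C₀, hC₀, fun n hn p hp => ?_⟩
  obtain ⟨φ, hφ⟩ := h p hp n hn
  exact ⟨φ, hφ.trans (mul_le_mul_of_nonneg_right (hle p hp) (by positivity))⟩

/-! ### Comparison of the error terms -/

/-- A constant factor as a correction of the exponent. -/
theorem rpow_sub_neg_log_div_log {c x a : ℝ} (hc : 0 < c) (hx : 1 < x) :
    x ^ (a - -Real.log c / Real.log x) = c * x ^ a := by
  have hlog : Real.log x ≠ 0 := (Real.log_pos hx).ne'
  rw [sub_eq_add_neg, neg_div, neg_neg, Real.rpow_add (by linarith), mul_comm]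
  congr 1
  rw [Real.rpow_def_of_pos (by linarith), mul_div_cancel₀ _ hlog, Real.exp_log hc]

/-- The factor `x ^ (-1 / log log x)` is smaller than any constant. -/
theorem eventually_rpow_sub_le {c : ℝ} (hc : 0 < c) (a : ℝ) : ∀ᶠ n : ℕ in atTop,
    (n : ℝ) ^ (a - 1 * (1 / Real.logb 2 (Real.logb 2 n))) ≤ c * (n : ℝ) ^ a := by
  have hlogb : Tendsto (fun n : ℕ => Real.logb 2 (n : ℝ)) atTop atTop :=
    (Real.tendsto_logb_atTop (by norm_num)).comp tendsto_natCast_atTop_atTop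
  have hll := (Real.tendsto_logb_atTop (b := 2) (by norm_num)).comp hlogb
  have hl2 : 0 < Real.log 2 := Real.log_pos (by norm_num)
  have hlittle := (Real.isLittleO_log_id_atTop.comp_tendsto hlogb).def
    (c := Real.log 2 * Real.log 2 / (|Real.log c| + 1)) (by positivity)
  filter_upwards [hlogb.eventually_ge_atTop 2, hll.eventually_ge_atTop 1, hlittle,
    eventually_gt_atTop 1] with n h1 h2 h3 h4
  have hn : (1 : ℝ) < n := by exact_mod_cast h4
  have hlog : 0 < Real.log n := Real.log_pos hn
  simp only [Function.comp_apply, id] at h2 h3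
  set y := Real.logb 2 (n : ℝ) with hy
  have hy' : y * Real.log 2 = Real.log n := by
    rw [hy, Real.logb]; field_simp
  have hly : 0 ≤ Real.log y := Real.log_nonneg (by linarith)
  rw [Real.norm_of_nonneg hly, Real.norm_of_nonneg (by linarith)] at h3
  rw [← rpow_sub_neg_log_div_log hc hn]
  refine Real.rpow_le_rpow_of_exponent_le hn.le (sub_le_sub_left ?_ _)
  rw [one_mul, div_le_div_iff₀ hlog (by linarith), one_mul, ← hy']
  have h5 : (|Real.log c| + 1) * Real.log y ≤ Real.log 2 * Real.log 2 * y := by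
    have := mul_le_mul_of_nonneg_left h3 (by positivity : 0 ≤ |Real.log c| + 1)
    refine this.trans (le_of_eq ?_)
    field_simp
  have h6 : -Real.log c * Real.log y ≤ (|Real.log c| + 1) * Real.log y :=
    mul_le_mul_of_nonneg_right (by linarith [neg_le_abs (Real.log c)]) hly
  rw [Real.logb, ← mul_div_assoc, div_le_iff₀ hl2]
  linarith

theorem theorem1p3 (d K : ℕ) (hd : 2 ≤ d) :
    -- at least `n ^ (2 / d² - o(1))` monochromatic solutions
    (∃ ε : ℕ → ℝ, Tendsto ε atTop (𝓝 0) ∧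
      ∀ᶠ n : ℕ in atTop, ∀ p ∈ nonOddPolys d K, ∀ φ : ℕ → Bool,
        (n : ℝ) ^ (2 / (d : ℝ) ^ 2 - ε n) ≤ ((monoSolutions p n φ).card : ℝ)) ∧
    -- for `d ≥ 3`, the lower bound `Ω(n ^ (2 / d²) / log n)`
    (3 ≤ d → ∃ c : ℝ, 0 < c ∧
      ∀ᶠ n : ℕ in atTop, ∀ p ∈ nonOddPolys d K, ∀ φ : ℕ → Bool,
        c * ((n : ℝ) ^ (2 / (d : ℝ) ^ 2) / Real.logb 2 n) ≤ ((monoSolutions p n φ).card : ℝ)) ∧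
    -- for `d = 2`, the lower bound `n ^ (2 / d² - O(1 / log log n))`
    (d = 2 → ∃ C : ℝ, 0 < C ∧
      ∀ᶠ n : ℕ in atTop, ∀ p ∈ nonOddPolys d K, ∀ φ : ℕ → Bool,
        (n : ℝ) ^ (2 / (d : ℝ) ^ 2 - C * (1 / Real.logb 2 (Real.logb 2 n))) ≤
          ((monoSolutions p n φ).card : ℝ)) ∧
    -- the matching upper bound: some coloring has only `O(n ^ (2 / d²))` monochromatic solutions
    (∃ C : ℝ, 0 < C ∧
      ∀ n : ℕ, 1 ≤ n → ∀ p ∈ nonOddPolys d K, ∃ φ : ℕ → Bool,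
        ((monoSolutions p n φ).card : ℝ) ≤ C * (n : ℝ) ^ (2 / (d : ℝ) ^ 2)) := by
  obtain ⟨c, hc, h⟩ := exists_forall_rpow_le_card hd K
  refine ⟨⟨fun n => -Real.log c / Real.log n, ?_, ?_⟩, fun _ => ⟨c, hc, ?_⟩,
    fun _ => ⟨1, one_pos, ?_⟩, exists_forall_card_le_rpow hd K⟩
  · exact tendsto_const_nhds.div_atTop (Real.tendsto_log_atTop.comp tendsto_natCast_atTop_atTop)
  · filter_upwards [h, eventually_gt_atTop 1] with n hn h1 p hp φ
    rw [rpow_sub_neg_log_div_log hc (by exact_mod_cast h1)]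
    exact hn p hp φ
  · filter_upwards [h, eventually_ge_atTop 2] with n hn h2 p hp φ
    refine le_trans ?_ (hn p hp φ)
    refine mul_le_mul_of_nonneg_left (div_le_self (by positivity) ?_) hc.le
    rw [Real.le_logb_iff_rpow_le (by norm_num) (by positivity), Real.rpow_one]
    exact_mod_cast h2
  · filter_upwards [h, eventually_rpow_sub_le hc (2 / (d : ℝ) ^ 2)] with n hn h1 p hp φ
    exact h1.trans (hn p hp φ)
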